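/- Let $E$ be a connected smooth manifold (finite-dimensional, Hausdorff, second countable), $\sigma$ a closed smooth $2$-form on $E$, and $\hbar>0$. A \emph{prequantisation} of $(E,\sigma)$ is a triple $(Y,\omega,\pi)$ where $\pi:Y\to E$ is a smooth principal $\mathrm{U}(1)$-bundle and $\omega$ is a smooth $\mathrm{U}(1)$-invariant $1$-form on $Y$ which takes the value $\hbar$ on the generator $\frac{d}{dt}\big|_{0}\,e^{it}\cdot y$ of the action (so that locally $\omega=\theta+\hbar\,\frac{dz}{iz}$) and satisfies $d\omega=\pi^*\sigma$. Two prequantisations of $(E,\sigma)$ are \emph{equivalent} if there is a $\mathrm{U}(1)$-equivariant diffeomorphism between their total spaces which covers the identity of $E$ and pulls one $1$-form back to the other. Assume that $(E,\sigma)$ is prequantisable and fix a reference prequantisation $(Y_0,\omega_0,\pi_0)$ and a base point $e\in E$. \textbf{Theorem.} There is a bijection $\Phi$ from the set of characters $\chi:\pi_1(E,e)\to\mathrm{U}(1)$ (group homomorphisms) onto the set of equivalence classes of prequantisations of $(E,\sigma)$, such that the following holds for every universal covering $q:\widetilde E\to E$ (a simply connected smooth covering) with base point $\tilde e\in q^{-1}(e)$.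 Sending a covering transformation $\tau$ to the class of the loop $q\circ c$, where $c$ is a path from $\tilde e$ to $\tau\tilde e$, is a bijection from the covering transformations of $q$ onto $\pi_1(E,e)$; write $\tau=g$ for the covering transformation with class $g$. Let $q^*(Y_0,\omega_0,\pi_0)=(\widetilde Y_0,\widetilde\omega_0,\widetilde\pi_0)$ be the pulled-back prequantisation of $(\widetilde E,q^*\sigma)$, with total space $\{(\tilde x,\xi)\in\widetilde E\times Y_0 : q(\tilde x)=\pi_0(\xi)\}$. For every character $\chi$: (i) the maps $\hat g^{\chi}(\tilde x,\xi)=\big(g\tilde x,\ \chi(g)\cdot\xi\big)$ define an action of the group of covering transformations on $\widetilde Y_0$ that lifts its action on $\widetilde E$, by smooth maps that commute with $\mathrm{U}(1)$ and preserve $\widetilde\omega_0$; (ii) $\Phi(\chi)$ is the class of the quotient $(Y_\chi,\omega_\chi,\pi_\chi)=(\widetilde Y_0,\widetilde\omega_0,\widetilde\pi_0)/\hat\pi_1^{\chi}$. Precisely, a prequantisation $(Y,\omega,\pi)$ of $(E,\sigma)$ belongs to the class $\Phi(\chi)$ if and only if there is a surjective local diffeomorphism $p:\widetilde Y_0\to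 Y$, $\mathrm{U}(1)$-equivariant and covering $q$, whose fibres are exactly the orbits of the action in (i), and with $p^*\omega=\widetilde\omega_0$. -/

import Mathlib

open scoped Manifold ContDiff

universe u

namespace Prequant

noncomputable section

open Set

section Forms
variable {F H F' H' F'' H'' M M' M'' : Type*}
  [NormedAddCommGroup F] [NormedSpace ℝ F] [TopologicalSpace H]
  [NormedAddCommGroup F'] [NormedSpace ℝ F'] [TopologicalSpace H']
  [NormedAddCommGroup F''] [NormedSpace ℝ F''] [TopologicalSpace H'']
  [TopologicalSpace M] [ChartedSpace H M] [TopologicalSpace M'] [ChartedSpace H' M']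
  [TopologicalSpace M''] [ChartedSpace H'' M'']
  {I : ModelWithCorners ℝ F H} {I' : ModelWithCorners ℝ F' H'} {I'' : ModelWithCorners ℝ F'' H''}
  {k : ℕ}

/-- Differential `k`-forms (not necessarily smooth) on a manifold `M`. -/
abbrev DForm (I : ModelWithCorners ℝ F H) (M : Type*) [TopologicalSpace M] [ChartedSpace H M]
    (k : ℕ) := ∀ x : M, TangentSpace I x [⋀^Fin k]→L[ℝ] ℝ

/-- The pullback `f^*α` of a form along a (differentiable) map `f`. -/
def DForm.pull (f : M → M') (α : DForm I' M' k) : DForm I M k := fun x =>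
  (α (f x)).compContinuousLinearMap (mfderiv I I' f x)

/-- The expression of a form in the preferred chart at `x₀`: its pullback along the inverse of the
chart, a form on the open subset `(extChartAt I x₀).target` of the model space
(all manifolds below are without boundary). -/
def DForm.inChart (α : DForm I M k) (x₀ : M) (v : F) : F [⋀^Fin k]→L[ℝ] ℝ :=
  (α ((extChartAt I x₀).symm v)).compContinuousLinearMap
    (mfderiv 𝓘(ℝ, F) I (extChartAt I x₀).symm v)

/-- A form is smooth if its coordinate expressions are. -/
def DForm.Smooth (α : DForm I M k) : Prop :=
  ∀ x₀ : M, ContDiffOn ℝ ∞ (α.inChart x₀) (extChartAt I x₀).target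

/-- The exterior derivative of a smooth form on a manifold without boundary: at `x` it is computed in
the preferred chart at `x`. -/
def DForm.d (α : DForm I M k) : DForm I M (k + 1) := fun x =>
  (extDeriv (α.inChart x) (extChartAt I x x)).compContinuousLinearMap
    (mfderiv I 𝓘(ℝ, F) (extChartAt I x) x)

theorem DForm.pull_comp {f : M → M'} {g : M' → M''} (hg : MDifferentiable I' I'' g)
    (hf : MDifferentiable I I' f) (α : DForm I'' M'' k) :
    DForm.pull (I := I) f (DForm.pull (I := I') g α) = DForm.pull (I := I) (g ∘ f) α := by
  funext x
  simp only [DForm.pull, mfderiv_comp x (hg (f x)) (hf x)]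
  rfl

theorem DForm.pull_id (α : DForm I M k) : DForm.pull (I := I) id α = α := by
  funext x
  simp only [DForm.pull, mfderiv_id]
  rfl

/-- The smooth structure lifted along a local homeomorphism `s : P → M`. -/
@[reducible]
def liftCharts {P : Type*} [TopologicalSpace P] {s : P → M} (hs : IsLocalHomeomorph s) :
    ChartedSpace H P where
  atlas := {e | ∃ p, e = (hs.localInverseAt p).symm.trans (chartAt H (s p))}
  chartAt p := (hs.localInverseAt p).symm.trans (chartAt H (s p))
  mem_chart_source p := by simp
  chart_mem_atlas p := ⟨p, rfl⟩

section lift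
variable {P : Type*} [TopologicalSpace P] {s : P → M} (hs : IsLocalHomeomorph s)

theorem liftCharts_isManifold [IsManifold I ∞ M] :
    @IsManifold ℝ _ F _ _ H _ I ∞ P _ (liftCharts hs) := by
  let _ := liftCharts (H := H) hs
  refine { compatible := ?_ }
  rintro e e' ⟨p, rfl⟩ ⟨p', rfl⟩
  set f := (hs.localInverseAt p).symm with hf
  set f' := (hs.localInverseAt p').symm with hf'
  have cf : ⇑f = s := by simp [hf]
  have cf' : ⇑f' = s := by simp [hf']
  have hc : (chartAt H (s p)).symm.trans (chartAt H (s p')) ∈ contDiffGroupoid ∞ I :=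
    HasGroupoid.compatible (chart_mem_atlas H _) (chart_mem_atlas H _)
  set A := (f.trans (chartAt H (s p))).symm.trans (f'.trans (chartAt H (s p'))) with hA
  have h2 := closedUnderRestriction' hc A.open_source
  refine StructureGroupoid.mem_of_eqOnSource _ h2 ?_
  have key : ∀ x ∈ A.source, x ∈ (chartAt H (s p)).target ∧
      (chartAt H (s p)).symm x ∈ (chartAt H (s p')).source ∧
      A x = (chartAt H (s p')) ((chartAt H (s p)).symm x) := by
    intro x hx
    simp only [hA, OpenPartialHomeomorph.trans_source, OpenPartialHomeomorph.symm_source,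
      mem_inter_iff, mem_preimage,
      OpenPartialHomeomorph.coe_trans, OpenPartialHomeomorph.trans_symm_eq_symm_trans_symm,
      Function.comp_apply, cf'] at hx ⊢
    obtain ⟨⟨h1, h2⟩, h3, h4⟩ := hx
    have h5 : s (f.symm ((chartAt H (s p)).symm x)) = (chartAt H (s p)).symm x := by
      have := f.right_inv h2
      rwa [cf] at this
    rw [h5] at h4 ⊢
    exact ⟨h1, h4, rfl⟩
  refine ⟨?_, ?_⟩
  · ext x
    rw [OpenPartialHomeomorph.restr_source, A.open_source.interior_eq]
    refine ⟨fun hx => ⟨?_, hx⟩, fun hx => hx.2⟩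
    obtain ⟨h1, h2, -⟩ := key x hx
    simp [h1, h2]
  · intro x hx
    simpa using (key x hx).2.2

theorem liftCharts_isLocalDiffeomorph [IsManifold I ∞ M] :
    letI := liftCharts (H := H) hs
    IsLocalDiffeomorph I I ∞ s := by
  let _ := liftCharts (H := H) hs
  have := liftCharts_isManifold (I := I) hs
  intro p
  set f := (hs.localInverseAt p).symm with hf
  have cf : ⇑f = s := by simp [hf]
  set c := chartAt H (s p) with hc
  set e := chartAt H p with he
  have hec : e = f.trans c := rfl
  have es : e.source = f.source ∩ s ⁻¹' c.source := by
    rw [hec, OpenPartialHomeomorph.trans_source, cf]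
  have ce : ∀ x, e x = c (s x) := fun x => by rw [hec, OpenPartialHomeomorph.coe_trans, cf]; rfl
  have hsymm : ∀ y, e.symm y = f.symm (c.symm y) := fun x => rfl
  refine ⟨⟨(f.restrOpen (s ⁻¹' c.source) (c.open_source.preimage hs.continuous)).toPartialEquiv,
    OpenPartialHomeomorph.open_source _, OpenPartialHomeomorph.open_target _, ?_, ?_⟩, ?_, ?_⟩
  · have h1 : ContMDiffOn I I ∞ (c.symm ∘ e) e.source := by
      refine ContMDiffOn.comp (t := c.target) (contMDiffOn_chart_symm) (contMDiffOn_chart) ?_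
      intro x hx
      rw [es] at hx
      rw [mem_preimage, ce]
      exact c.map_source hx.2
    change ContMDiffOn I I ∞ f (f.source ∩ s ⁻¹' c.source)
    rw [cf, ← es]
    refine h1.congr fun x hx => ?_
    rw [es] at hx
    rw [Function.comp_apply, ce, c.left_inv hx.2]
  · have ht : ∀ y ∈ (f.restrOpen (s ⁻¹' c.source) (c.open_source.preimage hs.continuous)).target,
        y ∈ f.target ∧ y ∈ c.source := by
      intro y hy
      have h1 := (f.restrOpen (s ⁻¹' c.source)
        (c.open_source.preimage hs.continuous)).map_target hy
      have h2 := (f.restrOpen (s ⁻¹' c.source)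
        (c.open_source.preimage hs.continuous)).right_inv hy
      change f.symm y ∈ f.source ∩ s ⁻¹' c.source at h1
      change f (f.symm y) = y at h2
      refine ⟨h2 ▸ f.map_source h1.1, ?_⟩
      have := h1.2
      rw [mem_preimage, ← cf, h2] at this
      exact this
    have h1 : ContMDiffOn I I ∞ (e.symm ∘ c)
        (f.restrOpen (s ⁻¹' c.source) (c.open_source.preimage hs.continuous)).target := by
      refine ContMDiffOn.comp (t := e.target) (contMDiffOn_chart_symm)
        ((contMDiffOn_chart).mono fun y hy => (ht y hy).2) ?_
      intro y hy
      obtain ⟨h1, h2⟩ := ht y hy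
      rw [mem_preimage, hec, OpenPartialHomeomorph.trans_target]
      exact ⟨c.map_source h2, by rw [mem_preimage, c.left_inv h2]; exact h1⟩
    change ContMDiffOn I I ∞ f.symm _
    refine h1.congr fun y hy => ?_
    rw [Function.comp_apply, hsymm, c.left_inv (ht y hy).2]
  · change p ∈ f.source ∩ s ⁻¹' c.source
    exact ⟨by simp [hf], mem_chart_source H (s p)⟩
  · intro x _
    change s x = f x
    rw [cf]

end lift

/-- Local version of `contMDiff_of_comp`. -/
theorem contMDiffOn_of_comp {P : Type*} [TopologicalSpace P] [ChartedSpace H P] {s : P → M}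
    (hs : IsLocalDiffeomorph I I ∞ s) {g : M' → P} {U : Set M'} (hU : IsOpen U)
    (hg : ContinuousOn g U) (h : ContMDiffOn I' I ∞ (s ∘ g) U) : ContMDiffOn I' I ∞ g U := by
  intro x hx
  have hUx := hU.mem_nhds hx
  have h1 : ContMDiffAt I' I ∞ ((hs (g x)).localInverse ∘ (s ∘ g)) x :=
    ContMDiffAt.comp x (hs (g x)).localInverse_contMDiffAt (h.contMDiffAt hUx)
  refine (h1.congr_of_eventuallyEq ?_).contMDiffWithinAt
  have h2 := (hg.continuousAt hUx).eventually (hs (g x)).localInverse_eventuallyEq_left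
  filter_upwards [h2] with y hy
  exact hy.symm

/-- A continuous map into `P` is smooth once its composition with a local diffeomorphism is. -/
theorem contMDiff_of_comp {P : Type*} [TopologicalSpace P] [ChartedSpace H P] {s : P → M}
    (hs : IsLocalDiffeomorph I I ∞ s) {g : M' → P} (hg : Continuous g)
    (h : ContMDiff I' I ∞ (s ∘ g)) : ContMDiff I' I ∞ g := by
  intro x
  have h1 : ContMDiffAt I' I ∞ ((hs (g x)).localInverse ∘ (s ∘ g)) x :=
    ContMDiffAt.comp x (hs (g x)).localInverse_contMDiffAt (h x)
  refine h1.congr_of_eventuallyEq ?_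
  have h2 := hg.continuousAt.eventually (hs (g x)).localInverse_eventuallyEq_left
  filter_upwards [h2] with y hy
  exact hy.symm

section liftForms
variable {P : Type*} [TopologicalSpace P] {s : P → M} (hs : IsLocalHomeomorph s)

theorem lift_extChartAt (p : P) :
    let _ := liftCharts (H := H) hs
    (∀ x, extChartAt I p x = extChartAt I (s p) (s x)) ∧
    ∀ v ∈ (extChartAt I p).target, v ∈ (extChartAt I (s p)).target ∧
      s ((extChartAt I p).symm v) = (extChartAt I (s p)).symm v := by
  let _ := liftCharts (H := H) hs
  set f := (hs.localInverseAt p).symm with hf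
  have cf : ⇑f = s := by simp [hf]
  have hec : chartAt H p = f.trans (chartAt H (s p)) := rfl
  refine ⟨fun x => ?_, fun v hv => ?_⟩
  · simp only [extChartAt_coe, hec, OpenPartialHomeomorph.coe_trans, cf]
    rfl
  · rw [extChartAt_target, hec, OpenPartialHomeomorph.trans_target] at hv
    obtain ⟨⟨h1, h2⟩, h3⟩ := hv
    refine ⟨by rw [extChartAt_target]; exact ⟨h1, h3⟩, ?_⟩
    have := f.right_inv h2
    rw [cf] at this
    exact this

variable [IsManifold I ∞ M] [I.Boundaryless]

theorem DForm.lift_inChart (α : DForm I M k) (p : P) :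
    let _ := liftCharts (H := H) hs
    ∀ v ∈ (extChartAt I p).target,
      DForm.inChart (DForm.pull (I := I) s α) p v = α.inChart (s p) v := by
  intro _ v hv
  have := liftCharts_isManifold (I := I) hs
  have hl := liftCharts_isLocalDiffeomorph (I := I) hs
  obtain ⟨-, h2⟩ := lift_extChartAt (I := I) hs p
  have hcomp : mfderiv 𝓘(ℝ, F) I (extChartAt I (s p)).symm v =
      (mfderiv I I s ((extChartAt I p).symm v)).comp
        (mfderiv 𝓘(ℝ, F) I (extChartAt I p).symm v) := by
    rw [← mfderiv_comp v (hl.mdifferentiable (by simp) _)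
      ((contMDiffOn_extChartAt_symm (n := ∞) p).contMDiffAt
        ((isOpen_extChartAt_target p).mem_nhds hv) |>.mdifferentiableAt (by simp))]
    apply Filter.EventuallyEq.mfderiv_eq
    filter_upwards [(isOpen_extChartAt_target (I := I) p).mem_nhds hv] with w hw
    exact (h2 w hw).2.symm
  have key : ∀ y y' : M, y = y' → (α y : F [⋀^Fin k]→L[ℝ] ℝ) = α y' := by
    rintro y _ rfl; rfl
  unfold DForm.inChart DForm.pull
  rw [hcomp]
  ext w
  exact congrArg (fun β : F [⋀^Fin k]→L[ℝ] ℝ => β fun i =>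
    (mfderiv I I s ((extChartAt I p).symm v)) ((mfderiv 𝓘(ℝ, F) I (extChartAt I p).symm v) (w i)))
    (key _ _ (h2 v hv).2)

theorem DForm.Smooth.lift {α : DForm I M k} (hα : α.Smooth) :
    let _ := liftCharts (H := H) hs
    DForm.Smooth (DForm.pull (I := I) s α) := by
  intro _ p
  refine ((hα (s p)).mono ?_).congr (DForm.lift_inChart hs α p)
  exact fun v hv => ((lift_extChartAt (I := I) hs p).2 v hv).1

theorem DForm.lift_d (α : DForm I M k) :
    let _ := liftCharts (H := H) hs
    (DForm.pull (I := I) s α).d = DForm.pull (I := I) s α.d := by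
  let _ := liftCharts (H := H) hs
  have := liftCharts_isManifold (I := I) hs
  have hl := liftCharts_isLocalDiffeomorph (I := I) hs
  funext p
  obtain ⟨h1, h2⟩ := lift_extChartAt (I := I) hs p
  have hd : extDeriv (DForm.inChart (DForm.pull (I := I) s α) p) (extChartAt I p p) =
      extDeriv (α.inChart (s p)) (extChartAt I (s p) (s p)) := by
    rw [← h1]
    apply Filter.EventuallyEq.extDeriv_eq
    filter_upwards [(isOpen_extChartAt_target (I := I) p).mem_nhds (mem_extChartAt_target p)]
      with w hw
    exact DForm.lift_inChart hs α p w hw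
  have hm : mfderiv I 𝓘(ℝ, F) (extChartAt I p) p =
      (mfderiv I 𝓘(ℝ, F) (extChartAt I (s p)) (s p)).comp (mfderiv I I s p) := by
    rw [← mfderiv_comp p (mdifferentiableAt_extChartAt (mem_chart_source H (s p)))
      (hl.mdifferentiable (by simp) p)]
    congr 1
    funext x
    exact h1 x
  unfold DForm.d
  rw [hd, hm]
  ext w
  rfl

end liftForms
end Forms

/-- The model with corners of the total space of a circle bundle over an `n`-manifold. -/
abbrev totalModel (n : ℕ) :
    ModelWithCorners ℝ (EuclideanSpace ℝ (Fin n) × EuclideanSpace ℝ (Fin 1))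
      (ModelProd (EuclideanSpace ℝ (Fin n)) (EuclideanSpace ℝ (Fin 1))) :=
  (𝓡 n).prod (𝓡 1)

/-- The generator of the circle action: the velocity at `t = 0` of `t ↦ e^{it} • y`. -/
def vertical {n : ℕ} {Y : Type*} [TopologicalSpace Y]
    [ChartedSpace (ModelProd (EuclideanSpace ℝ (Fin n)) (EuclideanSpace ℝ (Fin 1))) Y]
    [MulAction Circle Y] (y : Y) : TangentSpace (totalModel n) y :=
  mfderiv 𝓘(ℝ, ℝ) (totalModel n) (fun t : ℝ => Circle.exp t • y) 0 (1 : ℝ)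

/-- A prequantisation `(Y, ω, π)` of `(E, σ)`: a smooth principal `U(1)`-bundle `π : Y → E` with a
connection form `ω` (here `conn`), normalised to take the value `ħ` on the generator of the action,
i.e. locally `ω = θ + ħ dz/(iz)`, and such that `dω = π^*σ`. -/
structure Prequantisation {n : ℕ} {E : Type u} [TopologicalSpace E]
    [ChartedSpace (EuclideanSpace ℝ (Fin n)) E] (ħ : ℝ) (σ : DForm (𝓡 n) E 2) where
  Y : Type u
  [top : TopologicalSpace Y]
  [charts : ChartedSpace (ModelProd (EuclideanSpace ℝ (Fin n)) (EuclideanSpace ℝ (Fin 1))) Y]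
  [manifold : IsManifold (totalModel n) ∞ Y]
  [action : MulAction Circle Y]
  smul_smooth : ContMDiff ((𝓡 1).prod (totalModel n)) (totalModel n) ∞
    (fun p : Circle × Y => p.1 • p.2)
  proj : Y → E
  proj_smooth : ContMDiff (totalModel n) (𝓡 n) ∞ proj
  proj_smul : ∀ (z : Circle) (y : Y), proj (z • y) = proj y
  locallyTrivial : ∀ x : E, ∃ t : Bundle.Trivialization Circle proj, x ∈ t.baseSet ∧
    ContMDiffOn (totalModel n) (totalModel n) ∞ t t.source ∧
    ContMDiffOn (totalModel n) (totalModel n) ∞ t.toOpenPartialHomeomorph.symm t.target ∧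
    ∀ (z : Circle) (y : Y), y ∈ t.source → t (z • y) = ((t y).1, z * (t y).2)
  conn : DForm (totalModel n) Y 1
  conn_smooth : conn.Smooth
  conn_invariant : ∀ z : Circle, DForm.pull (I := totalModel n) (fun y => z • y) conn = conn
  conn_vertical : ∀ y : Y, conn y (fun _ => vertical y) = ħ
  curvature : conn.d = DForm.pull (I := totalModel n) proj σ

attribute [instance] Prequantisation.top Prequantisation.charts Prequantisation.manifold
  Prequantisation.action

section Bundles
variable {n : ℕ} {E E' E'' : Type u} [TopologicalSpace E]
  [ChartedSpace (EuclideanSpace ℝ (Fin n)) E] [TopologicalSpace E']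
  [ChartedSpace (EuclideanSpace ℝ (Fin n)) E'] [TopologicalSpace E'']
  [ChartedSpace (EuclideanSpace ℝ (Fin n)) E''] {ħ : ℝ} {σ : DForm (𝓡 n) E 2}
  {σ' : DForm (𝓡 n) E' 2} {σ'' : DForm (𝓡 n) E'' 2}

namespace Prequantisation

/-- `f` is a morphism of prequantisations covering the map `φ` of the base spaces: a smooth
`U(1)`-equivariant bundle map over `φ` with `f^*ω' = ω`. -/
structure IsMorphismOver (P : Prequantisation ħ σ) (P' : Prequantisation ħ σ') (φ : E → E')
    (f : P.Y → P'.Y) : Prop where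
  smooth : ContMDiff (totalModel n) (totalModel n) ∞ f
  covers : ∀ y, P'.proj (f y) = φ (P.proj y)
  equivariant : ∀ (z : Circle) (y : P.Y), f (z • y) = z • f y
  preserves : DForm.pull (I := totalModel n) f P'.conn = P.conn

theorem IsMorphismOver.comp {P : Prequantisation ħ σ} {P' : Prequantisation ħ σ'}
    {P'' : Prequantisation ħ σ''} {φ : E → E'} {φ' : E' → E''} {f : P.Y → P'.Y}
    {f' : P'.Y → P''.Y} (hf' : IsMorphismOver P' P'' φ' f') (hf : IsMorphismOver P P' φ f) :
    IsMorphismOver P P'' (φ' ∘ φ) (f' ∘ f) where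
  smooth := hf'.smooth.comp hf.smooth
  covers y := by simp [hf'.covers, hf.covers]
  equivariant z y := by simp [hf'.equivariant, hf.equivariant]
  preserves := by
    rw [← DForm.pull_comp (hf'.smooth.mdifferentiable (by simp))
      (hf.smooth.mdifferentiable (by simp)), hf'.preserves, hf.preserves]

/-- Two prequantisations of `(E, σ)` are equivalent if there is a `U(1)`-equivariant diffeomorphism
of the total spaces which covers the identity of `E` and exchanges the connection forms. -/
def Equivalent (P P' : Prequantisation ħ σ) : Prop :=
  ∃ f : P.Y ≃ₘ^∞⟮totalModel n, totalModel n⟯ P'.Y, IsMorphismOver P P' id f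

variable (ħ σ) in
/-- Equivalence of prequantisations. Its quotient is the set of inequivalent prequantisations. -/
def equivalenceSetoid : Setoid (Prequantisation ħ σ) where
  r := Equivalent
  iseqv := {
    refl := fun P => ⟨Diffeomorph.refl _ _ _, contMDiff_id, fun _ => rfl, fun _ _ => rfl,
      DForm.pull_id _⟩
    symm := by
      rintro P P' ⟨f, hf⟩
      have h1 : ∀ y, f (f.symm y) = y := f.apply_symm_apply
      refine ⟨f.symm, f.symm.contMDiff, fun y => ?_, fun z y => ?_, ?_⟩
      · have := hf.covers (f.symm y)
        rw [h1] at this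
        exact this.symm
      · apply f.injective
        refine (h1 _).trans ((hf.equivariant z (f.symm y)).trans ?_).symm
        rw [h1]
      · have h2 : (f ∘ f.symm : P'.Y → P'.Y) = id := funext h1
        rw [← hf.preserves, DForm.pull_comp (f.contMDiff.mdifferentiable (by simp))
          (f.symm.contMDiff.mdifferentiable (by simp)), h2, DForm.pull_id]
    trans := by
      rintro P P' P'' ⟨f, hf⟩ ⟨g, hg⟩
      exact ⟨f.trans g, hg.comp hf⟩ }

open Classical in
/-- The projection of a fibre product `E' ×_E Z → Z` is a local homeomorphism if `E' → E` is. -/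
theorem isLocalHomeomorph_snd {q : E' → E} (hq : IsLocalHomeomorph q) {Z : Type*}
    [TopologicalSpace Z] {π : Z → E} (hπ : Continuous π) :
    IsLocalHomeomorph (fun p : Function.Pullback q π => p.1.2) := by
  refine IsLocalHomeomorph.mk _ fun p => ?_
  obtain ⟨f, hpf, rfl⟩ := hq p.1.1
  refine ⟨{ toFun := fun p => p.1.2
            invFun := fun y => if h : π y ∈ f.target then ⟨(f.symm (π y), y), f.right_inv h⟩ else p
            source := {p | p.1.1 ∈ f.source}
            target := π ⁻¹' f.target
            map_source' := fun p' (hp' : p'.1.1 ∈ f.source) => by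
              rw [mem_preimage, ← p'.2]; exact f.map_source hp'
            map_target' := fun y (hy : π y ∈ f.target) => by
              rw [dif_pos hy]
              exact f.map_target hy
            left_inv' := fun p' (hp' : p'.1.1 ∈ f.source) => by
              have h : π p'.1.2 ∈ f.target := by rw [← p'.2]; exact f.map_source hp'
              simp only [h, dite_true]
              apply Subtype.ext
              apply Prod.ext
              · change f.symm (π p'.1.2) = p'.1.1
                rw [← p'.2, f.left_inv hp']
              · rfl
            right_inv' := fun y (hy : π y ∈ f.target) => by simp only [hy, dite_true]
            open_source := f.open_source.preimage (continuous_fst.comp continuous_subtype_val)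
            open_target := f.open_target.preimage hπ
            continuousOn_toFun := (continuous_snd.comp continuous_subtype_val).continuousOn
            continuousOn_invFun := by
              refine Topology.IsInducing.subtypeVal.continuousOn_iff.2 ?_
              have : ContinuousOn (fun y => (f.symm (π y), y)) (π ⁻¹' f.target) :=
                (f.continuousOn_symm.comp hπ.continuousOn fun y hy => hy).prodMk continuousOn_id
              refine this.congr fun y hy => ?_
              have hy' : π y ∈ f.target := hy
              simp [hy'] }, hpf, fun _ _ => rfl⟩

open Classical in
/-- The pullback `q^*P` of a prequantisation `P` of `(E, σ)` along a local diffeomorphism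
`q : E' → E`: the prequantisation of `(E', q^*σ)` whose total space is the fibre product
`{(x, ξ) | q x = π ξ}` with the smooth structure that makes `(x, ξ) ↦ ξ` a local diffeomorphism, with
action `z • (x, ξ) = (x, z • ξ)` and with the connection form pulled back along `(x, ξ) ↦ ξ`. -/
def pullback [IsManifold (𝓡 n) ∞ E] [IsManifold (𝓡 n) ∞ E'] (P : Prequantisation ħ σ) (q : E' → E)
    (hq : IsLocalDiffeomorph (𝓡 n) (𝓡 n) ∞ q) :
    Prequantisation ħ (DForm.pull (I := 𝓡 n) q σ) :=
  have hs : IsLocalHomeomorph (fun p : Function.Pullback q P.proj => p.1.2) :=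
    isLocalHomeomorph_snd hq.isLocalHomeomorph P.proj_smooth.continuous
  letI : ChartedSpace (ModelProd (EuclideanSpace ℝ (Fin n)) (EuclideanSpace ℝ (Fin 1)))
    (Function.Pullback q P.proj) := liftCharts hs
  have hman : IsManifold (totalModel n) ∞ (Function.Pullback q P.proj) :=
    liftCharts_isManifold hs
  have hl : IsLocalDiffeomorph (totalModel n) (totalModel n) ∞
    (fun p : Function.Pullback q P.proj => p.1.2) := liftCharts_isLocalDiffeomorph hs
  letI : MulAction Circle (Function.Pullback q P.proj) :=
    { smul := fun z p => ⟨(p.1.1, z • p.1.2), by rw [P.proj_smul]; exact p.2⟩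
      one_smul := fun p => Subtype.ext (Prod.ext rfl (one_smul _ _))
      mul_smul := fun _ _ p => Subtype.ext (Prod.ext rfl (mul_smul _ _ _)) }
  have hfst : ContMDiff (totalModel n) (𝓡 n) ∞
      (fun p : Function.Pullback q P.proj => p.1.1) := by
    refine contMDiff_of_comp hq (continuous_fst.comp continuous_subtype_val) ?_
    have h := P.proj_smooth.comp hl.contMDiff
    exact h.congr fun p => p.2
  have hsmul : ContMDiff ((𝓡 1).prod (totalModel n)) (totalModel n) ∞
      (fun p : Circle × Function.Pullback q P.proj => p.1 • p.2) := by
    have h2 : ContMDiff ((𝓡 1).prod (totalModel n)) (totalModel n) ∞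
        (fun p : Circle × Function.Pullback q P.proj => p.1 • p.2.1.2) :=
      P.smul_smooth.comp (contMDiff_fst.prodMk (hl.contMDiff.comp contMDiff_snd))
    refine contMDiff_of_comp hl ?_ h2
    refine Continuous.subtype_mk (Continuous.prodMk ?_ h2.continuous) _
    exact continuous_fst.comp (continuous_subtype_val.comp continuous_snd)
  { Y := Function.Pullback q P.proj
    manifold := hman
    smul_smooth := hsmul
    proj := fun p => p.1.1
    proj_smooth := hfst
    proj_smul := fun _ _ => rfl
    locallyTrivial := by
      intro x
      obtain ⟨t, hx, h1, h2, h3⟩ := P.locallyTrivial (q x)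
      have hp : ∀ (x : E') (z : Circle), q x ∈ t.baseSet →
          q x = P.proj (t.toOpenPartialHomeomorph.symm (q x, z)) :=
        fun x z h => (t.proj_symm_apply' h).symm
      have hb : ∀ p : Function.Pullback q P.proj, q p.1.1 ∈ t.baseSet → p.1.2 ∈ t.source :=
        fun p h => by rw [t.mem_source, ← p.2]; exact h
      have hbo : IsOpen (q ⁻¹' t.baseSet) := t.open_baseSet.preimage hq.contMDiff.continuous
      have htr : ∀ w : E' × Circle, q w.1 ∈ t.baseSet → (q w.1, w.2) ∈ t.target :=
        fun w h => by rw [t.target_eq]; exact ⟨h, mem_univ _⟩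
      have hfwd : ContMDiffOn (totalModel n) (totalModel n) ∞
          (fun p : Function.Pullback q P.proj => (p.1.1, (t p.1.2).2))
          {p | q p.1.1 ∈ t.baseSet} :=
        hfst.contMDiffOn.prodMk
          (contMDiff_snd.comp_contMDiffOn (h1.comp hl.contMDiff.contMDiffOn hb))
      have hsnd : ContMDiffOn (totalModel n) (totalModel n) ∞
          (fun w : E' × Circle => t.toOpenPartialHomeomorph.symm (q w.1, w.2))
          ((q ⁻¹' t.baseSet) ×ˢ univ) :=
        h2.comp (((hq.contMDiff.comp contMDiff_fst).prodMk contMDiff_snd).contMDiffOn)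
          fun w hw => htr w hw.1
      let inv : E' × Circle → Function.Pullback q P.proj := fun w =>
        if h : q w.1 ∈ t.baseSet then ⟨(w.1, t.toOpenPartialHomeomorph.symm (q w.1, w.2)), hp _ _ h⟩
        else ⟨(x, t.toOpenPartialHomeomorph.symm (q x, 1)), hp _ _ hx⟩
      have hinv : ∀ w : E' × Circle, q w.1 ∈ t.baseSet →
          (inv w).1 = (w.1, t.toOpenPartialHomeomorph.symm (q w.1, w.2)) := fun w h => by
        simp only [inv, dif_pos h]
      have hinvc : ContinuousOn inv ((q ⁻¹' t.baseSet) ×ˢ univ) := by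
        refine Topology.IsInducing.subtypeVal.continuousOn_iff.2 ?_
        refine (continuous_fst.continuousOn.prodMk hsnd.continuousOn).congr fun w hw => ?_
        exact hinv w hw.1
      have hinvs : ContMDiffOn (totalModel n) (totalModel n) ∞ inv
          ((q ⁻¹' t.baseSet) ×ˢ univ) := by
        refine contMDiffOn_of_comp hl (hbo.prod isOpen_univ) hinvc ?_
        exact hsnd.congr fun w hw => congrArg Prod.snd (hinv w hw.1)
      refine ⟨{ toFun := fun p => (p.1.1, (t p.1.2).2)
                invFun := inv
                source := {p | q p.1.1 ∈ t.baseSet}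
                target := (q ⁻¹' t.baseSet) ×ˢ univ
                map_source' := fun p hp => ⟨hp, mem_univ _⟩
                map_target' := fun w hw => ?_
                left_inv' := fun p hp => ?_
                right_inv' := fun w hw => ?_
                open_source := hbo.preimage hfst.continuous
                open_target := hbo.prod isOpen_univ
                continuousOn_toFun := hfwd.continuousOn
                continuousOn_invFun := hinvc
                baseSet := q ⁻¹' t.baseSet
                open_baseSet := hbo
                source_eq := rfl
                target_eq := rfl
                proj_toFun := fun _ _ => rfl }, hx, hfwd, hinvs, ?_⟩
      · change q (inv w).1.1 ∈ t.baseSet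
        rw [hinv w hw.1]
        exact hw.1
      · have hp' : q p.1.1 ∈ t.baseSet := hp
        apply Subtype.ext
        rw [hinv _ hp']
        refine Prod.ext rfl ?_
        have h4 : (q p.1.1, (t p.1.2).2) = t p.1.2 := by
          rw [p.2]
          exact Prod.ext (t.coe_fst (hb p hp')).symm rfl
        change t.toOpenPartialHomeomorph.symm (q p.1.1, (t p.1.2).2) = p.1.2
        rw [h4]
        exact t.toOpenPartialHomeomorph.left_inv (hb p hp')
      · change ((inv w).1.1, (t (inv w).1.2).2) = w
        rw [hinv w hw.1]
        have h5 : t (t.toOpenPartialHomeomorph.symm (q w.1, w.2)) = (q w.1, w.2) :=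
          t.toOpenPartialHomeomorph.right_inv (htr w hw.1)
        refine Prod.ext rfl ?_
        exact congrArg (fun u : E × Circle => u.2) h5
      · intro z p hp
        refine Prod.ext rfl ?_
        exact congrArg (fun u : E × Circle => u.2) (h3 z p.1.2 (hb p hp))
    conn := DForm.pull (I := totalModel n) (fun p => p.1.2) P.conn
    conn_smooth := P.conn_smooth.lift hs
    conn_invariant := fun z => by
      have hz : MDifferentiable (totalModel n) (totalModel n) (fun y : P.Y => z • y) :=
        (P.smul_smooth.comp (contMDiff_const.prodMk contMDiff_id)).mdifferentiable (by simp)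
      have hz' : MDifferentiable (totalModel n) (totalModel n)
          (fun y : Function.Pullback q P.proj => z • y) :=
        (hsmul.comp (contMDiff_const.prodMk contMDiff_id)).mdifferentiable (by simp)
      have hm := hl.contMDiff.mdifferentiable (by simp)
      rw [DForm.pull_comp hm hz']
      conv_rhs => rw [← P.conn_invariant z, DForm.pull_comp hz hm]
      rfl
    conn_vertical := fun p => by
      have hc : MDifferentiableAt 𝓘(ℝ, ℝ) (totalModel n) (fun t : ℝ => Circle.exp t • p) 0 :=
        ((hsmul.comp (contMDiff_circleExp.prodMk contMDiff_const)).mdifferentiable (by simp)) 0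
      have hm := hl.contMDiff.mdifferentiable (by simp)
      have key : ∀ p' : Function.Pullback q P.proj, p' = p →
          ∀ v : EuclideanSpace ℝ (Fin n) × EuclideanSpace ℝ (Fin 1),
          ((mfderiv (totalModel n) (totalModel n)
            (fun p : Function.Pullback q P.proj => p.1.2) p' v :
              EuclideanSpace ℝ (Fin n) × EuclideanSpace ℝ (Fin 1))) =
          mfderiv (totalModel n) (totalModel n)
            (fun p : Function.Pullback q P.proj => p.1.2) p v := by
        rintro _ rfl _; rfl
      have h0 : Circle.exp (0 : ℝ) • p = p := by rw [Circle.exp_zero, one_smul]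
      have hv : mfderiv (totalModel n) (totalModel n)
          (fun p : Function.Pullback q P.proj => p.1.2) p (vertical p) = vertical p.1.2 := by
        unfold vertical
        have h1 : (fun t : ℝ => Circle.exp t • p.1.2) =
          (fun p : Function.Pullback q P.proj => p.1.2) ∘
            (fun t : ℝ => Circle.exp t • p) := rfl
        rw [h1, mfderiv_comp (0 : ℝ) (hm _) hc]
        exact (key _ h0 _).symm
      refine Eq.trans ?_ (P.conn_vertical p.1.2)
      rw [← hv]
      rfl
    curvature := by
      rw [DForm.lift_d hs P.conn, P.curvature]
      have hm := hl.contMDiff.mdifferentiable (by simp)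
      rw [DForm.pull_comp (P.proj_smooth.mdifferentiable (by simp)) hm,
        DForm.pull_comp (hq.contMDiff.mdifferentiable (by simp)) (hfst.mdifferentiable (by simp))]
      congr 1
      funext p
      exact p.2.symm }

end Prequantisation

section Deck
variable {X X' : Type*} [TopologicalSpace X] [TopologicalSpace X']

/-- The group of covering transformations of `q`. -/
def deckGroup (q : X' → X) : Subgroup (X' ≃ₜ X') where
  carrier := {τ | ∀ x, q (τ x) = q x}
  one_mem' := fun _ => rfl
  mul_mem' := fun {a b} ha hb x => (ha (b x)).trans (hb x)
  inv_mem' := fun {a} ha x => by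
    have := ha (a⁻¹ x)
    rw [← this]
    exact congrArg q (a.apply_symm_apply x)

/-- The class in `π₁(X, e)` of a covering transformation `τ`: the image under `q` of a path from `x₀`
to `τ x₀`. If `q` is the universal covering, this identifies the group of covering transformations
with the fundamental group (Mathlib multiplies loops in the opposite order, which characters do not
see), and it is in this way that `π₁` acts on the universal covering. -/
def deckClass [PathConnectedSpace X'] {q : X' → X} (hq : Continuous q) {e : X} {x₀ : X'}
    (hx₀ : q x₀ = e) (τ : deckGroup q) : FundamentalGroup X e :=
  FundamentalGroup.fromPath (Path.Homotopic.Quotient.mk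
    (((PathConnectedSpace.somePath x₀ (τ.1 x₀)).map hq).cast hx₀.symm
      (hx₀.symm.trans (τ.2 x₀).symm)))

end Deck

namespace Prequantisation

/-- The lift, twisted by the character `χ`, of the action of `π₁` to the pulled-back prequantisation:
the covering transformation `τ` of class `g` acts by `(x, ξ) ↦ (τ x, χ(g) • ξ)`. -/
def twistedLift [IsManifold (𝓡 n) ∞ E] [IsManifold (𝓡 n) ∞ E'] [PathConnectedSpace E']
    (P : Prequantisation ħ σ) {q : E' → E}
    (hq : IsLocalDiffeomorph (𝓡 n) (𝓡 n) ∞ q) {e : E} {x₀ : E'} (hx₀ : q x₀ = e)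
    (χ : FundamentalGroup E e →* Circle) (τ : deckGroup q) (y : (P.pullback q hq).Y) :
    (P.pullback q hq).Y :=
  ⟨(τ.1 y.1.1, χ (deckClass hq.contMDiff.continuous hx₀ τ) • y.1.2), by
    rw [τ.2, P.proj_smul]; exact y.2⟩

/-- `Q` is the quotient of the pulled-back prequantisation `q^*P` by the action of `π₁` lifted with the
twist `χ`: there is a surjective local diffeomorphism onto `Q` whose fibres are the orbits, which
covers `q`, is `U(1)`-equivariant and pulls the connection form of `Q` back to that of `q^*P`. -/
def IsTwistedQuotient [IsManifold (𝓡 n) ∞ E] [IsManifold (𝓡 n) ∞ E'] [PathConnectedSpace E']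
    (P : Prequantisation ħ σ) {q : E' → E}
    (hq : IsLocalDiffeomorph (𝓡 n) (𝓡 n) ∞ q) {e : E} {x₀ : E'} (hx₀ : q x₀ = e)
    (χ : FundamentalGroup E e →* Circle) (Q : Prequantisation ħ σ) : Prop :=
  ∃ p : (P.pullback q hq).Y → Q.Y,
    IsLocalDiffeomorph (totalModel n) (totalModel n) ∞ p ∧ Function.Surjective p ∧
    (∀ y y', p y = p y' ↔ ∃ τ : deckGroup q, P.twistedLift hq hx₀ χ τ y = y') ∧
    IsMorphismOver (P.pullback q hq) Q q p

end Prequantisation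
end Bundles

end

end Prequant

/-! The proof compares prequantisations through flat circle bundles on `E`, presented as Čech data
with values in the discrete circle group (`FlatCocycle`).

Any two prequantisations are locally isomorphic: local sections pull the two connection forms back
to forms with the same exterior derivative `σ`, so by the Poincaré lemma on a ball they differ by
`dG`, and rotating one section by `exp (G / ħ)` absorbs the difference (`exists_gauge`,
`exists_local_isomorphism`). A gauge transformation that preserves the connection is locally
constant, because rotation by `exp θ` adds `ħ dθ` to the pulled-back form
(`eventually_eq_of_pullAt_smul_eq`). Hence every prequantisation is the reference one reglued by
locally constant circle-valued functions, a `twist` (`exists_twist_equivalent`), and two twists are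
equivalent exactly when their flat cocycles are gauge equivalent (`twist_equivalent_of_isGauge`,
`exists_isGauge_of_equivalent`).

Flat cocycles up to gauge are the characters of the fundamental group, by parallel transport:
holonomy is a gauge invariant (`IsGauge.holonomy_eq`), it is a complete one (`exists_isGauge`), and
every character occurs (`holonomy_ofCharacter`). Thus `Φ` sends a character to the twist of the
reference prequantisation by a flat cocycle with that holonomy; no covering enters its construction.

On a simply connected covering the flat bundle acquires a global parallel section `h`, and a
covering transformation multiplies `h` by the holonomy of its class (`FlatAlong.deck_apply`). The
map `(x, ξ) ↦ (h x)⁻¹ • ξ` therefore exhibits the twist as the quotient by the twisted action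
(`isTwistedQuotient_twist`), and such a quotient is unique up to equivalence
(`IsTwistedQuotient.equivalent`). -/

namespace Prequant

noncomputable section

open Set Filter Topology

/-! ### Flat circle bundles, parallel transport and holonomy. -/

/-- A Čech cocycle with values in the discrete circle group, given by a `0`-cochain of arbitrary
functions `c x`, defined near `x`, whose ratios are locally constant. -/
structure FlatCocycle (E : Type*) [TopologicalSpace E] where
  U : E → Set E
  isOpen_U : ∀ x, IsOpen (U x)
  mem_U : ∀ x, x ∈ U x
  c : E → E → Circle
  locconst : ∀ x x' y, y ∈ U x → y ∈ U x' → ∀ᶠ z in 𝓝 y, c x z / c x' z = c x y / c x' y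

/-- The circle with the discrete topology. -/
def DiscreteCircle := Circle

instance : TopologicalSpace DiscreteCircle := ⊥

instance : DiscreteTopology DiscreteCircle := ⟨rfl⟩

/-- The identity map from the discrete circle to the circle. -/
def DiscreteCircle.toCircle : DiscreteCircle ≃ Circle := Equiv.refl _

namespace FlatCocycle

section Flat
variable {E : Type*} [TopologicalSpace E] (D : FlatCocycle E)
  {X X' : Type*} [TopologicalSpace X] [TopologicalSpace X']

/-- `h` is a parallel section of the flat bundle of `D` along the map `g`. -/
def FlatAlong (g : X → E) (h : X → Circle) : Prop :=
  ∀ t, ∀ᶠ t' in 𝓝 t, h t' / D.c (g t) (g t') = h t / D.c (g t) (g t)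

variable {D}

theorem FlatAlong.comp {g : X → E} {h : X → Circle} (hh : D.FlatAlong g h) {φ : X' → X}
    (hφ : Continuous φ) : D.FlatAlong (g ∘ φ) (h ∘ φ) := fun t =>
  hφ.continuousAt.eventually (hh (φ t))

/-- Near each point both sections are constant multiples of the same function `D.c (g t) ∘ g`, which
cancels in the ratio; so the ratio is locally constant. -/
theorem FlatAlong.div_eq [PreconnectedSpace X] {g : X → E} {h h' : X → Circle}
    (hh : D.FlatAlong g h) (hh' : D.FlatAlong g h') (s t : X) : h s / h' s = h t / h' t := by
  have : IsLocallyConstant fun t => h t / h' t := by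
    rw [IsLocallyConstant.iff_eventually_eq]
    intro t
    filter_upwards [hh t, hh' t] with t' h1 h2
    rw [← div_div_div_cancel_right _ _ (D.c (g t) (g t')), h1, h2, div_div_div_cancel_right]
  exact this.apply_eq_of_preconnectedSpace s t

theorem FlatAlong.div_eq' [PreconnectedSpace X] {g : X → E} {h h' : X → Circle}
    (hh : D.FlatAlong g h) (hh' : D.FlatAlong g h') (s t : X) : h s / h t = h' s / h' t := by
  have := hh.div_eq hh' s t
  rw [div_eq_div_iff_mul_eq_mul] at this ⊢
  rw [this, mul_comm]

theorem FlatAlong.const (y : E) (z : Circle) : D.FlatAlong (fun _ : X => y) fun _ => z :=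
  fun _ => Eventually.of_forall fun _ => rfl

/-- Over its own patch each member of the cochain is a parallel section. This is what makes
transport inside a patch explicit. -/
theorem FlatAlong.of_subset {g : X → E} (hg : Continuous g) {x : E} (hx : ∀ t, g t ∈ D.U x) :
    D.FlatAlong g fun t => D.c x (g t) := fun t =>
  hg.continuousAt.eventually (D.locconst x (g t) (g t) (hx t) (D.mem_U _))

variable (D)

/-- The core of the covering space of `D`, a principal bundle with discrete structure group. -/
def core : FiberBundleCore E E DiscreteCircle where
  baseSet := D.U
  isOpen_baseSet := D.isOpen_U
  indexAt := id
  mem_baseSet_at := D.mem_U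
  coordChange i j x v :=
    DiscreteCircle.toCircle.symm (DiscreteCircle.toCircle v * (D.c i x / D.c j x))
  coordChange_self i x _ v := by
    rw [div_self', mul_one, Equiv.symm_apply_apply]
  continuousOn_coordChange i j := by
    rintro ⟨y, v⟩ ⟨hy, -⟩
    have h1 := D.locconst i j y hy.1 hy.2
    have h2 : ∀ᶠ w in 𝓝 v, w = v := by simp [nhds_discrete]
    -- The ratio is locally constant and the fibre is discrete, so near `(y, v)` the coordinate
    -- change agrees with this constant map.
    have h3 : ContinuousAt (fun _ : E × DiscreteCircle =>
      DiscreteCircle.toCircle.symm (DiscreteCircle.toCircle v * (D.c i y / D.c j y))) (y, v) :=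
      continuousAt_const
    refine (h3.congr ?_).continuousWithinAt
    filter_upwards [h1.prod_nhds h2] with w hw
    rw [hw.1, hw.2]
  coordChange_comp i j k x _ v := by
    rw [Equiv.apply_symm_apply, mul_assoc, div_mul_div_cancel]

/-- A bundle with discrete fibre is a covering, and a parallel section along `g` is a lift of `g` to
it; the lifting criterion for simply connected spaces provides one. -/
theorem exists_flatAlong [SimplyConnectedSpace X] [LocallyPathConnectedSpace X]
    {g : X → E} (hg : Continuous g) : ∃ h, D.FlatAlong g h := by
  obtain ⟨t₀⟩ : Nonempty X := inferInstance
  have hc : IsCoveringMap D.core.proj :=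
    IsFiberBundle.isCoveringMap fun x => ⟨D.core.localTriv x, D.mem_U x⟩
  obtain ⟨G, ⟨-, hG⟩, -⟩ := hc.existsUnique_continuousMap_lifts ⟨g, hg⟩ t₀
    ⟨g t₀, DiscreteCircle.toCircle.symm 1⟩ rfl
  have hG' : ∀ t, (G t).1 = g t := fun t => congrFun hG t
  -- The second component of `G t` is the coordinate in the trivialisation indexed by the point `g
  -- t` itself. The factor `D.c (g t) (g t)` turns it into a value independent of the index, since
  -- the coordinate for index `x` is this value divided by `D.c x (g t)`.
  refine ⟨fun t => DiscreteCircle.toCircle (G t).2 * D.c (g t) (g t), fun t => ?_⟩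
  have h1 : ContinuousAt (fun t' => (D.core.localTriv (g t) (G t')).2) t := by
    refine continuousAt_snd.comp (ContinuousAt.comp ?_ G.continuous.continuousAt)
    refine (D.core.localTriv (g t)).continuousAt ?_
    rw [Bundle.Trivialization.mem_source]
    change (G t).1 ∈ D.U (g t)
    rw [hG']
    exact D.mem_U _
  have h2 := h1.eventually (by simp [nhds_discrete] :
    ∀ᶠ w in 𝓝 (D.core.localTriv (g t) (G t)).2, w = (D.core.localTriv (g t) (G t)).2)
  filter_upwards [h2] with t' h3
  change DiscreteCircle.toCircle (G t').2 * (D.c (G t').1 (G t').1 / D.c (g t) (G t').1) =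
    DiscreteCircle.toCircle (G t).2 * (D.c (G t).1 (G t).1 / D.c (g t) (G t).1) at h3
  rw [hG', hG'] at h3
  rw [mul_div_assoc, h3, mul_div_assoc]

/-- A section along `g ∘ r` restricts along `i` to one along `g`. This transfers existence from the
line and the plane to the unit interval and the unit square. -/
theorem exists_flatAlong_of_retract [SimplyConnectedSpace X] [LocallyPathConnectedSpace X]
    {r : X → X'} (hr : Continuous r) {i : X' → X} (hi : Continuous i) (hri : r ∘ i = id)
    {g : X' → E} (hg : Continuous g) : ∃ h, D.FlatAlong g h := by
  obtain ⟨h, hh⟩ := D.exists_flatAlong (hg.comp hr)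
  refine ⟨h ∘ i, ?_⟩
  have := hh.comp hi
  rwa [Function.comp_assoc, hri, Function.comp_id] at this

theorem exists_flatAlong_unitInterval {g : unitInterval → E} (hg : Continuous g) :
    ∃ h, D.FlatAlong g h :=
  D.exists_flatAlong_of_retract (X := ℝ) (r := projIcc 0 1 zero_le_one) continuous_projIcc
    continuous_subtype_val (funext fun x => projIcc_val _ x) hg

theorem exists_flatAlong_square {g : unitInterval × unitInterval → E} (hg : Continuous g) :
    ∃ h, D.FlatAlong g h :=
  D.exists_flatAlong_of_retract (X := ℝ × ℝ)
    (r := Prod.map (projIcc 0 1 zero_le_one) (projIcc 0 1 zero_le_one))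
    (continuous_projIcc.prodMap continuous_projIcc)
    (i := Prod.map Subtype.val Subtype.val)
    (continuous_subtype_val.prodMap continuous_subtype_val)
    (funext fun x => Prod.ext (projIcc_val zero_le_one x.1) (projIcc_val zero_le_one x.2)) hg

/-- Parallel transport along a path. -/
def transport {a b : E} (γ : Path a b) : Circle :=
  (D.exists_flatAlong_unitInterval γ.continuous).choose 1 /
    (D.exists_flatAlong_unitInterval γ.continuous).choose 0

variable {D} {a b d : E}

theorem FlatAlong.transport_eq {γ : Path a b} {h : unitInterval → Circle}
    (hh : D.FlatAlong γ h) : D.transport γ = h 1 / h 0 :=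
  (D.exists_flatAlong_unitInterval γ.continuous).choose_spec.div_eq' hh 1 0

theorem FlatAlong.transport_map {g : X → E} {h : X → Circle}
    (hh : D.FlatAlong g h) (hg : Continuous g) {s t : X} (γ : Path s t) :
    D.transport (γ.map hg) = h t / h s := by
  have h1 : D.FlatAlong (γ.map hg) (h ∘ γ) := hh.comp γ.continuous
  rw [h1.transport_eq]
  simp

theorem transport_refl (a : E) : D.transport (Path.refl a) = 1 := by
  have h1 : D.FlatAlong (Path.refl a) fun _ => 1 := FlatAlong.const a 1
  rw [h1.transport_eq, div_self']

theorem transport_cast {a' b' : E} (γ : Path a b) (ha : a' = a) (hb : b' = b) :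
    D.transport (γ.cast ha hb) = D.transport γ := by
  subst ha hb
  rfl

theorem transport_of_subset {γ : Path a b} {x : E} (hx : ∀ t, γ t ∈ D.U x) :
    D.transport γ = D.c x b / D.c x a := by
  rw [(FlatAlong.of_subset γ.continuous hx).transport_eq, γ.source, γ.target]

/-- One parallel section over the concatenation, reparametrised on each half, computes all three
transports; the values at the midpoint cancel. -/
theorem transport_trans (γ : Path a b) (γ' : Path b d) :
    D.transport (γ.trans γ') = D.transport γ * D.transport γ' := by
  obtain ⟨h, hh⟩ := D.exists_flatAlong_unitInterval (γ.trans γ').continuous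
  have k1 : Continuous (fun t : unitInterval =>
      (⟨t / 2, by constructor <;> linarith [t.2.1, t.2.2]⟩ : unitInterval)) := by fun_prop
  have k2 : Continuous (fun t : unitInterval =>
      (⟨(t + 1) / 2, by constructor <;> linarith [t.2.1, t.2.2]⟩ : unitInterval)) := by fun_prop
  have h1 := hh.comp k1
  have h2 := hh.comp k2
  have e1 : (γ.trans γ') ∘ (fun t : unitInterval =>
      (⟨t / 2, by constructor <;> linarith [t.2.1, t.2.2]⟩ : unitInterval)) = γ := by
    funext t
    rw [Function.comp_apply, Path.trans_apply, dif_pos (by simp only; linarith [t.2.2])]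
    congr 1
    apply Subtype.ext
    simp
    ring
  have e2 : (γ.trans γ') ∘ (fun t : unitInterval =>
      (⟨(t + 1) / 2, by constructor <;> linarith [t.2.1, t.2.2]⟩ : unitInterval)) = γ' := by
    funext t
    rw [Function.comp_apply, Path.trans_apply]
    split_ifs with ht
    -- `Path.trans` assigns the midpoint to its first half, so the second half meets that branch at
    -- `t = 0` only.
    · have ht' : t = 0 := Subtype.ext (le_antisymm (by simp only at ht; simp; linarith) t.2.1)
      subst ht'
      rw [γ'.source]
      convert γ.target
      simp
    · congr 1
      apply Subtype.ext
      simp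
      ring
  rw [e1] at h1
  rw [e2] at h2
  rw [hh.transport_eq, h1.transport_eq, h2.transport_eq]
  simp only [Function.comp_apply]
  have z1 : (⟨((1 : unitInterval) : ℝ) / 2, by simp; norm_num⟩ : unitInterval) =
      ⟨(((0 : unitInterval) : ℝ) + 1) / 2, by simp; norm_num⟩ := by
    apply Subtype.ext; simp
  have z2 : (⟨(((1 : unitInterval) : ℝ) + 1) / 2, by simp⟩ : unitInterval) = 1 := by
    apply Subtype.ext; simp
  have z3 : (⟨((0 : unitInterval) : ℝ) / 2, by simp⟩ : unitInterval) = 0 := by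
    apply Subtype.ext; simp
  rw [z1, z2, z3, mul_comm, div_mul_div_cancel]

/-- Take a parallel section over the whole square. The homotopy is constant on the two sides that
correspond to the endpoints, so the section takes equal values at the ends of each of them, and the
other two sides give equal ratios. -/
theorem transport_eq_of_homotopic {γ γ' : Path a b} (H : γ.Homotopic γ') :
    D.transport γ = D.transport γ' := by
  obtain ⟨H⟩ := H
  obtain ⟨h, hh⟩ := D.exists_flatAlong_square (g := H) H.continuous
  have e (s : unitInterval) : Continuous fun t : unitInterval => (s, t) := by fun_prop
  have e' (t : unitInterval) : Continuous fun s : unitInterval => (s, t) := by fun_prop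
  have h0 := hh.comp (e 0)
  have h1 := hh.comp (e 1)
  have k0 := hh.comp (e' 0)
  have k1 := hh.comp (e' 1)
  have a0 : (H ∘ fun t : unitInterval => ((0 : unitInterval), t)) = γ := by
    funext t; simp
  have a1 : (H ∘ fun t : unitInterval => ((1 : unitInterval), t)) = γ' := by
    funext t; simp
  have b0 : (H ∘ fun s : unitInterval => (s, (0 : unitInterval))) = fun _ => a := by
    funext t; simp
  have b1 : (H ∘ fun s : unitInterval => (s, (1 : unitInterval))) = fun _ => b := by
    funext t; simp
  rw [a0] at h0
  rw [a1] at h1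
  rw [b0] at k0
  rw [b1] at k1
  have c0 := k0.div_eq' (FlatAlong.const a 1) 1 0
  have c1 := k1.div_eq' (FlatAlong.const b 1) 1 0
  rw [div_self', div_eq_one] at c0 c1
  rw [h0.transport_eq, h1.transport_eq]
  simp only [Function.comp_apply] at c0 c1 ⊢
  rw [c0, c1]

variable (D) in
/-- The holonomy character of `D`. -/
def holonomy (e : E) : FundamentalGroup E e →* Circle where
  toFun γ := Quotient.lift (s := Path.Homotopic.setoid e e) (fun γ => D.transport γ)
    (fun _ _ H => transport_eq_of_homotopic H) (FundamentalGroup.toPath γ)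
  map_one' := transport_refl e
  map_mul' := by
    intro γ γ'
    induction γ using Quotient.inductionOn with | _ γ
    induction γ' using Quotient.inductionOn with | _ γ'
    -- The product in `FundamentalGroup` concatenates in the opposite order; the target is
    -- commutative.
    exact (transport_trans γ' γ).trans (mul_comm _ _)

theorem holonomy_fromPath {e : E} (γ : Path e e) :
    D.holonomy e (FundamentalGroup.fromPath (Path.Homotopic.Quotient.mk γ)) = D.transport γ := rfl

end Flat

end FlatCocycle

/-! ### Holonomy is a complete gauge invariant. -/

namespace FlatCocycle

section Gauge
variable {E : Type*} [TopologicalSpace E] {D D' : FlatCocycle E} {a b : E}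

theorem transport_symm (γ : Path a b) : D.transport γ.symm = (D.transport γ)⁻¹ := by
  rw [eq_inv_iff_mul_eq_one, mul_comm, ← transport_trans, ← transport_refl (D := D) a]
  exact (transport_eq_of_homotopic ⟨Path.Homotopy.reflTransSymm γ⟩).symm

variable (D D') in
/-- `u` is an isomorphism between the flat bundles of `D'` and `D`. -/
def IsGauge (u : E → Circle) : Prop :=
  ∀ x, ∀ᶠ y in 𝓝 x, u y * D'.c x y / D.c x y = u x * D'.c x x / D.c x x

/-- Multiplication by `u` carries parallel sections of `D'` to parallel sections of `D`; along a
loop the two end values of `u` coincide and drop out. -/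
theorem IsGauge.holonomy_eq {u : E → Circle} (hu : IsGauge D D' u) (e : E) :
    D.holonomy e = D'.holonomy e := by
  ext γ
  induction γ using Quotient.inductionOn with | _ γ
  refine congrArg Subtype.val (?_ : D.transport γ = D'.transport γ)
  obtain ⟨h, hh⟩ := D'.exists_flatAlong_unitInterval γ.continuous
  have h1 : D.FlatAlong γ fun t => u (γ t) * h t := fun t => by
    filter_upwards [hh t, γ.continuous.continuousAt.eventually (hu (γ t))] with t' h1 h2
    have key : ∀ t'', u (γ t'') * h t'' / D.c (γ t) (γ t'') =
        (u (γ t'') * D'.c (γ t) (γ t'') / D.c (γ t) (γ t'')) *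
          (h t'' / D'.c (γ t) (γ t'')) := fun t'' => by
      rw [div_mul_div_comm, mul_right_comm, mul_div_mul_right_eq_div]
    rw [key, h1, h2, ← key]
  rw [h1.transport_eq, hh.transport_eq, γ.target, γ.source, mul_div_mul_left_eq_div]

/-- The gauge transformation at `x` is the ratio of the two transports from `e` to `x` along any
path: equality of the holonomies makes the choice of path irrelevant. -/
theorem exists_isGauge [PathConnectedSpace E] [LocallyPathConnectedSpace E] {e : E}
    (h : D.holonomy e = D'.holonomy e) : ∃ u, IsGauge D D' u := by
  have hl : ∀ γ : Path e e, D.transport γ = D'.transport γ := fun γ =>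
    DFunLike.congr_fun h (FundamentalGroup.fromPath (Path.Homotopic.Quotient.mk γ))
  let s := fun x => PathConnectedSpace.somePath e x
  refine ⟨fun x => D.transport (s x) / D'.transport (s x), fun x => ?_⟩
  have hV : IsOpen (D.U x ∩ D'.U x) := (D.isOpen_U x).inter (D'.isOpen_U x)
  have hx : x ∈ D.U x ∩ D'.U x := ⟨D.mem_U x, D'.mem_U x⟩
  filter_upwards [pathComponentIn_mem_nhds (hV.mem_nhds hx)] with y hy
  obtain ⟨δ, hδ⟩ := hy
  -- This loop compares the chosen paths to `x` and `y`. Its middle piece stays in both patches at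
  -- `x`, where transport is a ratio of values of the cochains, so equality of the two holonomies
  -- rearranges to the gauge condition.
  have h1 := hl (((s x).trans δ).trans (s y).symm)
  simp only [transport_trans, transport_symm, transport_of_subset fun t => (hδ t).1,
    transport_of_subset fun t => (hδ t).2] at h1
  rw [← div_eq_mul_inv, ← div_eq_mul_inv, div_eq_div_iff_mul_eq_mul] at h1
  rw [div_eq_div_iff_mul_eq_mul]
  generalize D.transport (s x) = A at *
  generalize D.transport (s y) = B at *
  generalize D'.transport (s x) = A' at *
  generalize D'.transport (s y) = B' at *
  have h2 := congrArg Subtype.val h1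
  apply Subtype.ext
  change ((_ : Circle) : ℂ) = ((_ : Circle) : ℂ) at h2 ⊢
  push_cast at h2 ⊢
  have n1 := Circle.coe_ne_zero (D.c x x)
  have n2 := Circle.coe_ne_zero (D'.c x x)
  have n3 := Circle.coe_ne_zero A'
  have n4 := Circle.coe_ne_zero B'
  field_simp at h2 ⊢
  linear_combination -h2

end Gauge

/-! ### A flat cocycle with a prescribed holonomy character. -/

section Character

variable {E : Type*} [TopologicalSpace E] {e : E} (χ : FundamentalGroup E e →* Circle)
  (s : ∀ x : E, Path e x)

/-- The extension of a character of the fundamental group to the fundamental groupoid, by means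
of a choice of paths from the base point. -/
def extendCharacter {a b : E} (γ : Path.Homotopic.Quotient a b) : Circle :=
  χ (FundamentalGroup.fromPath
    (((Path.Homotopic.Quotient.mk (s a)).trans γ).trans (Path.Homotopic.Quotient.mk (s b)).symm))

theorem extendCharacter_trans {a b d : E} (γ : Path.Homotopic.Quotient a b)
    (γ' : Path.Homotopic.Quotient b d) :
    extendCharacter χ s (γ.trans γ') = extendCharacter χ s γ * extendCharacter χ s γ' := by
  rw [mul_comm]
  unfold extendCharacter
  rw [← map_mul, FundamentalGroup.mul_def]
  congr 1
  simp only [Path.Homotopic.Quotient.trans_assoc]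
  congr 2
  rw [← Path.Homotopic.Quotient.trans_assoc _ (Path.Homotopic.Quotient.mk (s b)),
    Path.Homotopic.Quotient.symm_trans, Path.Homotopic.Quotient.refl_trans]

/-- The chosen path `s e` need not be constant, so the loop is conjugated by it; a character into a
commutative group does not see this. -/
theorem extendCharacter_loop (γ : Path.Homotopic.Quotient e e) :
    extendCharacter χ s γ = χ (FundamentalGroup.fromPath γ) := by
  have h : ∀ a b : Path.Homotopic.Quotient e e, χ (FundamentalGroup.fromPath (a.trans b)) =
      χ (FundamentalGroup.fromPath a) * χ (FundamentalGroup.fromPath b) := fun a b =>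
    (map_mul χ (FundamentalGroup.fromPath b) (FundamentalGroup.fromPath a)).trans (mul_comm _ _)
  unfold extendCharacter
  rw [h, mul_comm, ← h, ← Path.Homotopic.Quotient.trans_assoc,
    Path.Homotopic.Quotient.symm_trans, Path.Homotopic.Quotient.refl_trans]

theorem extendCharacter_refl (a : E) :
    extendCharacter χ s (Path.Homotopic.Quotient.refl a) = 1 := by
  have := extendCharacter_trans χ s (Path.Homotopic.Quotient.refl a) (Path.Homotopic.Quotient.refl a)
  rw [Path.Homotopic.Quotient.refl_trans] at this
  exact left_eq_mul.1 this

variable {U : E → Set E} (hU : ∀ x, IsOpen (U x)) (hx : ∀ x, x ∈ U x)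
  (hs : ∀ x, IsSimplyConnected (U x))

open Classical in
/-- The flat cocycle with a given holonomy character, for a cover by simply connected open sets. -/
def ofCharacterFun (x y : E) : Circle :=
  if h : y ∈ U x then
    haveI := (hs x).simplyConnectedSpace
    extendCharacter χ s (Path.Homotopic.Quotient.mk ((PathConnectedSpace.somePath (⟨x, hx x⟩ : U x)
      ⟨y, h⟩).map continuous_subtype_val))
  else 1

/-- Inside the simply connected set `U x`, the reference path from `x` to `a` followed by `γ` is
homotopic to the reference path from `x` to `b`. Local constancy of the ratios in `ofCharacter`
follows by applying this to one path in two patches. -/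
theorem extendCharacter_of_subset {a b x : E} (γ : Path a b) (hγ : ∀ t, γ t ∈ U x) :
    extendCharacter χ s (Path.Homotopic.Quotient.mk γ) =
      ofCharacterFun χ s hx hs x b / ofCharacterFun χ s hx hs x a := by
  have := (hs x).simplyConnectedSpace
  have ha : a ∈ U x := by simpa using hγ 0
  have hb : b ∈ U x := by simpa using hγ 1
  let γ' : Path (⟨a, ha⟩ : U x) ⟨b, hb⟩ :=
    { toFun := fun t => ⟨γ t, hγ t⟩
      continuous_toFun := by fun_prop
      source' := by simp
      target' := by simp }
  have h1 : γ = γ'.map continuous_subtype_val := by ext; rfl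
  rw [eq_div_iff_mul_eq', ofCharacterFun, ofCharacterFun, dif_pos ha, dif_pos hb,
    mul_comm, ← extendCharacter_trans, ← Path.Homotopic.Quotient.mk_trans]
  congr 1
  rw [h1, ← Path.map_trans, Path.Homotopic.Quotient.eq]
  exact Path.Homotopic.map (SimplyConnectedSpace.paths_homotopic _ _) ⟨_, continuous_subtype_val⟩

variable [LocallyPathConnectedSpace E]

/-- The flat cocycle with a given holonomy character, for a cover by simply connected open sets. -/
def ofCharacter : FlatCocycle E where
  U := U
  isOpen_U := hU
  mem_U := hx
  c := ofCharacterFun χ s hx hs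
  locconst x x' y hy hy' := by
    filter_upwards [pathComponentIn_mem_nhds (((hU x).inter (hU x')).mem_nhds ⟨hy, hy'⟩)]
      with z hz
    obtain ⟨δ, hδ⟩ := hz
    have h1 := extendCharacter_of_subset χ s hx hs δ fun t => (hδ t).1
    rw [extendCharacter_of_subset χ s hx hs δ fun t => (hδ t).2] at h1
    rw [div_eq_div_iff_mul_eq_mul] at h1 ⊢
    exact h1.symm.trans (mul_comm _ _)

/-- The extended character of the initial segment of `γ` up to time `t` is a parallel section along
`γ`: it starts at `1` and ends at the value of `χ` on the loop. -/
theorem holonomy_ofCharacter : (ofCharacter χ s hU hx hs).holonomy e = χ := by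
  ext γ
  induction γ using Quotient.inductionOn with | _ γ
  refine congrArg Subtype.val (?_ : (ofCharacter χ s hU hx hs).transport γ =
    χ (FundamentalGroup.fromPath (Path.Homotopic.Quotient.mk γ)))
  let h := fun t : unitInterval => extendCharacter χ s (Path.Homotopic.Quotient.mk (γ.subpath 0 t))
  have hh : (ofCharacter χ s hU hx hs).FlatAlong γ h := by
    intro t
    have hV := γ.continuous.continuousAt.preimage_mem_nhds ((hU (γ t)).mem_nhds (hx (γ t)))
    -- The whole segment of `γ` between `t` and `t'`, not just its far end, has to lie in the patch
    -- for `extendCharacter_of_subset` to apply.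
    have h2 : ∀ᶠ t' in 𝓝 t, uIcc t t' ⊆ γ ⁻¹' U (γ t) := by
      have : Tendsto (fun t' => uIcc t t') (𝓝 t) (𝓝 t).smallSets :=
        tendsto_const_nhds.uIcc tendsto_id
      exact this.eventually (eventually_smallSets_subset.2 hV)
    filter_upwards [h2] with t' ht'
    have h3 : h t' = h t * extendCharacter χ s (Path.Homotopic.Quotient.mk (γ.subpath t t')) := by
      rw [← extendCharacter_trans, ← Path.Homotopic.Quotient.mk_trans]
      exact congrArg (extendCharacter χ s)
        (Path.Homotopic.Quotient.eq.2 ⟨Path.Homotopy.subpathTransSubpath γ 0 t t'⟩).symm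
    have h4 : ∀ r, γ.subpath t t' r ∈ U (γ t) := fun r => by
      have : γ.subpath t t' r ∈ range (γ.subpath t t') := mem_range_self r
      rw [Path.range_subpath] at this
      obtain ⟨r', hr', h5⟩ := this
      rw [← h5]
      exact ht' hr'
    rw [h3, extendCharacter_of_subset χ s hx hs _ h4]
    simp only [ofCharacter]
    rw [mul_div_assoc, div_div, div_mul_eq_div_div_swap, div_self', one_div, div_eq_mul_inv]
  rw [hh.transport_eq]
  simp only [h]
  have e1 : extendCharacter χ s (Path.Homotopic.Quotient.mk (γ.subpath 0 0)) = 1 := by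
    rw [Path.subpath_self, Path.Homotopic.Quotient.mk_refl, extendCharacter_refl]
  have e2 : extendCharacter χ s (Path.Homotopic.Quotient.mk (γ.subpath 0 1)) =
      extendCharacter χ s (Path.Homotopic.Quotient.mk γ) := by
    have key : ∀ (a b : E) (ha : a = e) (hb : b = e), extendCharacter χ s
        (Path.Homotopic.Quotient.mk (γ.cast ha hb)) =
          extendCharacter χ s (Path.Homotopic.Quotient.mk γ) := by
      rintro _ _ rfl hb
      cases hb
      rfl
    rw [Path.subpath_zero_one]
    exact key _ _ _ _
  rw [e1, e2, div_one, extendCharacter_loop]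

end Character

end FlatCocycle

/-- The preimage of a ball under a chart is homeomorphic to a convex set. These sets are the patches
used for `ofCharacter`. -/
theorem exists_isSimplyConnected_nhds {n : ℕ} {E : Type*} [TopologicalSpace E]
    [ChartedSpace (EuclideanSpace ℝ (Fin n)) E] (x : E) :
    ∃ U : Set E, IsOpen U ∧ x ∈ U ∧ IsSimplyConnected U := by
  set c := chartAt (EuclideanSpace ℝ (Fin n)) x
  obtain ⟨r, hr, hb⟩ := Metric.isOpen_iff.1 c.open_target (c x)
    (c.map_source (mem_chart_source _ x))
  set f := c.symm.restrOpen (Metric.ball (c x) r) Metric.isOpen_ball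
  have hs : f.source = Metric.ball (c x) r := by
    simp only [f, OpenPartialHomeomorph.restrOpen_source, OpenPartialHomeomorph.symm_source]
    exact inter_eq_right.2 hb
  have hx : c x ∈ f.source := by rw [hs]; exact Metric.mem_ball_self hr
  refine ⟨f.target, f.open_target, ?_, ?_⟩
  · have h1 := f.map_source hx
    have h2 : f (c x) = x := c.left_inv (mem_chart_source _ x)
    rwa [h2] at h1
  · have : ContractibleSpace f.source := by
      rw [hs]
      exact (convex_ball (c x) r).contractibleSpace ⟨_, Metric.mem_ball_self hr⟩
    exact f.toHomeomorphSourceTarget.symm.toHomotopyEquiv.simplyConnectedSpace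

/-! ### Pointwise calculus of one-forms and logarithms of circle-valued functions. -/

section OneForms
variable {F H F' H' F'' H'' M M' M'' : Type*}
  [NormedAddCommGroup F] [NormedSpace ℝ F] [TopologicalSpace H]
  [NormedAddCommGroup F'] [NormedSpace ℝ F'] [TopologicalSpace H']
  [NormedAddCommGroup F''] [NormedSpace ℝ F''] [TopologicalSpace H'']
  [TopologicalSpace M] [ChartedSpace H M] [TopologicalSpace M'] [ChartedSpace H' M']
  [TopologicalSpace M''] [ChartedSpace H'' M'']
  {I : ModelWithCorners ℝ F H} {I' : ModelWithCorners ℝ F' H'} {I'' : ModelWithCorners ℝ F'' H''}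

variable (I I') in
/-- The derivative of a map between manifolds, as a map between the model spaces. -/
def tder (f : M → M') (x : M) : F →L[ℝ] F' := mfderiv I I' f x

theorem tder_comp {g : M' → M''} {f : M → M'} {x : M} (hg : MDifferentiableAt I' I'' g (f x))
    (hf : MDifferentiableAt I I' f x) :
    tder I I'' (g ∘ f) x = (tder I' I'' g (f x)).comp (tder I I' f x) :=
  mfderiv_comp x hg hf

theorem tder_congr {f g : M → M'} {x : M} (h : f =ᶠ[𝓝 x] g) :
    tder I I' f x = tder I I' g x := by
  unfold tder
  rw [h.mfderiv_eq]

theorem tder_id (x : M) : tder I I (id : M → M) x = ContinuousLinearMap.id ℝ F := mfderiv_id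

/-- A `1`-form as a field of linear forms on the model space. -/
def DForm.toCLM (α : DForm I M 1) (x : M) : F →L[ℝ] ℝ :=
  (ContinuousAlternatingMap.ofSubsingletonLIE (𝕜 := ℝ) (E := F) (F := ℝ) (0 : Fin 1)).symm (α x)

theorem DForm.ext_toCLM {α β : DForm I M 1} (h : ∀ x, α.toCLM x = β.toCLM x) : α = β :=
  funext fun x => (ContinuousAlternatingMap.ofSubsingletonLIE (𝕜 := ℝ)
    (E := F) (F := ℝ) (0 : Fin 1)).symm.injective
    (h x)

/-- The pullback of a `1`-form at a point. -/
def DForm.pullAt (α : DForm I' M' 1) (f : M → M') (x : M) : F →L[ℝ] ℝ :=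
  (α.toCLM (f x)).comp (tder I I' f x)

theorem DForm.toCLM_pull (α : DForm I' M' 1) (f : M → M') (x : M) :
    (DForm.pull (I := I) f α).toCLM x = α.pullAt (I := I) f x := rfl

theorem DForm.pullAt_comp (α : DForm I'' M'' 1) {g : M' → M''} {f : M → M'} {x : M}
    (hg : MDifferentiableAt I' I'' g (f x)) (hf : MDifferentiableAt I I' f x) :
    α.pullAt (I := I) (g ∘ f) x = (α.pullAt (I := I') g (f x)).comp (tder I I' f x) := by
  unfold DForm.pullAt
  rw [tder_comp hg hf]
  rfl

theorem DForm.pullAt_congr (α : DForm I' M' 1) {f g : M → M'} {x : M} (h : f =ᶠ[𝓝 x] g) :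
    α.pullAt (I := I) f x = α.pullAt (I := I) g x := by
  unfold DForm.pullAt
  rw [tder_congr h, h.eq_of_nhds]

theorem DForm.pullAt_id (α : DForm I M 1) (x : M) : α.pullAt (I := I) id x = α.toCLM x := by
  unfold DForm.pullAt
  rw [tder_id]
  rfl

/-- A circle valued function is locally the exponential of a real function. -/
theorem exists_circle_log {u : M → Circle} {m : M} (hu : ContMDiffAt I (𝓡 1) ∞ u m) :
    ∃ θ : M → ℝ, ContMDiffAt I 𝓘(ℝ, ℝ) ∞ θ m ∧ ∀ y, u y = u m * Circle.exp (θ y) := by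
  -- Division by `u m` moves the value at `m` to `1`, where `arg` is the imaginary part of a smooth
  -- logarithm. The identity holds for every `y`, because `exp (arg z) = z` on the whole circle;
  -- only smoothness is local.
  refine ⟨fun y => Complex.arg ((u m)⁻¹ * u y : Circle), ?_, fun y => ?_⟩
  · have h1 : ContMDiffAt I 𝓘(ℝ, ℂ) ∞ (fun y => (((u m)⁻¹ * u y : Circle) : ℂ)) m := by
      have h2 : ContMDiff (𝓡 1) 𝓘(ℝ, ℂ) ∞ (fun z : Circle => (((u m)⁻¹ * z : Circle) : ℂ)) := by
        have h3 : ContMDiff 𝓘(ℝ, ℂ) 𝓘(ℝ, ℂ) ∞ (fun z : ℂ => (((u m)⁻¹ : Circle) : ℂ) * z) :=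
          (contDiff_const.mul contDiff_id).contMDiff
        have := finrank_real_complex_fact'
        exact h3.comp contMDiff_coe_sphere
      exact h2.contMDiffAt.comp m hu
    have h4 : ContMDiffAt 𝓘(ℝ, ℂ) 𝓘(ℝ, ℝ) ∞ Complex.arg
        ((fun y => (((u m)⁻¹ * u y : Circle) : ℂ)) m) := by
      refine ContDiffAt.contMDiffAt ?_
      have h5 : ContDiffAt ℝ ∞ (fun z => (Complex.log z).im)
          ((fun y => (((u m)⁻¹ * u y : Circle) : ℂ)) m) := by
        refine Complex.imCLM.contDiff.contDiffAt.comp _ (ContDiffAt.restrict_scalars ℝ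
          (Complex.contDiffAt_log ?_))
        simp
      simpa only [Complex.log_im] using h5
    exact h4.comp m h1
  · rw [Circle.exp_arg, mul_inv_cancel_left]

/-- A function with vanishing derivative is locally constant. -/
theorem eventually_eq_of_tder_eq_zero [I.Boundaryless] [IsManifold I 1 M] {θ : M → ℝ} {m : M}
    (h : ∀ᶠ y in 𝓝 m, MDifferentiableAt I 𝓘(ℝ, ℝ) θ y ∧ tder I 𝓘(ℝ, ℝ) θ y = 0) :
    ∀ᶠ y in 𝓝 m, θ y = θ m := by
  set c := extChartAt I m
  have h1 : ∀ᶠ v in 𝓝 (c m), v ∈ c.target ∧ MDifferentiableAt I 𝓘(ℝ, ℝ) θ (c.symm v) ∧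
      tder I 𝓘(ℝ, ℝ) θ (c.symm v) = 0 := by
    refine Filter.Eventually.and
      ((isOpen_extChartAt_target m).mem_nhds (mem_extChartAt_target m)) ?_
    have h2 : Tendsto c.symm (𝓝 (c m)) (𝓝 (c.symm (c m))) := continuousAt_extChartAt_symm m
    rw [extChartAt_to_inv] at h2
    exact h2.eventually h
  obtain ⟨r, hr, hb⟩ := Metric.mem_nhds_iff.1 h1
  have hc : ∀ v ∈ Metric.ball (c m) r, MDifferentiableAt 𝓘(ℝ, F) I c.symm v := fun v hv =>
    ((contMDiffOn_extChartAt_symm (n := 1) m).contMDiffAt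
        ((isOpen_extChartAt_target m).mem_nhds (hb hv).1) |>.mdifferentiableAt (by simp))
  have hd : ∀ v ∈ Metric.ball (c m) r, HasFDerivAt (θ ∘ c.symm) (0 : F →L[ℝ] ℝ) v := by
    intro v hv
    obtain ⟨-, h2, h3⟩ := hb hv
    have h4 := (h2.comp v (hc v hv)).differentiableAt.hasFDerivAt
    have h5 : fderiv ℝ (θ ∘ c.symm) v = 0 := by
      have h6 : tder 𝓘(ℝ, F) 𝓘(ℝ, ℝ) (θ ∘ c.symm) v = 0 := by
        rw [tder_comp h2 (hc v hv), h3, ContinuousLinearMap.zero_comp]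
      rwa [tder, mfderiv_eq_fderiv] at h6
    rwa [h5] at h4
  have hconst : ∀ v ∈ Metric.ball (c m) r, (θ ∘ c.symm) v = (θ ∘ c.symm) (c m) := fun v hv =>
    (convex_ball (c m) r).is_const_of_fderivWithin_eq_zero
      (fun w hw => (hd w hw).differentiableAt.differentiableWithinAt)
      (fun w hw => by
        rw [fderivWithin_of_isOpen Metric.isOpen_ball hw, (hd w hw).fderiv]) hv
      (Metric.mem_ball_self hr)
  have h7 : ∀ᶠ y in 𝓝 m, c y ∈ Metric.ball (c m) r :=
    (continuousAt_extChartAt m).eventually (Metric.ball_mem_nhds _ hr)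
  filter_upwards [h7, extChartAt_source_mem_nhds (I := I) m] with y hy hy'
  have := hconst _ hy
  simp only [Function.comp_apply] at this
  rwa [c.left_inv hy', extChartAt_to_inv] at this

end OneForms

/-! ### The connection form under rotation by a variable angle. -/

namespace Prequantisation

section Conn
variable {n : ℕ} {E : Type u} [TopologicalSpace E] [ChartedSpace (EuclideanSpace ℝ (Fin n)) E]
  {ħ : ℝ} {σ : DForm (𝓡 n) E 2} (P : Prequantisation ħ σ)
  {F H M : Type*} [NormedAddCommGroup F] [NormedSpace ℝ F] [TopologicalSpace H]
  {I : ModelWithCorners ℝ F H} [TopologicalSpace M] [ChartedSpace H M]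

theorem contMDiff_smul (z : Circle) :
    ContMDiff (totalModel n) (totalModel n) ∞ (fun y : P.Y => z • y) :=
  P.smul_smooth.comp (contMDiff_const.prodMk contMDiff_id)

theorem contMDiff_exp_smul : ContMDiff (𝓘(ℝ, ℝ).prod (totalModel n)) (totalModel n) ∞
    (fun p : ℝ × P.Y => Circle.exp p.1 • p.2) :=
  P.smul_smooth.comp ((contMDiff_circleExp.comp contMDiff_fst).prodMk contMDiff_snd)

theorem pullAt_const_smul {g : M → P.Y} {m : M} (hg : MDifferentiableAt I (totalModel n) g m)
    (z : Circle) :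
    P.conn.pullAt (I := I) (fun x => z • g x) m = P.conn.pullAt (I := I) g m := by
  have h1 := P.conn.pullAt_comp (((P.contMDiff_smul z).mdifferentiable (by simp)) (g m)) hg
  refine h1.trans ?_
  rw [← DForm.toCLM_pull, P.conn_invariant]
  rfl

/-- The derivative of the action splits into a part along the orbit, where the form takes the value
`ħ` on the generator, and a rotation of the derivative of `g`, which the invariance of the form
undoes. This is the transformation law `ω ↦ ω + ħ dθ`. -/
theorem pullAt_exp_smul {g : M → P.Y} {θ : M → ℝ} {m : M}
    (hθ : MDifferentiableAt I 𝓘(ℝ, ℝ) θ m) (hg : MDifferentiableAt I (totalModel n) g m) :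
    P.conn.pullAt (I := I) (fun x => Circle.exp (θ x) • g x) m =
      ħ • tder I 𝓘(ℝ, ℝ) θ m + P.conn.pullAt (I := I) g m := by
  have hS := P.contMDiff_exp_smul.mdifferentiable (by simp) (θ m, g m)
  have h1 := P.conn.pullAt_comp (f := fun x => (θ x, g x)) hS (hθ.prodMk hg)
  refine h1.trans ?_
  ext v
  set a : ℝ := tder I 𝓘(ℝ, ℝ) θ m v with ha
  set w := tder I (totalModel n) g m v with hw
  have h2 : tder I (𝓘(ℝ, ℝ).prod (totalModel n)) (fun x => (θ x, g x)) m v = (a, w) := by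
    unfold tder
    rw [mfderiv_prodMk hθ hg]
    rfl
  have h3 : tder (𝓘(ℝ, ℝ).prod (totalModel n)) (totalModel n)
      (fun p : ℝ × P.Y => Circle.exp p.1 • p.2) (θ m, g m) (a, w) =
      tder 𝓘(ℝ, ℝ) (totalModel n) (fun t : ℝ => Circle.exp t • g m) (θ m) a +
      tder (totalModel n) (totalModel n) (fun y : P.Y => Circle.exp (θ m) • y) (g m) w :=
    mfderiv_prod_eq_add_apply hS
  -- Translating time by `θ m` identifies the velocity of the orbit at time `θ m` with the generator
  -- at the rotated point, to which `conn_vertical` applies.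
  have h4 : tder 𝓘(ℝ, ℝ) (totalModel n) (fun t : ℝ => Circle.exp t • g m) (θ m) 1 =
      tder 𝓘(ℝ, ℝ) (totalModel n)
        (fun t : ℝ => Circle.exp t • (Circle.exp (θ m) • g m)) 0 1 := by
    have h5 : (fun t : ℝ => Circle.exp t • g m) =
        (fun t : ℝ => Circle.exp t • (Circle.exp (θ m) • g m)) ∘ fun t => t - θ m := by
      funext t
      rw [Function.comp_apply, smul_smul, ← Circle.exp_add, sub_add_cancel]
    have h6 : MDifferentiableAt 𝓘(ℝ, ℝ) (totalModel n)
        (fun t : ℝ => Circle.exp t • (Circle.exp (θ m) • g m)) (θ m - θ m) :=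
      (P.smul_smooth.comp (contMDiff_circleExp.prodMk contMDiff_const)).mdifferentiable
        (by simp) _
    have h7 : HasFDerivAt (fun t : ℝ => t - θ m) (ContinuousLinearMap.id ℝ ℝ) (θ m) :=
      (hasFDerivAt_id _).sub_const _
    rw [h5, tder_comp (f := fun t : ℝ => t - θ m) h6 h7.differentiableAt.mdifferentiableAt]
    have h8 : tder 𝓘(ℝ, ℝ) 𝓘(ℝ, ℝ) (fun t : ℝ => t - θ m) (θ m) = ContinuousLinearMap.id ℝ ℝ := by
      unfold tder
      rw [mfderiv_eq_fderiv]
      exact h7.fderiv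
    rw [h8, sub_self]
    rfl
  have h9 := DFunLike.congr_fun (P.pullAt_const_smul
    (mdifferentiableAt_id (I := totalModel n) (x := g m)) (Circle.exp (θ m))) w
  rw [DForm.pullAt_id] at h9
  have h10 : tder 𝓘(ℝ, ℝ) (totalModel n) (fun t : ℝ => Circle.exp t • g m) (θ m) a =
      a • tder 𝓘(ℝ, ℝ) (totalModel n)
        (fun t : ℝ => Circle.exp t • (Circle.exp (θ m) • g m)) 0 1 := by
    rw [← h4]
    refine Eq.trans ?_ (map_smul _ a (1 : ℝ))
    rw [smul_eq_mul, mul_one]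
  have h11 : P.conn.toCLM (Circle.exp (θ m) • g m) (tder 𝓘(ℝ, ℝ) (totalModel n)
        (fun t : ℝ => Circle.exp t • (Circle.exp (θ m) • g m)) 0 1) = ħ :=
    P.conn_vertical _
  change P.conn.toCLM (Circle.exp (θ m) • g m) (tder (𝓘(ℝ, ℝ).prod (totalModel n)) (totalModel n)
      (fun p : ℝ × P.Y => Circle.exp p.1 • p.2) (θ m, g m)
      (tder I (𝓘(ℝ, ℝ).prod (totalModel n)) (fun x => (θ x, g x)) m v)) =
    ħ * a + P.conn.toCLM (g m) w
  rw [h2, h3, map_add, h10]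
  refine congrArg₂ (· + ·) ?_ h9
  refine (map_smul _ a _).trans ?_
  rw [h11, smul_eq_mul, mul_comm]

end Conn

end Prequantisation

/-! ### Exterior derivative of forms pulled back to a vector space. -/

section Pull
variable {F H V M : Type*}
  [NormedAddCommGroup F] [NormedSpace ℝ F] [TopologicalSpace H]
  [NormedAddCommGroup V] [NormedSpace ℝ V]
  [TopologicalSpace M] [ChartedSpace H M]
  {I : ModelWithCorners ℝ F H} [I.Boundaryless] [IsManifold I ∞ M] {k : ℕ}

/-- The single chart centred at `f v` is used at all nearby points, so that the formula can be
differentiated at `v`. -/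
theorem DForm.pull_eventuallyEq_inChart (α : DForm I M k) {f : V → M} {v : V}
    (hf : ContMDiffAt 𝓘(ℝ, V) I 1 f v) :
    ∀ᶠ w in 𝓝 v, DForm.pull (I := 𝓘(ℝ, V)) f α w =
      (α.inChart (f v) (extChartAt I (f v) (f w))).compContinuousLinearMap
        (fderiv ℝ (extChartAt I (f v) ∘ f) w) := by
  have : IsManifold I 1 M := IsManifold.of_le (n := ∞) (by simp)
  have h1 : ∀ᶠ w in 𝓝 v, ContMDiffAt 𝓘(ℝ, V) I 1 f w :=
    (contMDiffAt_iff_contMDiffAt_nhds (by simp)).1 hf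
  have h2 : ∀ᶠ w in 𝓝 v, f w ∈ (chartAt H (f v)).source :=
    hf.continuousAt.eventually ((chartAt H (f v)).open_source.mem_nhds (mem_chart_source H (f v)))
  filter_upwards [h1, h2, h2.eventually_nhds] with w hw hw2 hw3
  set c := extChartAt I (f v) with hc
  have hw4 : f w ∈ c.source := by rwa [hc, extChartAt_source]
  have hS : MDifferentiableAt 𝓘(ℝ, V) 𝓘(ℝ, F) (c ∘ f) w :=
    (mdifferentiableAt_extChartAt hw2).comp w (hw.mdifferentiableAt (by simp))
  have hcs : MDifferentiableAt 𝓘(ℝ, F) I c.symm (c (f w)) :=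
    ((contMDiffOn_extChartAt_symm (n := 1) (f v)).contMDiffAt
      ((isOpen_extChartAt_target (f v)).mem_nhds (c.map_source hw4))).mdifferentiableAt (by simp)
  have h5 : tder 𝓘(ℝ, V) I f w =
      (tder 𝓘(ℝ, F) I c.symm (c (f w))).comp (fderiv ℝ (c ∘ f) w) := by
    have h6 : fderiv ℝ (c ∘ f) w = tder 𝓘(ℝ, V) 𝓘(ℝ, F) (c ∘ f) w := mfderiv_eq_fderiv.symm
    rw [h6]
    refine Eq.trans ?_ (tder_comp (f := c ∘ f) hcs hS)
    apply tder_congr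
    filter_upwards [hw3] with w' hw'
    exact (c.left_inv (by rwa [hc, extChartAt_source])).symm
  -- Forgetting that the tangent space depends on the point allows the base point to be rewritten.
  let α' : M → F [⋀^Fin k]→L[ℝ] ℝ := fun y => α y
  have h7 : DForm.pull (I := 𝓘(ℝ, V)) f α w =
      (α' (f w)).compContinuousLinearMap (tder 𝓘(ℝ, V) I f w) := rfl
  have h8 : α' (f w) = α' (c.symm (c (f w))) := by rw [c.left_inv hw4]
  refine h7.trans ?_
  rw [h5, h8]
  rfl

/-- The value of `α.d` at `f v` is by definition computed in the chart centred at `f v`, so the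
claim reduces to the naturality of `extDeriv` between vector spaces, with no change of chart. -/
theorem DForm.extDeriv_pull {α : DForm I M k} (hα : α.Smooth) {f : V → M} {v : V}
    (hf : ContMDiffAt 𝓘(ℝ, V) I ∞ f v) :
    extDeriv (fun w => (DForm.pull (I := 𝓘(ℝ, V)) f α w : V [⋀^Fin k]→L[ℝ] ℝ)) v =
      DForm.pull (I := 𝓘(ℝ, V)) f α.d v := by
  have h1 := α.pull_eventuallyEq_inChart (hf.of_le (by simp))
  have hS : ContDiffAt ℝ ∞ (extChartAt I (f v) ∘ f) v :=
    ((contMDiffAt_extChartAt (n := ∞) (x := f v)).comp v hf).contDiffAt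
  have hβ : ContDiffAt ℝ ∞ (α.inChart (f v)) (extChartAt I (f v) (f v)) :=
    (hα (f v)).contDiffAt ((isOpen_extChartAt_target (f v)).mem_nhds (mem_extChartAt_target _))
  have h2 := extDeriv_pullback (f := extChartAt I (f v) ∘ f) (x := v)
    (hβ.differentiableAt (by simp)) hS (by
      rw [minSmoothness_of_isRCLikeNormedField]
      exact WithTop.coe_le_coe.2 (le_top (a := (2 : ℕ∞))))
  rw [Filter.EventuallyEq.extDeriv_eq h1]
  refine h2.trans ?_
  have h6 : fderiv ℝ (extChartAt I (f v) ∘ f) v =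
      (tder I 𝓘(ℝ, F) (extChartAt I (f v)) (f v)).comp (tder 𝓘(ℝ, V) I f v) := by
    rw [← tder_comp (mdifferentiableAt_extChartAt (mem_chart_source H (f v)))
      (hf.mdifferentiableAt (by simp))]
    exact mfderiv_eq_fderiv.symm
  rw [h6]
  rfl

theorem DForm.contDiffAt_pullAt {α : DForm I M 1} (hα : α.Smooth) {f : V → M} {v : V}
    (hf : ContMDiffAt 𝓘(ℝ, V) I ∞ f v) :
    ContDiffAt ℝ ∞ (fun w => α.pullAt (I := 𝓘(ℝ, V)) f w) v := by
  have h1 := α.pull_eventuallyEq_inChart (hf.of_le (by simp))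
  have hS : ContDiffAt ℝ ∞ (extChartAt I (f v) ∘ f) v :=
    ((contMDiffAt_extChartAt (n := ∞) (x := f v)).comp v hf).contDiffAt
  have hβ : ContDiffAt ℝ ∞ (α.inChart (f v)) ((extChartAt I (f v) ∘ f) v) :=
    (hα (f v)).contDiffAt ((isOpen_extChartAt_target (f v)).mem_nhds (mem_extChartAt_target _))
  set L := (ContinuousAlternatingMap.ofSubsingletonLIE (𝕜 := ℝ) (E := F) (F := ℝ)
    (0 : Fin 1)).symm.toContinuousLinearEquiv.toContinuousLinearMap
  have h3 : ContDiffAt ℝ ∞ (fun w => (L (α.inChart (f v) ((extChartAt I (f v) ∘ f) w))).comp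
      (fderiv ℝ (extChartAt I (f v) ∘ f) w)) v :=
    (L.contDiff.contDiffAt.comp v (hβ.comp v hS)).clm_comp (hS.fderiv_right (by simp))
  refine h3.congr_of_eventuallyEq ?_
  filter_upwards [h1] with w hw
  exact congrArg (ContinuousAlternatingMap.ofSubsingletonLIE (𝕜 := ℝ) (E := V) (F := ℝ)
    (0 : Fin 1)).symm hw

theorem extDeriv_ofSubsingleton_apply {A : V → V →L[ℝ] ℝ} {v : V} (hA : DifferentiableAt ℝ A v)
    (x y : V) :
    extDeriv (fun w => ContinuousAlternatingMap.ofSubsingletonLIE (𝕜 := ℝ) (E := V) (F := ℝ)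
      (0 : Fin 1) (A w)) v ![x, y] = fderiv ℝ A v x y - fderiv ℝ A v y x := by
  have h1 : DifferentiableAt ℝ (fun w => ContinuousAlternatingMap.ofSubsingletonLIE (𝕜 := ℝ)
      (E := V) (F := ℝ) (0 : Fin 1) (A w)) v :=
    (LinearIsometryEquiv.differentiableAt _).comp v hA
  rw [extDeriv_apply h1]
  have h2 : ∀ m : Fin 1 → V, ∀ w, ContinuousAlternatingMap.ofSubsingletonLIE (𝕜 := ℝ)
      (E := V) (F := ℝ) (0 : Fin 1) (A w) m = A w (m 0) := fun _ _ => rfl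
  have h3 : ∀ u x : V, fderiv ℝ (fun w => A w u) v x = fderiv ℝ A v x u := fun u x => by
    rw [fderiv_clm_apply hA (differentiableAt_const u)]
    simp
  simp only [h2, h3]
  simp [Fin.removeNth]
  ring

end Pull

/-! ### Local morphisms and the rigidity of gauge transformations. -/

namespace Prequantisation

section Morph
variable {n : ℕ} {E E' E'' : Type u} [TopologicalSpace E]
  [ChartedSpace (EuclideanSpace ℝ (Fin n)) E] [TopologicalSpace E']
  [ChartedSpace (EuclideanSpace ℝ (Fin n)) E'] [TopologicalSpace E'']
  [ChartedSpace (EuclideanSpace ℝ (Fin n)) E''] {ħ : ℝ} {σ : DForm (𝓡 n) E 2}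
  {σ' : DForm (𝓡 n) E' 2} {σ'' : DForm (𝓡 n) E'' 2}

/-- `f` is smooth at `y` and preserves the connection forms there. -/
structure MorphAt (P : Prequantisation ħ σ) (P' : Prequantisation ħ σ')
    (f : P.Y → P'.Y) (y : P.Y) : Prop where
  smooth : ContMDiffAt (totalModel n) (totalModel n) ∞ f y
  preserves : P'.conn.pullAt (I := totalModel n) f y = P.conn.toCLM y

variable {P : Prequantisation ħ σ} {P' : Prequantisation ħ σ'} {P'' : Prequantisation ħ σ''}

theorem MorphAt.comp {f : P.Y → P'.Y} {g : P'.Y → P''.Y} {y : P.Y} (hg : MorphAt P' P'' g (f y))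
    (hf : MorphAt P P' f y) : MorphAt P P'' (g ∘ f) y where
  smooth := hg.smooth.comp y hf.smooth
  preserves := by
    rw [DForm.pullAt_comp _ (hg.smooth.mdifferentiableAt (by simp))
      (hf.smooth.mdifferentiableAt (by simp)), hg.preserves]
    exact hf.preserves

theorem MorphAt.congr {f g : P.Y → P'.Y} {y : P.Y} (hf : MorphAt P P' f y)
    (h : g =ᶠ[𝓝 y] f) : MorphAt P P' g y where
  smooth := hf.smooth.congr_of_eventuallyEq h
  preserves := by rw [DForm.pullAt_congr _ h, hf.preserves]

theorem MorphAt.const_smul {f : P.Y → P'.Y} {y : P.Y} (hf : MorphAt P P' f y) (z : Circle) :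
    MorphAt P P' (fun x => z • f x) y where
  smooth := (P'.contMDiff_smul z).contMDiffAt.comp y hf.smooth
  preserves := by
    rw [P'.pullAt_const_smul (hf.smooth.mdifferentiableAt (by simp)), hf.preserves]

theorem MorphAt.id (y : P.Y) : MorphAt P P id y where
  smooth := contMDiffAt_id
  preserves := DForm.pullAt_id _ _

theorem IsMorphismOver.of_morphAt {φ : E → E'} {f : P.Y → P'.Y} (h : ∀ y, MorphAt P P' f y)
    (hc : ∀ y, P'.proj (f y) = φ (P.proj y)) (he : ∀ (z : Circle) (y : P.Y), f (z • y) = z • f y) :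
    IsMorphismOver P P' φ f where
  smooth y := (h y).smooth
  covers := hc
  equivariant := he
  preserves := DForm.ext_toCLM fun y => (h y).preserves

theorem IsMorphismOver.morphAt {φ : E → E'} {f : P.Y → P'.Y} (h : IsMorphismOver P P' φ f)
    (y : P.Y) : MorphAt P P' f y where
  smooth := h.smooth y
  preserves := by rw [← DForm.toCLM_pull, h.preserves]

end Morph

section Local
variable {n : ℕ} {E : Type u} [TopologicalSpace E] [ChartedSpace (EuclideanSpace ℝ (Fin n)) E]
  {ħ : ℝ} {σ : DForm (𝓡 n) E 2} (P : Prequantisation ħ σ)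
  {F H M : Type*} [NormedAddCommGroup F] [NormedSpace ℝ F] [TopologicalSpace H]
  {I : ModelWithCorners ℝ F H} [TopologicalSpace M] [ChartedSpace H M]

/-- In a local trivialisation `u` is the quotient of the fibre coordinates of `u • g` and `g`. -/
theorem contMDiffAt_of_smul {g : M → P.Y} {u : M → Circle} {m : M}
    (hg : ContMDiffAt I (totalModel n) ∞ g m)
    (hug : ContMDiffAt I (totalModel n) ∞ (fun x => u x • g x) m) :
    ContMDiffAt I (𝓡 1) ∞ u m := by
  obtain ⟨t, ht, h1, -, h3⟩ := P.locallyTrivial (P.proj (g m))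
  have hm : g m ∈ t.source := t.mem_source.2 ht
  have hm' : u m • g m ∈ t.source := t.mem_source.2 (by rwa [P.proj_smul])
  have h4 : ContMDiffAt I (𝓡 1) ∞ (fun x => (t (g x)).2) m :=
    contMDiffAt_snd.comp m ((h1.contMDiffAt (t.open_source.mem_nhds hm)).comp m hg)
  have h5 : ContMDiffAt I (𝓡 1) ∞ (fun x => (t (u x • g x)).2) m :=
    ContMDiffAt.comp (g := fun y : E × Circle => y.2) m contMDiffAt_snd
      (ContMDiffAt.comp (g := t) (f := fun x => u x • g x) m
        (h1.contMDiffAt (t.open_source.mem_nhds hm')) hug)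
  refine (h5.mul h4.inv).congr_of_eventuallyEq ?_
  filter_upwards [hg.continuousAt.eventually (t.open_source.mem_nhds hm)] with x hx
  simp only [Pi.mul_apply]
  rw [h3 _ _ hx, mul_inv_cancel_right]

/-- A gauge transformation which preserves the connection is locally constant. -/
theorem eventually_eq_of_pullAt_smul_eq [I.Boundaryless] [IsManifold I ∞ M] (hħ : 0 < ħ)
    {g : M → P.Y} {u : M → Circle} {m : M}
    (hg : ∀ᶠ x in 𝓝 m, ContMDiffAt I (totalModel n) ∞ g x)
    (hug : ContMDiffAt I (totalModel n) ∞ (fun x => u x • g x) m)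
    (hp : ∀ᶠ x in 𝓝 m, P.conn.pullAt (I := I) (fun x => u x • g x) x =
      P.conn.pullAt (I := I) g x) :
    ∀ᶠ x in 𝓝 m, u x = u m := by
  have : IsManifold I 1 M := IsManifold.of_le (n := ∞) (by simp)
  obtain ⟨θ, hθ, hu⟩ := exists_circle_log (P.contMDiffAt_of_smul hg.self_of_nhds hug)
  have hθ' : ∀ᶠ x in 𝓝 m, ContMDiffAt I 𝓘(ℝ, ℝ) 1 θ x :=
    (contMDiffAt_iff_contMDiffAt_nhds (by simp)).1 (hθ.of_le (by simp))
  have h1 : ∀ᶠ x in 𝓝 m, MDifferentiableAt I 𝓘(ℝ, ℝ) θ x ∧ tder I 𝓘(ℝ, ℝ) θ x = 0 := by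
    filter_upwards [hθ', hg, hp] with x h1 h2 h3
    have h4 := h1.mdifferentiableAt (by simp)
    have h2' := h2.mdifferentiableAt (by simp)
    refine ⟨h4, ?_⟩
    have h5 : MDifferentiableAt I (totalModel n) (fun y => Circle.exp (θ y) • g y) x :=
      MDifferentiableAt.comp (f := fun y => (θ y, g y)) x
        (P.contMDiff_exp_smul.mdifferentiable (by simp) (θ x, g x)) (h4.prodMk h2')
    -- With `u = u m * exp θ`, the pullback along `u • g` is `ħ dθ` plus the pullback along `g`;
    -- equality of the two pullbacks leaves `ħ dθ = 0`.
    have h6 := P.pullAt_const_smul h5 (u m)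
    rw [P.pullAt_exp_smul h4 h2'] at h6
    have h7 : (fun y => u m • Circle.exp (θ y) • g y) = fun y => u y • g y := by
      funext y
      rw [smul_smul, ← hu]
    rw [h7, h3, right_eq_add] at h6
    exact (smul_eq_zero.1 h6).resolve_left hħ.ne'
  filter_upwards [eventually_eq_of_tder_eq_zero h1] with x hx
  rw [hu x, hx, ← hu m]

/-- Here `s` is the unit section of a trivialisation and `k` is the fibre coordinate. Together they
carry all that is needed of local triviality later on. -/
theorem exists_local_section (x : E) : ∃ (U : Set E) (s : E → P.Y) (k : P.Y → Circle),
    IsOpen U ∧ x ∈ U ∧ ContMDiffOn (𝓡 n) (totalModel n) ∞ s U ∧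
    ContMDiffOn (totalModel n) (𝓡 1) ∞ k (P.proj ⁻¹' U) ∧ (∀ x ∈ U, P.proj (s x) = x) ∧
    ∀ y, P.proj y ∈ U → y = k y • s (P.proj y) ∧ ∀ z : Circle, k (z • y) = z * k y := by
  obtain ⟨t, ht, h1, h2, h3⟩ := P.locallyTrivial x
  have hs : ∀ x ∈ t.baseSet, t.toOpenPartialHomeomorph.symm (x, 1) ∈ t.source := fun x hx =>
    t.toOpenPartialHomeomorph.map_target (t.mem_target.2 hx)
  refine ⟨t.baseSet, fun x => t.toOpenPartialHomeomorph.symm (x, 1), fun y => (t y).2,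
    t.open_baseSet, ht, ?_, ?_, fun x hx => t.proj_symm_apply' hx, fun y hy => ⟨?_, fun z => ?_⟩⟩
  · exact h2.comp (contMDiff_id.prodMk contMDiff_const).contMDiffOn fun x hx => t.mem_target.2 hx
  · rw [← t.source_eq]
    exact contMDiff_snd.comp_contMDiffOn h1
  · have hy' : y ∈ t.source := t.mem_source.2 hy
    refine t.injOn hy' (t.mem_source.2 (by rw [P.proj_smul, t.proj_symm_apply' hy]; exact hy)) ?_
    change t y = t _
    rw [h3 _ _ (hs _ hy), t.apply_symm_apply' hy, mul_one]
    exact Prod.ext (t.coe_fst hy') rfl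
  · simp only [h3 z y (t.mem_source.2 hy)]

end Local

end Prequantisation

/-! ### Prequantisations of the same form are locally isomorphic. -/

namespace Prequantisation

section Local
variable {n : ℕ} {E : Type u} [TopologicalSpace E] [ChartedSpace (EuclideanSpace ℝ (Fin n)) E]
  {ħ : ℝ} {σ : DForm (𝓡 n) E 2} (P P' : Prequantisation ħ σ)

/-- The pullback of the connection form along a section of `P` in coordinates of `E`. -/
theorem fderiv_pullAt_section [IsManifold (𝓡 n) ∞ E] {V : Type*} [NormedAddCommGroup V]
    [NormedSpace ℝ V] {f : V → P.Y} {v : V}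
    (hf : ContMDiffAt 𝓘(ℝ, V) (totalModel n) ∞ f v) (x y : V) :
    fderiv ℝ (fun w => P.conn.pullAt (I := 𝓘(ℝ, V)) f w) v x y -
      fderiv ℝ (fun w => P.conn.pullAt (I := 𝓘(ℝ, V)) f w) v y x =
    DForm.pull (I := 𝓘(ℝ, V)) (P.proj ∘ f) σ v ![x, y] := by
  rw [← extDeriv_ofSubsingleton_apply
    ((DForm.contDiffAt_pullAt P.conn_smooth hf).differentiableAt (by simp))]
  have h0 : (fun w => ContinuousAlternatingMap.ofSubsingletonLIE (𝕜 := ℝ) (E := V) (F := ℝ)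
      (0 : Fin 1) (P.conn.pullAt (I := 𝓘(ℝ, V)) f w)) =
      fun w => DForm.pull (I := 𝓘(ℝ, V)) f P.conn w :=
    funext fun w => (ContinuousAlternatingMap.ofSubsingletonLIE (𝕜 := ℝ) (E := V) (F := ℝ)
      (0 : Fin 1)).apply_symm_apply (DForm.pull (I := 𝓘(ℝ, V)) f P.conn w)
  rw [h0]
  have h1 := DForm.extDeriv_pull P.conn_smooth hf
  have h2 : (DForm.pull (I := 𝓘(ℝ, V)) f (DForm.pull (I := totalModel n) P.proj σ) v) =
      DForm.pull (I := 𝓘(ℝ, V)) (P.proj ∘ f) σ v := by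
    simp only [DForm.pull]
    rw [mfderiv_comp v (P.proj_smooth.mdifferentiable (by simp) _)
      (hf.mdifferentiableAt (by simp))]
    rfl
  rw [P.curvature, h2] at h1
  exact congrArg (fun β : V [⋀^Fin 2]→L[ℝ] ℝ => β ![x, y]) h1

/-- Two sections differ by a gauge transformation from having the same connection form. -/
theorem exists_gauge [IsManifold (𝓡 n) ∞ E] (hħ : 0 < ħ) {x : E} {U : Set E} (hU : IsOpen U)
    (hx : x ∈ U) {s : E → P.Y} {s' : E → P'.Y}
    (hs : ContMDiffOn (𝓡 n) (totalModel n) ∞ s U) (hs' : ContMDiffOn (𝓡 n) (totalModel n) ∞ s' U)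
    (hps : ∀ y ∈ U, P.proj (s y) = y) (hps' : ∀ y ∈ U, P'.proj (s' y) = y) :
    ∃ W : Set E, IsOpen W ∧ x ∈ W ∧ W ⊆ U ∧ ∃ θ : E → ℝ, ContMDiffOn (𝓡 n) 𝓘(ℝ, ℝ) ∞ θ W ∧
      ∀ y ∈ W, P'.conn.pullAt (I := 𝓡 n) (fun z => Circle.exp (θ z) • s' z) y =
        P.conn.pullAt (I := 𝓡 n) s y := by
  set V := EuclideanSpace ℝ (Fin n)
  set c := extChartAt (𝓡 n) x with hc
  have hO : IsOpen (c.target ∩ c.symm ⁻¹' U) :=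
    (continuousOn_extChartAt_symm x).isOpen_inter_preimage (isOpen_extChartAt_target x) hU
  have hxO : c x ∈ c.target ∩ c.symm ⁻¹' U := by
    refine ⟨mem_extChartAt_target x, ?_⟩
    rw [mem_preimage, extChartAt_to_inv]
    exact hx
  obtain ⟨r, hr, hb⟩ := Metric.isOpen_iff.1 hO _ hxO
  have hcs : ∀ v ∈ Metric.ball (c x) r, ContMDiffAt 𝓘(ℝ, V) (𝓡 n) ∞ c.symm v := fun v hv =>
    (contMDiffOn_extChartAt_symm x).contMDiffAt
      ((isOpen_extChartAt_target x).mem_nhds (hb hv).1)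
  have hf : ∀ v ∈ Metric.ball (c x) r, ContMDiffAt 𝓘(ℝ, V) (totalModel n) ∞ (s ∘ c.symm) v :=
    fun v hv => (hs.contMDiffAt (hU.mem_nhds (hb hv).2)).comp v (hcs v hv)
  have hf' : ∀ v ∈ Metric.ball (c x) r, ContMDiffAt 𝓘(ℝ, V) (totalModel n) ∞ (s' ∘ c.symm) v :=
    fun v hv => (hs'.contMDiffAt (hU.mem_nhds (hb hv).2)).comp v (hcs v hv)
  set A := fun w => P.conn.pullAt (I := 𝓘(ℝ, V)) (s ∘ c.symm) w with hA
  set A' := fun w => P'.conn.pullAt (I := 𝓘(ℝ, V)) (s' ∘ c.symm) w with hA'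
  have dA : ∀ v ∈ Metric.ball (c x) r, ContDiffAt ℝ ∞ A v := fun v hv =>
    DForm.contDiffAt_pullAt P.conn_smooth (hf v hv)
  have dA' : ∀ v ∈ Metric.ball (c x) r, ContDiffAt ℝ ∞ A' v := fun v hv =>
    DForm.contDiffAt_pullAt P'.conn_smooth (hf' v hv)
  have hproj : ∀ v ∈ Metric.ball (c x) r,
      DForm.pull (I := 𝓘(ℝ, V)) (P.proj ∘ s ∘ c.symm) σ v =
      DForm.pull (I := 𝓘(ℝ, V)) (P'.proj ∘ s' ∘ c.symm) σ v := by
    intro v hv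
    have h1 : P.proj ∘ s ∘ c.symm =ᶠ[𝓝 v] P'.proj ∘ s' ∘ c.symm := by
      filter_upwards [Metric.isOpen_ball.mem_nhds hv] with w hw
      simp only [Function.comp_apply]
      rw [hps _ (hb hw).2, hps' _ (hb hw).2]
    let σ' : E → V [⋀^Fin 2]→L[ℝ] ℝ := fun y => σ y
    change (σ' ((P.proj ∘ s ∘ c.symm) v)).compContinuousLinearMap (tder 𝓘(ℝ, V) (𝓡 n) _ v) =
      (σ' ((P'.proj ∘ s' ∘ c.symm) v)).compContinuousLinearMap (tder 𝓘(ℝ, V) (𝓡 n) _ v)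
    rw [tder_congr h1, h1.eq_of_nhds]
  have hd : DifferentiableOn ℝ (fun v => A v - A' v) (Metric.ball (c x) r) := fun v hv =>
    ((dA v hv).sub (dA' v hv)).differentiableAt (by simp) |>.differentiableWithinAt
  -- Poincaré lemma: the antisymmetric parts of the derivatives of `A` and `A'` are both the
  -- coordinate expression of `σ`, so `A - A'` is closed on the ball and has a primitive.
  obtain ⟨G, hG⟩ := (convex_ball (c x) r).exists_forall_hasFDerivAt_of_fderiv_symmetric
    Metric.isOpen_ball hd (by
      intro v hv a b
      have d1 := (dA v hv).differentiableAt (by simp)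
      have d2 := (dA' v hv).differentiableAt (by simp)
      have e1 := P.fderiv_pullAt_section (hf v hv) a b
      have e2 := P'.fderiv_pullAt_section (hf' v hv) a b
      rw [hproj v hv, ← e2] at e1
      rw [fderiv_fun_sub d1 d2]
      simp only [sub_apply]
      change fderiv ℝ A v a b - fderiv ℝ A v b a = fderiv ℝ A' v a b - fderiv ℝ A' v b a at e1
      linarith)
  have hGs : ContDiffOn ℝ ∞ G (Metric.ball (c x) r) := by
    rw [contDiffOn_infty_iff_fderiv_of_isOpen Metric.isOpen_ball]
    refine ⟨fun v hv => (hG v hv).differentiableAt.differentiableWithinAt, ?_⟩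
    have h1 : ContDiffOn ℝ ∞ (fun v => A v - A' v) (Metric.ball (c x) r) := fun v hv =>
      ((dA v hv).sub (dA' v hv)).contDiffWithinAt
    exact h1.congr fun v hv => (hG v hv).fderiv
  have hWo : IsOpen (c.source ∩ c ⁻¹' Metric.ball (c x) r) :=
    (continuousOn_extChartAt x).isOpen_inter_preimage (isOpen_extChartAt_source x)
      Metric.isOpen_ball
  have hcc : ∀ y ∈ c.source, ContMDiffAt (𝓡 n) 𝓘(ℝ, V) ∞ c y := fun y hy =>
    contMDiffOn_extChartAt.contMDiffAt
      ((chartAt V x).open_source.mem_nhds (by rwa [hc, extChartAt_source] at hy))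
  have hθ : ContMDiffOn (𝓡 n) 𝓘(ℝ, ℝ) ∞ (fun y => ħ⁻¹ * G (c y))
      (c.source ∩ c ⁻¹' Metric.ball (c x) r) := fun y hy =>
    ((contDiff_const.mul contDiff_id).contMDiff (n := ∞).contMDiffAt.comp y
      (((hGs.contDiffAt (Metric.isOpen_ball.mem_nhds hy.2)).contMDiffAt).comp y
        (hcc y hy.1))).contMDiffWithinAt
  -- The factor `ħ⁻¹` in the angle cancels the `ħ` of `pullAt_exp_smul`, so the rotation adds
  -- exactly `dG = A - A'`.
  refine ⟨c.source ∩ c ⁻¹' Metric.ball (c x) r, hWo,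
    ⟨mem_extChartAt_source x, Metric.mem_ball_self hr⟩, fun y hy => ?_,
    fun y => ħ⁻¹ * G (c y), hθ, fun y hy => ?_⟩
  · have := (hb hy.2).2
    rwa [mem_preimage, c.left_inv hy.1] at this
  · have hyU : y ∈ U := by
      have := (hb hy.2).2
      rwa [mem_preimage, c.left_inv hy.1] at this
    have d0 := (hcc y hy.1).mdifferentiableAt (by simp)
    rw [P'.pullAt_exp_smul ((hθ.contMDiffAt (hWo.mem_nhds hy)).mdifferentiableAt (by simp))
      ((hs'.contMDiffAt (hU.mem_nhds hyU)).mdifferentiableAt (by simp))]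
    have h1 : HasFDerivAt (fun v => ħ⁻¹ * G v) (ħ⁻¹ • (A (c y) - A' (c y))) (c y) :=
      (hG (c y) hy.2).const_mul _
    have h2 : tder (𝓡 n) 𝓘(ℝ, ℝ) (fun y => ħ⁻¹ * G (c y)) y =
        (ħ⁻¹ • (A (c y) - A' (c y))).comp (tder (𝓡 n) 𝓘(ℝ, V) c y) := by
      refine (tder_comp (g := fun v => ħ⁻¹ * G v) h1.differentiableAt.mdifferentiableAt d0).trans ?_
      congr 1
      rw [← h1.fderiv]
      exact mfderiv_eq_fderiv
    have h3 : c.symm ∘ c =ᶠ[𝓝 y] id := by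
      filter_upwards [(isOpen_extChartAt_source x).mem_nhds hy.1] with z hz
      exact c.left_inv hz
    have h4 : P.conn.pullAt (I := 𝓡 n) s y = (A (c y)).comp (tder (𝓡 n) 𝓘(ℝ, V) c y) := by
      rw [← DForm.pullAt_comp _ ((hf _ hy.2).mdifferentiableAt (by simp)) d0]
      exact (DForm.pullAt_congr _ (h3.fun_comp s)).symm
    have h5 : P'.conn.pullAt (I := 𝓡 n) s' y = (A' (c y)).comp (tder (𝓡 n) 𝓘(ℝ, V) c y) := by
      rw [← DForm.pullAt_comp _ ((hf' _ hy.2).mdifferentiableAt (by simp)) d0]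
      exact (DForm.pullAt_congr _ (h3.fun_comp s')).symm
    rw [h2, h4, h5]
    ext v
    simp only [add_apply, smul_apply,
      ContinuousLinearMap.comp_apply, sub_apply, smul_eq_mul]
    field_simp
    ring

/-- Prequantisations of `(E, σ)` are locally isomorphic. -/
theorem exists_local_isomorphism [IsManifold (𝓡 n) ∞ E] (hħ : 0 < ħ) (x : E) :
    ∃ (U : Set E) (ψ : P.Y → P'.Y), IsOpen U ∧ x ∈ U ∧ ∀ y, P.proj y ∈ U →
      P'.proj (ψ y) = P.proj y ∧ (∀ z : Circle, ψ (z • y) = z • ψ y) ∧ MorphAt P P' ψ y := by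
  obtain ⟨U, s, k, hU, hx, hs, hk, hps, hy⟩ := P.exists_local_section x
  obtain ⟨U', s', -, hU', hx', hs', -, hps', -⟩ := P'.exists_local_section x
  obtain ⟨W, hW, hxW, hWU, θ, hθ, hθ'⟩ := P.exists_gauge P' hħ (hU.inter hU') ⟨hx, hx'⟩
    (hs.mono inter_subset_left) (hs'.mono inter_subset_right)
    (fun y hy => hps y hy.1) (fun y hy => hps' y hy.2)
  set s'' := fun z => Circle.exp (θ z) • s' z with hs''
  have hs''s : ContMDiffOn (𝓡 n) (totalModel n) ∞ s'' W :=
    P'.contMDiff_exp_smul.comp_contMDiffOn (hθ.prodMk (hs'.mono fun z hz => (hWU hz).2))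
  -- The map sends `k • s` to `k • s''`. The two sections have the same pulled-back connection form,
  -- and writing `k` locally as a constant times `exp φ` adds the same term `ħ dφ` on both sides.
  refine ⟨W, fun y => k y • s'' (P.proj y), hW, hxW, fun y hyW => ⟨?_, fun z => ?_, ?_⟩⟩
  · rw [P'.proj_smul, P'.proj_smul, hps' _ (hWU hyW).2]
  · simp only [(hy y (hWU hyW).1).2, P.proj_smul, mul_smul]
  · have kU : ContMDiffAt (totalModel n) (𝓡 1) ∞ k y :=
      hk.contMDiffAt ((hU.preimage P.proj_smooth.continuous).mem_nhds (hWU hyW).1)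
    have g1 : ContMDiffAt (totalModel n) (totalModel n) ∞ (s ∘ P.proj) y :=
      (hs.contMDiffAt (hU.mem_nhds (hWU hyW).1)).comp y P.proj_smooth.contMDiffAt
    have g2 : ContMDiffAt (totalModel n) (totalModel n) ∞ (s'' ∘ P.proj) y :=
      (hs''s.contMDiffAt (hW.mem_nhds hyW)).comp y P.proj_smooth.contMDiffAt
    have hg : P'.conn.pullAt (I := totalModel n) (s'' ∘ P.proj) y =
        P.conn.pullAt (I := totalModel n) (s ∘ P.proj) y := by
      rw [DForm.pullAt_comp _ ((hs''s.contMDiffAt (hW.mem_nhds hyW)).mdifferentiableAt (by simp))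
        (P.proj_smooth.mdifferentiable (by simp) _), hθ' _ hyW, ← DForm.pullAt_comp _
        ((hs.contMDiffAt (hU.mem_nhds (hWU hyW).1)).mdifferentiableAt (by simp))
        (P.proj_smooth.mdifferentiable (by simp) _)]
    obtain ⟨φ, hφ, hkφ⟩ := exists_circle_log kU
    have dφ := hφ.mdifferentiableAt (by simp)
    have d1 := g1.mdifferentiableAt (by simp)
    have d2 := g2.mdifferentiableAt (by simp)
    have a1 := P.pullAt_exp_smul dφ d1
    have a2 := P'.pullAt_exp_smul dφ d2
    have b1 : MDifferentiableAt (totalModel n) (totalModel n)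
        (fun z => Circle.exp (φ z) • (s ∘ P.proj) z) y :=
      MDifferentiableAt.comp (f := fun z => (φ z, (s ∘ P.proj) z)) y
        (P.contMDiff_exp_smul.mdifferentiable (by simp) _) (dφ.prodMk d1)
    have b2 : MDifferentiableAt (totalModel n) (totalModel n)
        (fun z => Circle.exp (φ z) • (s'' ∘ P.proj) z) y :=
      MDifferentiableAt.comp (f := fun z => (φ z, (s'' ∘ P.proj) z)) y
        (P'.contMDiff_exp_smul.mdifferentiable (by simp) _) (dφ.prodMk d2)
    rw [← P.pullAt_const_smul b1 (k y)] at a1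
    rw [← P'.pullAt_const_smul b2 (k y), hg, ← a1] at a2
    have c1 : (fun z => k y • Circle.exp (φ z) • (s ∘ P.proj) z) =ᶠ[𝓝 y] id := by
      filter_upwards [(hU.preimage P.proj_smooth.continuous).mem_nhds (hWU hyW).1] with z hz
      rw [smul_smul, ← hkφ]
      exact (hy z hz).1.symm
    have c2 : (fun z => k y • Circle.exp (φ z) • (s'' ∘ P.proj) z) =
        fun z => k z • s'' (P.proj z) := by
      funext z
      rw [smul_smul, ← hkφ]
      rfl
    rw [DForm.pullAt_congr _ c1, DForm.pullAt_id, c2] at a2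
    exact ⟨P'.smul_smooth.contMDiffAt.comp y (kU.prodMk g2), a2⟩

end Local

end Prequantisation

/-! ### Manifolds and forms glued from pieces of a given manifold. -/

section ChartedOver
variable {F H M N : Type*}
  [NormedAddCommGroup F] [NormedSpace ℝ F] [TopologicalSpace H]
  [TopologicalSpace M] [ChartedSpace H M] [TopologicalSpace N] [ChartedSpace M N]
  {I : ModelWithCorners ℝ F H} {k : ℕ}

variable (I M N) in
/-- A space with charts in a manifold whose transition functions are smooth. -/
def SmoothTransitions : Prop :=
  ∀ e ∈ atlas M N, ∀ e' ∈ atlas M N, ContMDiffOn I I ∞ (e.symm.trans e') (e.symm.trans e').source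

variable [IsManifold I ∞ M]

theorem SmoothTransitions.isManifold (hc : SmoothTransitions M N I) :
    @IsManifold ℝ _ F _ _ H _ I ∞ N _ (ChartedSpace.comp H M N) := by
  let _ := ChartedSpace.comp H M N
  refine isManifold_of_contDiffOn I ∞ N ?_
  rintro _ _ ⟨e, he, c, hc1, rfl⟩ ⟨e', he', c', hc1', rfl⟩
  set f := (e.trans c).symm.trans (e'.trans c') with hf
  have hs : ∀ v ∈ f.source, v ∈ c.target ∧ c.symm v ∈ (e.symm.trans e').source ∧
      (e.symm.trans e') (c.symm v) ∈ c'.source := by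
    intro v hv
    simp only [hf, OpenPartialHomeomorph.trans_source, OpenPartialHomeomorph.symm_source,
      OpenPartialHomeomorph.trans_symm_eq_symm_trans_symm, mem_inter_iff, mem_preimage,
      OpenPartialHomeomorph.coe_trans, Function.comp_apply] at hv ⊢
    exact ⟨hv.1.1, ⟨hv.1.2, hv.2.1⟩, hv.2.2⟩
  have h1 : ContMDiffOn I I ∞ f f.source := by
    have g1 : ContMDiffOn I I ∞ c.symm f.source :=
      (contMDiffOn_symm_of_mem_maximalAtlas
        (IsManifold.subset_maximalAtlas hc1)).mono fun v hv => (hs v hv).1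
    have g2 : ContMDiffOn I I ∞ ((e.symm.trans e') ∘ c.symm) f.source :=
      (hc e he e' he').comp g1 fun v hv => (hs v hv).2.1
    exact (contMDiffOn_of_mem_maximalAtlas
        (IsManifold.subset_maximalAtlas hc1')).comp g2 fun v hv => (hs v hv).2.2
  have h2 := (contMDiffOn_iff.1 h1).2
  intro v hv
  have h3 := h2 (I.symm v) (I.symm v)
  simp only [chartAt_self_eq, mfld_simps] at h3
  exact (h3 v ⟨hv.2, hv.1⟩).mono fun w hw => ⟨hw.2, hw.1⟩

theorem SmoothTransitions.contMDiffOn (hc : SmoothTransitions M N I)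
    {e : OpenPartialHomeomorph N M} (he : e ∈ atlas M N) :
    letI := ChartedSpace.comp H M N
    ContMDiffOn I I ∞ e e.source := by
  let _ := ChartedSpace.comp H M N
  have := hc.isManifold
  intro p hp
  refine ContMDiffAt.contMDiffWithinAt ?_
  set f := chartAt M p
  set c := chartAt H (f p)
  have hpf : p ∈ f.source := mem_chart_source M p
  have h1 : ContMDiffAt I I ∞ (c.symm ∘ chartAt H p) p := by
    refine ContMDiffAt.comp p ?_ (contMDiffOn_chart.contMDiffAt
      ((chartAt H p).open_source.mem_nhds (mem_chart_source H p)))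
    refine contMDiffOn_chart_symm.contMDiffAt (c.open_target.mem_nhds ?_)
    exact c.map_source (mem_chart_source H _)
  have h2 : ContMDiffAt I I ∞ f p := by
    refine h1.congr_of_eventuallyEq ?_
    filter_upwards [f.continuousAt hpf |>.eventually (c.open_source.mem_nhds
      (mem_chart_source H _))] with q hq
    exact (c.left_inv hq).symm
  have h3 : ContMDiffAt I I ∞ (f.symm.trans e) (f p) :=
    (hc f (chart_mem_atlas M p) e he).contMDiffAt ((f.symm.trans e).open_source.mem_nhds
      ⟨f.map_source hpf, by
        change f.symm (f p) ∈ e.source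
        rwa [f.left_inv hpf]⟩)
  refine (h3.comp p h2).congr_of_eventuallyEq ?_
  filter_upwards [f.open_source.mem_nhds hpf] with q hq
  change e q = e (f.symm (f q))
  rw [f.left_inv hq]

theorem SmoothTransitions.contMDiffOn_symm (hc : SmoothTransitions M N I)
    {e : OpenPartialHomeomorph N M}
    (he : e ∈ atlas M N) :
    letI := ChartedSpace.comp H M N
    ContMDiffOn I I ∞ e.symm e.target := by
  let _ := ChartedSpace.comp H M N
  have := hc.isManifold
  intro q hq
  refine ContMDiffAt.contMDiffWithinAt ?_
  set p := e.symm q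
  have hp : p ∈ e.source := e.map_target hq
  set f := chartAt M p
  set c := chartAt H (f p)
  have hpf : p ∈ f.source := mem_chart_source M p
  have hfc : f p ∈ c.source := mem_chart_source H _
  have h1 : ContMDiffAt I I ∞ ((chartAt H p).symm ∘ c) (f p) := by
    refine ContMDiffAt.comp (f p) ?_ (contMDiffOn_chart.contMDiffAt (c.open_source.mem_nhds hfc))
    refine contMDiffOn_chart_symm.contMDiffAt ((chartAt H p).open_target.mem_nhds ?_)
    exact (chartAt H p).map_source (mem_chart_source H p)
  have h2 : ContMDiffAt I I ∞ f.symm (f p) := by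
    refine h1.congr_of_eventuallyEq ?_
    filter_upwards [c.open_source.mem_nhds hfc] with q hq
    change f.symm q = f.symm (c.symm (c q))
    rw [c.left_inv hq]
  have h3 : ContMDiffAt I I ∞ (e.symm.trans f) q :=
    (hc e he f (chart_mem_atlas M p)).contMDiffAt ((e.symm.trans f).open_source.mem_nhds
      ⟨hq, hpf⟩)
  have h4 : ContMDiffAt I I ∞ (f.symm ∘ (e.symm.trans f)) q := ContMDiffAt.comp q h2 h3
  refine h4.congr_of_eventuallyEq ?_
  filter_upwards [(e.symm.trans f).open_source.mem_nhds ⟨hq, hpf⟩] with r hr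
  exact (f.left_inv hr.2).symm

variable [I.Boundaryless] {α : DForm I M k}

/-- The preferred chart of the composite structure at `p` is `chartAt M p` followed by a preferred
chart of `M`. A form that every chart into `M` pulls back from the same `α` thus has the coordinate
expressions of `α`, and inherits smoothness and exterior derivative from it. -/
theorem SmoothTransitions.inChart_eq (hc : SmoothTransitions M N I) :
    letI := ChartedSpace.comp H M N
    ∀ {β : DForm I N k} (_ : ∀ e ∈ atlas M N, ∀ p ∈ e.source, β p = DForm.pull (I := I) e α p)
      (p : N), ∀ v ∈ (extChartAt I p).target, β.inChart p v = α.inChart (chartAt M p p) v := by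
  let _ := ChartedSpace.comp H M N
  intro β hβ p v hv
  have := hc.isManifold
  set f := chartAt M p with hf
  set c := chartAt H (f p) with hcdef
  have hcomp : chartAt H p = f.trans c := rfl
  have ht : ∀ w ∈ (extChartAt I p).target, (extChartAt I p).symm w ∈ f.source ∧
      f ((extChartAt I p).symm w) = (extChartAt I (f p)).symm w := by
    intro w hw
    rw [extChartAt_target, hcomp, OpenPartialHomeomorph.trans_target] at hw
    obtain ⟨⟨h1, h2⟩, h3⟩ := hw
    exact ⟨f.map_target h2, f.right_inv h2⟩
  have hd : tder 𝓘(ℝ, F) I (extChartAt I (f p)).symm v =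
      (tder I I f ((extChartAt I p).symm v)).comp (tder 𝓘(ℝ, F) I (extChartAt I p).symm v) := by
    rw [← tder_comp (((hc.contMDiffOn (chart_mem_atlas M p)).contMDiffAt
      (f.open_source.mem_nhds (ht v hv).1)).mdifferentiableAt (by simp))
      (((contMDiffOn_extChartAt_symm (n := ∞) p).contMDiffAt
        ((isOpen_extChartAt_target p).mem_nhds hv)).mdifferentiableAt (by simp))]
    apply tder_congr
    filter_upwards [(isOpen_extChartAt_target (I := I) p).mem_nhds hv] with w hw
    exact (ht w hw).2.symm
  let α' : M → F [⋀^Fin k]→L[ℝ] ℝ := fun y => α y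
  have h1 : α.inChart (f p) v = (α' ((extChartAt I (f p)).symm v)).compContinuousLinearMap
    (tder 𝓘(ℝ, F) I (extChartAt I (f p)).symm v) := rfl
  rw [h1, hd, ← (ht v hv).2]
  unfold DForm.inChart
  rw [hβ f (chart_mem_atlas M p) _ (ht v hv).1]
  rfl

theorem SmoothTransitions.smooth (hc : SmoothTransitions M N I) (hα : α.Smooth) :
    letI := ChartedSpace.comp H M N
    ∀ {β : DForm I N k} (_ : ∀ e ∈ atlas M N, ∀ p ∈ e.source, β p = DForm.pull (I := I) e α p),
      β.Smooth := by
  let _ := ChartedSpace.comp H M N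
  intro β hβ p
  refine ((hα (chartAt M p p)).mono ?_).congr (hc.inChart_eq hβ p)
  intro v hv
  rw [extChartAt_target] at hv ⊢
  exact ⟨hv.1.1, hv.2⟩

theorem SmoothTransitions.d_eq (hc : SmoothTransitions M N I) :
    letI := ChartedSpace.comp H M N
    ∀ {β : DForm I N k} (_ : ∀ e ∈ atlas M N, ∀ p ∈ e.source, β p = DForm.pull (I := I) e α p)
      (p : N), β.d p = DForm.pull (I := I) (chartAt M p) α.d p := by
  let _ := ChartedSpace.comp H M N
  intro β hβ p
  have := hc.isManifold
  set f := chartAt M p with hf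
  have hd : extDeriv (β.inChart p) (extChartAt I p p) =
      extDeriv (α.inChart (f p)) (extChartAt I (f p) (f p)) := by
    apply Filter.EventuallyEq.extDeriv_eq
    filter_upwards [(isOpen_extChartAt_target (I := I) p).mem_nhds (mem_extChartAt_target p)]
      with w hw
    exact hc.inChart_eq hβ p w hw
  have hm : tder I 𝓘(ℝ, F) (extChartAt I p) p =
      (tder I 𝓘(ℝ, F) (extChartAt I (f p)) (f p)).comp (tder I I f p) := by
    rw [← tder_comp (mdifferentiableAt_extChartAt (mem_chart_source H (f p)))
      (((hc.contMDiffOn (chart_mem_atlas M p)).contMDiffAt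
      (f.open_source.mem_nhds (mem_chart_source M p))).mdifferentiableAt (by simp))]
    rfl
  change (extDeriv (β.inChart p) (extChartAt I p p)).compContinuousLinearMap
    (tder I 𝓘(ℝ, F) (extChartAt I p) p) = _
  rw [hd, hm]
  rfl

end ChartedOver

/-! ### The twist of a prequantisation by a flat cocycle. -/

namespace Prequantisation

section Twist
variable {n : ℕ} {E : Type u} [TopologicalSpace E] [ChartedSpace (EuclideanSpace ℝ (Fin n)) E]
  {ħ : ℝ} {σ : DForm (𝓡 n) E 2} (P : Prequantisation ħ σ) (D : FlatCocycle E)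

/-- A locally constant gauge transformation. -/
theorem morphAt_smul_of_eventually_eq {u : E → Circle} {y : P.Y}
    (hu : ∀ᶠ x in 𝓝 (P.proj y), u x = u (P.proj y)) :
    MorphAt P P (fun z => u (P.proj z) • z) y := by
  refine ((MorphAt.id y).const_smul (u (P.proj y))).congr ?_
  filter_upwards [P.proj_smooth.continuous.continuousAt.eventually hu] with z hz
  rw [hz]
  rfl

/-- The total space of the twist of a prequantisation by a flat cocycle. As a set with an action
of the circle, it is the same as the original total space. -/
structure Twist (P : Prequantisation ħ σ) (D : FlatCocycle E) : Type u where
  val : P.Y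

namespace Twist

variable {P D} in
@[ext]
theorem ext {y y' : Twist P D} (h : y.val = y'.val) : y = y' := by
  cases y; cases y'; exact congrArg mk h

instance : MulAction Circle (Twist P D) where
  smul z y := ⟨z • y.val⟩
  one_smul _ := Twist.ext (one_smul _ _)
  mul_smul _ _ _ := Twist.ext (mul_smul _ _ _)

theorem smul_val (z : Circle) (y : Twist P D) : (z • y).val = z • y.val := rfl

/-- The chart of the twisted total space with values in the original total space, as a bare map. -/
def partialChart (x : E) : PartialEquiv (Twist P D) P.Y where
  toFun y := D.c x (P.proj y.val) • y.val
  invFun y := ⟨(D.c x (P.proj y))⁻¹ • y⟩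
  source := {y | P.proj y.val ∈ D.U x}
  target := P.proj ⁻¹' D.U x
  map_source' _ hy := by
    rw [mem_preimage, P.proj_smul]
    exact hy
  map_target' y hy := by
    change P.proj ((D.c x (P.proj y))⁻¹ • y) ∈ D.U x
    rw [P.proj_smul]
    exact hy
  left_inv' y hy := Twist.ext (by rw [P.proj_smul, inv_smul_smul])
  right_inv' y hy := by simp only [P.proj_smul, smul_inv_smul]

/-- The transition map rotates the fibre over `z` by `D.c x' z / D.c x z`, which is locally
constant; so it is smooth and preserves the connection, although neither factor need be continuous.
This is why smooth structure and connection form both glue. -/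
theorem partialChart_trans_morphAt {x x' : E} {y : P.Y} (hx : P.proj y ∈ D.U x)
    (hx' : P.proj y ∈ D.U x') :
    MorphAt P P ((partialChart P D x).symm.trans (partialChart P D x')) y := by
  have h1 := P.morphAt_smul_of_eventually_eq (u := fun z => D.c x' z / D.c x z)
    (D.locconst x' x _ hx' hx)
  have h2 : ((partialChart P D x).symm.trans (partialChart P D x') : P.Y → P.Y) =
      fun z => (D.c x' (P.proj z) / D.c x (P.proj z)) • z := by
    funext z
    change D.c x' (P.proj ((D.c x (P.proj z))⁻¹ • z)) • (D.c x (P.proj z))⁻¹ • z = _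
    rw [P.proj_smul, smul_smul, div_eq_mul_inv]
  rw [h2]
  exact h1

theorem partialChart_trans_source (x x' : E) :
    ((partialChart P D x).symm.trans (partialChart P D x')).source =
      P.proj ⁻¹' (D.U x ∩ D.U x') := by
  ext y
  change P.proj y ∈ D.U x ∧ P.proj ((D.c x (P.proj y))⁻¹ • y) ∈ D.U x' ↔ _
  rw [P.proj_smul]
  rfl

/-- The atlas of the twisted total space. -/
def atlasCore : ChartedSpaceCore P.Y (Twist P D) where
  atlas := range (partialChart P D)
  chartAt y := partialChart P D (P.proj y.val)
  mem_chart_source y := D.mem_U _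
  chart_mem_atlas y := mem_range_self _
  open_source := by
    rintro _ _ ⟨x, rfl⟩ ⟨x', rfl⟩
    rw [partialChart_trans_source]
    exact ((D.isOpen_U x).inter (D.isOpen_U x')).preimage P.proj_smooth.continuous
  continuousOn_toFun := by
    rintro _ _ ⟨x, rfl⟩ ⟨x', rfl⟩ y hy
    rw [partialChart_trans_source] at hy
    exact (partialChart_trans_morphAt P D hy.1 hy.2).smooth.continuousAt.continuousWithinAt

instance : TopologicalSpace (Twist P D) := (atlasCore P D).toTopologicalSpace

instance : ChartedSpace P.Y (Twist P D) := (atlasCore P D).toChartedSpace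

instance : ChartedSpace (ModelProd (EuclideanSpace ℝ (Fin n)) (EuclideanSpace ℝ (Fin 1)))
    (Twist P D) := ChartedSpace.comp _ P.Y _

/-- The local isomorphisms of the twisted total space with the original one. -/
def chart (x : E) : OpenPartialHomeomorph (Twist P D) P.Y :=
  (atlasCore P D).openPartialHomeomorph (partialChart P D x) (mem_range_self x)

theorem chart_mem_atlas (x : E) : chart P D x ∈ atlas P.Y (Twist P D) :=
  mem_iUnion.2 ⟨_, mem_iUnion.2 ⟨mem_range_self x, rfl⟩⟩

theorem eq_chart_of_mem_atlas {e : OpenPartialHomeomorph (Twist P D) P.Y}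
    (he : e ∈ atlas P.Y (Twist P D)) : ∃ x, e = chart P D x := by
  obtain ⟨f, hf⟩ := mem_iUnion.1 he
  obtain ⟨⟨x, rfl⟩, h⟩ := mem_iUnion.1 hf
  exact ⟨x, h⟩

theorem chartAt_eq (y : Twist P D) : chartAt P.Y y = chart P D (P.proj y.val) := rfl

theorem chart_apply (x : E) (y : Twist P D) :
    chart P D x y = D.c x (P.proj y.val) • y.val := rfl

theorem chart_symm_apply (x : E) (y : P.Y) :
    ((chart P D x).symm y).val = (D.c x (P.proj y))⁻¹ • y := rfl

theorem mem_chart_target {x : E} {y : P.Y} :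
    y ∈ (chart P D x).target ↔ P.proj y ∈ D.U x := Iff.rfl

theorem proj_chart (x : E) (y : Twist P D) : P.proj (chart P D x y) = P.proj y.val := by
  rw [chart_apply, P.proj_smul]

theorem chart_smul (x : E) (z : Circle) (y : Twist P D) :
    chart P D x (z • y) = z • chart P D x y := by
  rw [chart_apply, chart_apply, smul_val, P.proj_smul, smul_smul, smul_smul, mul_comm]

theorem smoothTransitions : SmoothTransitions P.Y (Twist P D) (totalModel n) := by
  intro e he e' he' y hy
  obtain ⟨x, rfl⟩ := eq_chart_of_mem_atlas P D he
  obtain ⟨x', rfl⟩ := eq_chart_of_mem_atlas P D he'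
  have hy' : y ∈ ((partialChart P D x).symm.trans (partialChart P D x')).source := hy
  rw [partialChart_trans_source] at hy'
  exact (partialChart_trans_morphAt P D hy'.1 hy'.2).smooth.contMDiffWithinAt

instance : IsManifold (totalModel n) ∞ (Twist P D) := (smoothTransitions P D).isManifold

variable {P D}

theorem contMDiffAt_chart {x : E} {y : Twist P D} (hy : P.proj y.val ∈ D.U x) :
    ContMDiffAt (totalModel n) (totalModel n) ∞ (chart P D x) y :=
  ((smoothTransitions P D).contMDiffOn (chart_mem_atlas P D x)).contMDiffAt
    ((chart P D x).open_source.mem_nhds hy)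

theorem contMDiffAt_chart_symm {x : E} {y : P.Y} (hy : P.proj y ∈ D.U x) :
    ContMDiffAt (totalModel n) (totalModel n) ∞ (chart P D x).symm y :=
  ((smoothTransitions P D).contMDiffOn_symm (chart_mem_atlas P D x)).contMDiffAt
    ((chart P D x).open_target.mem_nhds hy)

theorem isLocalDiffeomorphAt_chart_symm {x : E} {y : P.Y} (hy : P.proj y ∈ D.U x) :
    IsLocalDiffeomorphAt (totalModel n) (totalModel n) ∞ (chart P D x).symm y :=
  ⟨{ toPartialEquiv := (chart P D x).symm.toPartialEquiv
     open_source := (chart P D x).open_target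
     open_target := (chart P D x).open_source
     contMDiffOn_toFun := (smoothTransitions P D).contMDiffOn_symm (chart_mem_atlas P D x)
     contMDiffOn_invFun := (smoothTransitions P D).contMDiffOn (chart_mem_atlas P D x) },
   hy, fun _ _ => rfl⟩

theorem contMDiff_proj :
    ContMDiff (totalModel n) (𝓡 n) ∞ (fun y : Twist P D => P.proj y.val) := fun y => by
  refine (P.proj_smooth.contMDiffAt.comp y
    (contMDiffAt_chart (D.mem_U (P.proj y.val)))).congr_of_eventuallyEq ?_
  exact Eventually.of_forall fun y' => (proj_chart P D _ y').symm

theorem contMDiff_smul :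
    ContMDiff ((𝓡 1).prod (totalModel n)) (totalModel n) ∞
      (fun p : Circle × Twist P D => p.1 • p.2) := by
  rintro ⟨z, y⟩
  have hy : P.proj y.val ∈ D.U (P.proj y.val) := D.mem_U _
  set f := chart P D (P.proj y.val) with hf
  have h1 : ContMDiffAt ((𝓡 1).prod (totalModel n)) (totalModel n) ∞
      (fun p : Circle × Twist P D => p.1 • f p.2) (z, y) :=
    P.smul_smooth.contMDiffAt.comp (z, y) (contMDiffAt_fst.prodMk
      ((contMDiffAt_chart hy).comp (z, y) contMDiffAt_snd))
  have h2 : ContMDiffAt (totalModel n) (totalModel n) ∞ f.symm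
      ((fun p : Circle × Twist P D => p.1 • f p.2) (z, y)) :=
    contMDiffAt_chart_symm (by simp only [P.proj_smul, hf, proj_chart]; exact hy)
  refine (h2.comp (z, y) h1).congr_of_eventuallyEq ?_
  have h3 : f.source ∈ 𝓝 y := f.open_source.mem_nhds hy
  filter_upwards [continuous_snd.continuousAt.preimage_mem_nhds h3] with p hp
  simp only [Function.comp_apply]
  rw [hf, ← chart_smul, OpenPartialHomeomorph.left_inv]
  change P.proj (p.1 • p.2.val) ∈ D.U _
  rw [P.proj_smul]
  exact hp

theorem chart_eventuallyEq {x x' : E} {y : Twist P D} (hx : P.proj y.val ∈ D.U x)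
    (hx' : P.proj y.val ∈ D.U x') :
    (chart P D x' : Twist P D → P.Y) =ᶠ[𝓝 y]
      fun y' => (D.c x' (P.proj y.val) / D.c x (P.proj y.val)) • chart P D x y' := by
  filter_upwards [contMDiff_proj.continuous.continuousAt.eventually
    (D.locconst x' x _ hx' hx)] with y' hy'
  rw [← hy', chart_apply, chart_apply, smul_smul, div_mul_cancel]

variable (P D) in
/-- The connection form of the twisted prequantisation. -/
def conn : DForm (totalModel n) (Twist P D) 1 := fun y =>
  DForm.pull (I := totalModel n) (chart P D (P.proj y.val)) P.conn y

/-- `conn` is defined by the chart indexed by the base point of `y`. Any other chart differs from it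
near `y` by a constant rotation, which leaves the connection form unchanged. -/
theorem toCLM_conn {x : E} {y : Twist P D} (hy : P.proj y.val ∈ D.U x) :
    (conn P D).toCLM y = P.conn.pullAt (I := totalModel n) (chart P D x) y := by
  have h1 : (conn P D).toCLM y =
    P.conn.pullAt (I := totalModel n) (chart P D (P.proj y.val)) y := rfl
  rw [h1, P.conn.pullAt_congr (chart_eventuallyEq hy (D.mem_U _)), P.pullAt_const_smul]
  exact (contMDiffAt_chart hy).mdifferentiableAt (by simp)

theorem conn_eq_pull : ∀ e ∈ atlas P.Y (Twist P D), ∀ y ∈ e.source,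
    conn P D y = DForm.pull (I := totalModel n) e P.conn y := by
  intro e he y hy
  obtain ⟨x, rfl⟩ := eq_chart_of_mem_atlas P D he
  exact (ContinuousAlternatingMap.ofSubsingletonLIE (𝕜 := ℝ)
    (E := EuclideanSpace ℝ (Fin n) × EuclideanSpace ℝ (Fin 1)) (F := ℝ)
    (0 : Fin 1)).symm.injective (toCLM_conn hy)

theorem pullAt_conn {F H M : Type*} [NormedAddCommGroup F] [NormedSpace ℝ F] [TopologicalSpace H]
    {I : ModelWithCorners ℝ F H} [TopologicalSpace M] [ChartedSpace H M] {g : M → Twist P D}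
    {m : M} (hg : MDifferentiableAt I (totalModel n) g m) {x : E}
    (hx : P.proj (g m).val ∈ D.U x) :
    (conn P D).pullAt (I := I) g m = P.conn.pullAt (I := I) (chart P D x ∘ g) m := by
  rw [DForm.pullAt_comp _ ((contMDiffAt_chart hx).mdifferentiableAt (by simp)) hg,
    ← toCLM_conn hx]
  rfl

end Twist

/-- The twist of a prequantisation by a flat cocycle. -/
def twist [IsManifold (𝓡 n) ∞ E] : Prequantisation ħ σ where
  Y := Twist P D
  smul_smooth := Twist.contMDiff_smul
  proj y := P.proj y.val
  proj_smooth := Twist.contMDiff_proj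
  proj_smul z y := P.proj_smul z y.val
  locallyTrivial x := by
    obtain ⟨t, ht, h1, h2, h3⟩ := P.locallyTrivial x
    have hsrc : ∀ y : Twist P D, Twist.chart P D x y ∈ t.source ↔ P.proj y.val ∈ t.baseSet :=
      fun y => by rw [t.mem_source, Twist.proj_chart]
    have htgt : ∀ w ∈ t.target, t.toOpenPartialHomeomorph.symm w ∈ (Twist.chart P D x).target ↔
        w.1 ∈ D.U x := fun w hw => by
      rw [Twist.mem_chart_target, t.proj_symm_apply hw]
    -- A trivialisation of the original bundle is composed with the twisted chart at `x`, over the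
    -- part of its base that lies in the patch of `x`.
    refine ⟨{
      toOpenPartialHomeomorph := (Twist.chart P D x).trans t.toOpenPartialHomeomorph
      baseSet := D.U x ∩ t.baseSet
      open_baseSet := (D.isOpen_U x).inter t.open_baseSet
      source_eq := ?_
      target_eq := ?_
      proj_toFun := fun y hy => ?_ }, ⟨D.mem_U x, ht⟩, fun y hy => ?_, fun w hw => ?_,
      fun z y hy => ?_⟩
    · ext y
      rw [OpenPartialHomeomorph.trans_source]
      exact and_congr_right fun _ => hsrc y
    · ext w
      rw [OpenPartialHomeomorph.trans_target]
      constructor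
      · rintro ⟨hw1, hw2⟩
        exact ⟨⟨(htgt w hw1).1 hw2, t.mem_target.1 hw1⟩, mem_univ _⟩
      · rintro ⟨⟨hw1, hw2⟩, -⟩
        exact ⟨t.mem_target.2 hw2, (htgt w (t.mem_target.2 hw2)).2 hw1⟩
    · rw [OpenPartialHomeomorph.trans_source] at hy
      change (t (Twist.chart P D x y)).1 = _
      rw [t.coe_fst hy.2, Twist.proj_chart]
    · change y ∈ ((Twist.chart P D x).trans t.toOpenPartialHomeomorph).source at hy
      rw [OpenPartialHomeomorph.trans_source] at hy
      exact ((h1.contMDiffAt (t.open_source.mem_nhds hy.2)).comp y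
        (Twist.contMDiffAt_chart hy.1)).contMDiffWithinAt
    · change w ∈ ((Twist.chart P D x).trans t.toOpenPartialHomeomorph).target at hw
      rw [OpenPartialHomeomorph.trans_target] at hw
      exact (ContMDiffAt.comp w (Twist.contMDiffAt_chart_symm hw.2)
        (h2.contMDiffAt (t.open_target.mem_nhds hw.1))).contMDiffWithinAt
    · change y ∈ ((Twist.chart P D x).trans t.toOpenPartialHomeomorph).source at hy
      rw [OpenPartialHomeomorph.trans_source] at hy
      change t (Twist.chart P D x (z • y)) = ((t (Twist.chart P D x y)).1,
        z * (t (Twist.chart P D x y)).2)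
      rw [Twist.chart_smul, h3 z _ hy.2]
  conn := Twist.conn P D
  conn_smooth := (Twist.smoothTransitions P D).smooth P.conn_smooth Twist.conn_eq_pull
  conn_invariant z := DForm.ext_toCLM fun y => by
    have hz : MDifferentiableAt (totalModel n) (totalModel n) (fun y : Twist P D => z • y) y :=
      (Twist.contMDiff_smul.comp (contMDiff_const.prodMk contMDiff_id)).mdifferentiable (by simp) y
    have hy : P.proj y.val ∈ D.U (P.proj y.val) := D.mem_U _
    rw [DForm.toCLM_pull, Twist.pullAt_conn hz (x := P.proj y.val)
      (by rw [Twist.smul_val, P.proj_smul]; exact hy), Twist.toCLM_conn hy,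
      ← P.pullAt_const_smul ((Twist.contMDiffAt_chart hy).mdifferentiableAt (by simp)) z]
    refine P.conn.pullAt_congr (Eventually.of_forall fun y' => ?_)
    exact Twist.chart_smul P D _ z y'
  conn_vertical y := by
    have hy : P.proj y.val ∈ D.U (P.proj y.val) := D.mem_U _
    have hv : MDifferentiableAt 𝓘(ℝ, ℝ) (totalModel n) (fun t : ℝ => Circle.exp t • y) 0 :=
      (Twist.contMDiff_smul.comp (contMDiff_circleExp.prodMk contMDiff_const)).mdifferentiable
        (by simp) 0
    have h0 : Circle.exp (0 : ℝ) • y = y := by rw [Circle.exp_zero, one_smul]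
    set f := Twist.chart P D (P.proj y.val)
    have h0' : Circle.exp (0 : ℝ) • f y = f y := by rw [Circle.exp_zero, one_smul]
    have h1 := Twist.pullAt_conn hv (x := P.proj y.val) (by rw [h0]; exact hy)
    have h2 : f ∘ (fun t : ℝ => Circle.exp t • y) = fun t : ℝ => Circle.exp t • f y :=
      funext fun t => Twist.chart_smul P D _ _ _
    rw [h2] at h1
    have h3 := DFunLike.congr_fun h1 (1 : ℝ)
    unfold DForm.pullAt at h3
    beta_reduce at h3
    rw [h0, h0'] at h3
    exact h3.trans (P.conn_vertical (f y))
  curvature := by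
    funext y
    have hy : P.proj y.val ∈ D.U (P.proj y.val) := D.mem_U _
    rw [(Twist.smoothTransitions P D).d_eq Twist.conn_eq_pull y, P.curvature, Twist.chartAt_eq]
    simp only [DForm.pull]
    have h1 : (fun y : Twist P D => P.proj y.val) = P.proj ∘ Twist.chart P D (P.proj y.val) :=
      funext fun y' => (Twist.proj_chart P D _ y').symm
    let σ' : E → EuclideanSpace ℝ (Fin n) [⋀^Fin 2]→L[ℝ] ℝ := fun y => σ y
    have h2 : tder (totalModel n) (𝓡 n) (fun y : Twist P D => P.proj y.val) y =
        (tder (totalModel n) (𝓡 n) P.proj (Twist.chart P D (P.proj y.val) y)).comp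
          (tder (totalModel n) (totalModel n) (Twist.chart P D (P.proj y.val)) y) := by
      rw [h1, tder_comp (P.proj_smooth.mdifferentiable (by simp) _)
        ((Twist.contMDiffAt_chart hy).mdifferentiableAt (by simp))]
    change _ = (σ' (P.proj y.val)).compContinuousLinearMap
      (tder (totalModel n) (𝓡 n) (fun y : Twist P D => P.proj y.val) y)
    have h4 : σ' (P.proj y.val) = σ' (P.proj (Twist.chart P D (P.proj y.val) y)) := by
      rw [Twist.proj_chart]
    rw [h2, h4]
    rfl

end Twist

end Prequantisation

/-! ### Fibres as torsors, and morphisms over the identity. -/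

namespace Prequantisation

section Torsor
variable {n : ℕ} {E : Type u} [TopologicalSpace E] [ChartedSpace (EuclideanSpace ℝ (Fin n)) E]
  {ħ : ℝ} {σ : DForm (𝓡 n) E 2} (P P' : Prequantisation ħ σ)

theorem exists_smul_eq {y y' : P.Y} (h : P.proj y = P.proj y') : ∃ z : Circle, z • y = y' := by
  obtain ⟨U, s, k, -, hx, -, -, -, hk⟩ := P.exists_local_section (P.proj y)
  have h1 := (hk y hx).1
  have h2 := (hk y' (h ▸ hx)).1
  refine ⟨k y' / k y, ?_⟩
  calc (k y' / k y) • y = (k y' / k y) • k y • s (P.proj y) := congrArg _ h1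
    _ = k y' • s (P.proj y') := by rw [smul_smul, div_mul_cancel, h]
    _ = y' := h2.symm

theorem smul_left_injective (y : P.Y) : Function.Injective fun z : Circle => z • y := by
  obtain ⟨U, s, k, -, hx, -, -, -, hk⟩ := P.exists_local_section (P.proj y)
  intro z z' h
  have h1 := congrArg k h
  simp only [(hk y hx).2] at h1
  exact mul_right_cancel h1

theorem proj_surjective : Function.Surjective P.proj := fun x => by
  obtain ⟨U, s, k, -, hx, -, -, hs, -⟩ := P.exists_local_section x
  exact ⟨s x, hs x hx⟩

variable {P P'}

theorem IsMorphismOver.bijective {f : P.Y → P'.Y} (hf : IsMorphismOver P P' id f) :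
    Function.Bijective f := by
  refine ⟨fun y y' h => ?_, fun w => ?_⟩
  · obtain ⟨z, rfl⟩ := P.exists_smul_eq (y := y) (y' := y')
      (by rw [← id_eq (P.proj y), ← hf.covers, h, hf.covers, id_eq])
    rw [hf.equivariant] at h
    have : z = 1 := P'.smul_left_injective (f y) (by simpa using h.symm)
    rw [this, one_smul]
  · obtain ⟨y, hy⟩ := P.proj_surjective (P'.proj w)
    obtain ⟨z, hz⟩ := P'.exists_smul_eq (y := f y) (y' := w) (by rw [hf.covers, hy, id_eq])
    exact ⟨z • y, by rw [hf.equivariant, hz]⟩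

/-- A morphism over the identity is automatically invertible: it is an equivariant map of torsors on
each fibre, and smoothness of the inverse comes from a local section. Later equivalences need only
one direction. -/
theorem IsMorphismOver.equivalent {f : P.Y → P'.Y} (hf : IsMorphismOver P P' id f) :
    Equivalent P P' := by
  let g := Equiv.ofBijective f hf.bijective
  refine ⟨⟨g, hf.smooth, fun w => ?_⟩, hf⟩
  obtain ⟨U, s, k, hU, hx, hs, -, hps, -⟩ := P.exists_local_section (P'.proj w)
  -- The coordinate of `w'` relative to the image of the section `s`. It is smooth by
  -- `contMDiffAt_of_smul`, and the inverse map is this coordinate applied to `s`.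
  have hex : ∀ w', ∃ z : Circle, P'.proj w' ∈ U → z • f (s (P'.proj w')) = w' := fun w' => by
    by_cases hw : P'.proj w' ∈ U
    · obtain ⟨z, hz⟩ := P'.exists_smul_eq (y := f (s (P'.proj w'))) (y' := w')
        (by rw [hf.covers, hps _ hw, id_eq])
      exact ⟨z, fun _ => hz⟩
    · exact ⟨1, fun h => absurd h hw⟩
  choose v hv using hex
  have hU' : ∀ᶠ w' in 𝓝 w, P'.proj w' ∈ U :=
    P'.proj_smooth.continuous.continuousAt.eventually (hU.mem_nhds hx)
  have h1 : ContMDiffAt (totalModel n) (totalModel n) ∞ (fun w' => s (P'.proj w')) w :=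
    (hs.contMDiffAt (hU.mem_nhds hx)).comp w P'.proj_smooth.contMDiffAt
  have h2 : ContMDiffAt (totalModel n) (𝓡 1) ∞ v w := by
    refine P'.contMDiffAt_of_smul (hf.smooth.contMDiffAt.comp w h1) ?_
    refine contMDiffAt_id.congr_of_eventuallyEq ?_
    filter_upwards [hU'] with w' hw'
    exact hv w' hw'
  refine (P.smul_smooth.contMDiffAt.comp w (h2.prodMk h1)).congr_of_eventuallyEq ?_
  filter_upwards [hU'] with w' hw'
  change g.symm w' = v w' • s (P'.proj w')
  rw [Equiv.symm_apply_eq]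
  change w' = f _
  rw [hf.equivariant, hv w' hw']

/-- Both `f` and `g` pull the connection of `P'` back to that of `P`, so rigidity makes `v ∘ P.proj`
locally constant on the total space; a local section brings this down to the base. -/
theorem eventually_eq_of_morphAt [IsManifold (𝓡 n) ∞ E] (hħ : 0 < ħ) {f g : P.Y → P'.Y}
    {V : Set E} (hV : IsOpen V) {v : E → Circle} (hf : ∀ y, P.proj y ∈ V → MorphAt P P' f y)
    (hg : ∀ y, P.proj y ∈ V → MorphAt P P' g y)
    (h : ∀ y, P.proj y ∈ V → g y = v (P.proj y) • f y) {x : E} (hx : x ∈ V) :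
    ∀ᶠ z in 𝓝 x, v z = v x := by
  obtain ⟨U, s, k, hU, hxU, hs, -, hps, -⟩ := P.exists_local_section x
  have := P.manifold
  have hy : P.proj (s x) ∈ V := by rwa [hps x hxU]
  have hV' : ∀ y, P.proj y ∈ V → ∀ᶠ y' in 𝓝 y, P.proj y' ∈ V := fun y hy =>
    P.proj_smooth.continuous.continuousAt.eventually (hV.mem_nhds hy)
  have hfg : ∀ y, P.proj y ∈ V → (fun w => v (P.proj w) • f w) =ᶠ[𝓝 y] g := fun y hy => by
    filter_upwards [hV' y hy] with y' hy'
    exact (h y' hy').symm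
  have h1 : ∀ᶠ y in 𝓝 (s x), v (P.proj y) = v (P.proj (s x)) := by
    refine P'.eventually_eq_of_pullAt_smul_eq (I := totalModel n) hħ (g := f)
      (u := fun y => v (P.proj y)) ?_ ((hg _ hy).congr (hfg _ hy)).smooth ?_
    · filter_upwards [hV' _ hy] with y hy
      exact (hf y hy).smooth
    · filter_upwards [hV' _ hy] with y hy
      rw [((hg _ hy).congr (hfg _ hy)).preserves, (hf y hy).preserves]
  have h2 := (hs.contMDiffAt (hU.mem_nhds hxU)).continuousAt.eventually h1
  filter_upwards [h2, hU.mem_nhds hxU] with z h3 hz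
  rwa [hps z hz, hps x hxU] at h3

/-- The gauge transformation by `u`, read in the charts of two twists. -/
theorem Twist.gauge_eq {D D' : FlatCocycle E} (x : E) (u : E → Circle) (y : Twist P D) :
    (⟨u (P.proj y.val) • y.val⟩ : Twist P D') = (Twist.chart P D' x).symm
      ((u (P.proj y.val) * D'.c x (P.proj y.val) / D.c x (P.proj y.val)) •
        Twist.chart P D x y) := by
  refine Twist.ext ?_
  rw [Twist.chart_symm_apply, P.proj_smul, Twist.proj_chart, Twist.chart_apply, smul_smul,
    smul_smul, mul_assoc, div_mul_cancel, mul_comm, mul_inv_cancel_right]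

end Torsor

/-! ### Prequantisations correspond to flat cocycles up to gauge. -/

section Classification
variable {n : ℕ} {E : Type u} [TopologicalSpace E] [ChartedSpace (EuclideanSpace ℝ (Fin n)) E]
  [IsManifold (𝓡 n) ∞ E] {ħ : ℝ} {σ : DForm (𝓡 n) E 2} {P : Prequantisation ħ σ}
  {D D' : FlatCocycle E}

theorem Twist.morphAt_chart {x : E} {y : Twist P D} (hy : P.proj y.val ∈ D.U x) :
    MorphAt (P.twist D) P (Twist.chart P D x) y :=
  ⟨Twist.contMDiffAt_chart hy, (Twist.toCLM_conn hy).symm⟩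

theorem Twist.morphAt_chart_symm {x : E} {y : P.Y} (hy : P.proj y ∈ D.U x) :
    MorphAt P (P.twist D) (Twist.chart P D x).symm y := by
  refine ⟨Twist.contMDiffAt_chart_symm hy, ?_⟩
  refine (Twist.pullAt_conn ((Twist.contMDiffAt_chart_symm hy).mdifferentiableAt (by simp))
    (x := x) (by rw [Twist.chart_symm_apply, P.proj_smul]; exact hy)).trans ?_
  have h : (Twist.chart P D x ∘ (Twist.chart P D x).symm) =ᶠ[𝓝 y] id := by
    filter_upwards [(Twist.chart P D x).open_target.mem_nhds hy] with w hw
    exact (Twist.chart P D x).right_inv hw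
  rw [P.conn.pullAt_congr h, DForm.pullAt_id]

/-- Rotation by `u` over the common underlying set, read in the charts of index `x`, is rotation by
`u * D'.c x / D.c x`; the gauge condition says that this is locally constant. -/
theorem twist_equivalent_of_isGauge {u : E → Circle} (hu : D.IsGauge D' u) :
    Equivalent (P.twist D) (P.twist D') := by
  let f : Twist P D → Twist P D' := fun y => ⟨u (P.proj y.val) • y.val⟩
  refine IsMorphismOver.equivalent (f := f) (.of_morphAt (fun y => ?_)
    (fun y => P.proj_smul _ y.val) fun z y => ?_)
  · set x := P.proj y.val with hx
    have h0 : P.proj (Twist.chart P D x y) = x := Twist.proj_chart P D x y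
    have h1 : MorphAt (P.twist D) P (Twist.chart P D x) y := Twist.morphAt_chart (D.mem_U x)
    have h2 := P.morphAt_smul_of_eventually_eq (y := Twist.chart P D x y)
      (u := fun z => u z * D'.c x z / D.c x z) (by rw [h0]; exact hu x)
    have h3 : MorphAt P (P.twist D') (Twist.chart P D' x).symm
        ((u (P.proj (Twist.chart P D x y)) * D'.c x (P.proj (Twist.chart P D x y)) /
          D.c x (P.proj (Twist.chart P D x y))) • Twist.chart P D x y) :=
      Twist.morphAt_chart_symm (by rw [P.proj_smul, h0]; exact D'.mem_U x)
    refine (MorphAt.comp (P' := P) (f := (fun z => (u (P.proj z) * D'.c x (P.proj z) /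
      D.c x (P.proj z)) • z) ∘ Twist.chart P D x) h3 (h2.comp h1)).congr
      (Eventually.of_forall fun y' => ?_)
    exact (Twist.gauge_eq x u y').trans (congrArg (fun w => (Twist.chart P D' x).symm
      ((u w * D'.c x w / D.c x w) • Twist.chart P D x y')) (Twist.proj_chart P D x y').symm)
  · refine Twist.ext ?_
    change u (P.proj (z • y.val)) • z • y.val = z • u (P.proj y.val) • y.val
    rw [P.proj_smul, smul_comm]

theorem exists_isGauge_of_equivalent (hħ : 0 < ħ) (h : Equivalent (P.twist D) (P.twist D')) :
    ∃ u, D.IsGauge D' u := by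
  obtain ⟨F, hF⟩ := h
  let f : Twist P D → Twist P D' := F
  -- Both twists have the fibres of `P` as underlying torsors, so an equivariant map over the
  -- identity is a rotation of each fibre.
  have hex : ∀ x, ∃ z : Circle, ∀ y : Twist P D, P.proj y.val = x → f y = ⟨z • y.val⟩ := by
    intro x
    obtain ⟨y, hy⟩ := P.proj_surjective x
    obtain ⟨z, hz⟩ := P.exists_smul_eq (y := y) (y' := (f ⟨y⟩).val) (hF.covers ⟨y⟩).symm
    refine ⟨z, fun y' hy' => ?_⟩
    obtain ⟨z', hz'⟩ := P.exists_smul_eq (hy.trans hy'.symm)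
    have h1 : y' = z' • (⟨y⟩ : Twist P D) := Twist.ext hz'.symm
    refine Twist.ext ?_
    have h2 : f (z' • (⟨y⟩ : Twist P D)) = z' • f ⟨y⟩ := hF.equivariant z' ⟨y⟩
    rw [h1, h2, Twist.smul_val, ← hz, Twist.smul_val, smul_comm]
  choose u hu using hex
  refine ⟨u, fun x => ?_⟩
  refine eventually_eq_of_morphAt (P := P) (P' := P) hħ (f := id)
    (g := Twist.chart P D' x ∘ f ∘ (Twist.chart P D x).symm)
    ((D.isOpen_U x).inter (D'.isOpen_U x)) (v := fun z => u z * D'.c x z / D.c x z)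
    (fun y _ => MorphAt.id y) (fun y hy => ?_) (fun y hy => ?_) ⟨D.mem_U x, D'.mem_U x⟩
  · refine MorphAt.comp (P' := P.twist D') ?_
      (MorphAt.comp (P' := P.twist D) (hF.morphAt _) (Twist.morphAt_chart_symm hy.1))
    refine Twist.morphAt_chart ?_
    refine (congrArg (· ∈ D'.U x) (hF.covers ((Twist.chart P D x).symm y))).mpr ?_
    change P.proj ((Twist.chart P D x).symm y).val ∈ _
    rw [Twist.chart_symm_apply, P.proj_smul]
    exact hy.2
  · have h1 : P.proj ((Twist.chart P D x).symm y).val = P.proj y := by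
      rw [Twist.chart_symm_apply, P.proj_smul]
    simp only [Function.comp_apply, hu (P.proj y) _ h1, id_eq]
    rw [Twist.chart_apply, Twist.chart_symm_apply, P.proj_smul, P.proj_smul, smul_smul, smul_smul,
      div_eq_mul_inv, mul_comm (u _)]

theorem exists_twist_equivalent (P P' : Prequantisation ħ σ) (hħ : 0 < ħ) :
    ∃ D, Equivalent (P.twist D) P' := by
  choose U ψ hU hx h using P.exists_local_isomorphism P' hħ
  -- Over the point `z` the local isomorphism `ψ x` is compared with `ψ z`, the one attached to `z`
  -- itself. Such a comparison holds only on that fibre, so `k x` need not be continuous in `z`;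
  -- outside `U x` its value is arbitrary.
  have hex : ∀ x z, ∃ k : Circle, z ∈ U x → ∀ y, P.proj y = z → ψ x y = k • ψ z y := by
    intro x z
    by_cases hz : z ∈ U x
    · obtain ⟨y, rfl⟩ := P.proj_surjective z
      obtain ⟨k, hk⟩ := P'.exists_smul_eq (y := ψ (P.proj y) y) (y' := ψ x y)
        (by rw [(h _ y (hx _)).1, (h x y hz).1])
      refine ⟨k, fun _ y' hy' => ?_⟩
      obtain ⟨z', rfl⟩ := P.exists_smul_eq hy'.symm
      rw [(h x y hz).2.1, (h _ y (hx _)).2.1, ← hk, smul_comm]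
    · exact ⟨1, fun h => absurd h hz⟩
  choose k hk using hex
  let D : FlatCocycle E := {
    U := U
    isOpen_U := hU
    mem_U := hx
    c := fun x z => (k x z)⁻¹
    locconst := fun x x' y hy hy' => by
      refine eventually_eq_of_morphAt (P := P) (P' := P') hħ ((hU x).inter (hU x')) (f := ψ x)
        (g := ψ x') (v := fun z => (k x z)⁻¹ / (k x' z)⁻¹) (fun w hw => (h x w hw.1).2.2)
        (fun w hw => (h x' w hw.2).2.2) (fun w hw => ?_) ⟨hy, hy'⟩
      rw [hk x' _ hw.2 w rfl, hk x _ hw.1 w rfl, smul_smul]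
      congr 1
      rw [div_inv_eq_mul, mul_comm, mul_inv_cancel_left] }
  -- A different local isomorphism is used on each fibre. In the chart of index `x` the jumps are
  -- corrected by `(k x z)⁻¹` and the map becomes `ψ x`.
  let f : Twist P D → P'.Y := fun y => ψ (P.proj y.val) y.val
  refine ⟨D, IsMorphismOver.equivalent (f := f) (.of_morphAt (fun y => ?_)
    (fun y => (h _ y.val (hx _)).1) fun z y => ?_)⟩
  · set x := P.proj y.val with hxy
    have h1 : MorphAt (P.twist D) P (Twist.chart P D x) y := Twist.morphAt_chart (hx x)
    have h2 : MorphAt P P' (ψ x) (Twist.chart P D x y) :=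
      (h x _ ((Twist.proj_chart P D x y).symm ▸ hx x)).2.2
    refine (h2.comp h1).congr ?_
    have h4 : ∀ᶠ y' : Twist P D in 𝓝 y, P.proj y'.val ∈ U x :=
      Twist.contMDiff_proj.continuous.continuousAt.eventually ((hU x).mem_nhds (hx x))
    refine h4.mono fun y' hy' => ?_
    change ψ (P.proj y'.val) y'.val = ψ x ((k x (P.proj y'.val))⁻¹ • y'.val)
    rw [(h x _ hy').2.1, hk x _ hy' _ rfl, inv_smul_smul]
  · change ψ (P.proj (z • y.val)) (z • y.val) = z • ψ (P.proj y.val) y.val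
    rw [P.proj_smul, (h _ _ (hx _)).2.1]

end Classification

end Prequantisation

/-! ### Covering transformations and the fundamental group. -/

section Deck
variable {X X' : Type*} [TopologicalSpace X] [TopologicalSpace X'] {q : X' → X}

theorem IsCoveringMap.surjective [PathConnectedSpace X] [Nonempty X'] (hq : IsCoveringMap q) :
    Function.Surjective q := fun x => by
  obtain ⟨x₀⟩ := ‹Nonempty X'›
  let γ := PathConnectedSpace.somePath (q x₀) x
  have h : γ 0 = q x₀ := γ.source
  refine ⟨hq.liftPath γ x₀ h 1, ?_⟩
  exact (congrFun (hq.liftPath_lifts γ x₀ h) 1).trans γ.target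

variable [SimplyConnectedSpace X']

theorem deckClass_eq (hq : Continuous q) {e : X} {x₀ : X'} (hx₀ : q x₀ = e) (τ : deckGroup q)
    (γ : Path x₀ (τ.1 x₀)) : deckClass hq hx₀ τ = FundamentalGroup.fromPath
      (Path.Homotopic.Quotient.mk ((γ.map hq).cast hx₀.symm (hx₀.symm.trans (τ.2 x₀).symm))) := by
  unfold deckClass
  rw [Path.Homotopic.Quotient.mk_cast, Path.Homotopic.Quotient.mk_cast]
  congr 2
  exact Path.Homotopic.Quotient.eq.2
    ((SimplyConnectedSpace.paths_homotopic _ γ).map ⟨q, hq⟩)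

/-- A path to `τ x₀` followed by the `τ`-translate of a path to `τ' x₀` ends at `τ τ' x₀` and
projects to the concatenated loop. `FundamentalGroup` multiplies in the opposite order, whence the
reversal. -/
theorem deckClass_mul (hq : Continuous q) {e : X} {x₀ : X'} (hx₀ : q x₀ = e) (τ τ' : deckGroup q) :
    deckClass hq hx₀ (τ * τ') = deckClass hq hx₀ τ' * deckClass hq hx₀ τ := by
  subst hx₀
  let γ := PathConnectedSpace.somePath x₀ (τ.1 x₀)
  let γ' := PathConnectedSpace.somePath x₀ (τ'.1 x₀)
  rw [deckClass_eq hq rfl τ γ, deckClass_eq hq rfl τ' γ',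
    deckClass_eq hq rfl (τ * τ') (γ.trans (γ'.map τ.1.continuous))]
  refine congrArg (fun c => FundamentalGroup.fromPath (Path.Homotopic.Quotient.mk c)) ?_
  ext t
  change q ((γ.trans (γ'.map τ.1.continuous) : Path x₀ (τ.1 (τ'.1 x₀))) t) = _
  simp only [Path.cast_coe, Path.trans_apply]
  split_ifs
  · rfl
  · exact τ.2 _

/-- Since `q ∘ τ = q`, the function `h ∘ τ` is again parallel along `q`, so its ratio to `h` is
constant; at `x₀` that ratio is the transport along the loop that represents `τ`. -/
theorem FlatCocycle.FlatAlong.deck_apply {D : FlatCocycle X} {h : X' → Circle}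
    (hh : D.FlatAlong q h) (hq : Continuous q) {e : X} {x₀ : X'} (hx₀ : q x₀ = e)
    (τ : deckGroup q) (x : X') : h (τ.1 x) = D.holonomy e (deckClass hq hx₀ τ) * h x := by
  have h1 : D.FlatAlong q (h ∘ τ.1) := by
    have := hh.comp τ.1.continuous
    rwa [show q ∘ τ.1 = q from funext τ.2] at this
  have h2 : h (τ.1 x) / h x = h (τ.1 x₀) / h x₀ := h1.div_eq hh x x₀
  have h3 : D.holonomy e (deckClass hq hx₀ τ) = h (τ.1 x₀) / h x₀ := by
    unfold deckClass
    rw [holonomy_fromPath, transport_cast, hh.transport_map]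
  rw [h3, ← h2, div_mul_cancel]

variable [LocallyPathConnectedSpace X']

/-- Lift `q` through itself, once with `x ↦ x'` and once with `x' ↦ x`; the two lifts are mutually
inverse because lifts that agree at a point are equal. -/
theorem exists_deck_apply_eq (hq : IsCoveringMap q) {x x' : X'} (h : q x' = q x) :
    ∃ τ : deckGroup q, τ.1 x = x' := by
  obtain ⟨f, ⟨hf, hqf⟩, -⟩ := hq.existsUnique_continuousMap_lifts ⟨q, hq.continuous⟩ x x' h
  obtain ⟨g, ⟨hg, hqg⟩, -⟩ := hq.existsUnique_continuousMap_lifts ⟨q, hq.continuous⟩ x' x h.symm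
  have hqf' : ∀ y, q (f y) = q y := congrFun hqf
  have hqg' : ∀ y, q (g y) = q y := congrFun hqg
  have h1 : f ∘ g = id := hq.eq_of_comp_eq (f.continuous.comp g.continuous) continuous_id
    (funext fun y => by simp only [Function.comp_apply, hqf', hqg', id_eq]) x'
    (by simp only [Function.comp_apply, hg, hf, id_eq])
  have h2 : g ∘ f = id := hq.eq_of_comp_eq (g.continuous.comp f.continuous) continuous_id
    (funext fun y => by simp only [Function.comp_apply, hqf', hqg', id_eq]) x
    (by simp only [Function.comp_apply, hg, hf, id_eq])
  exact ⟨⟨⟨⟨f, g, congrFun h2, congrFun h1⟩, f.continuous, g.continuous⟩, hqf'⟩, hf⟩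

theorem deckClass_bijective (hq : IsCoveringMap q) {e : X} {x₀ : X'} (hx₀ : q x₀ = e) :
    Function.Bijective (deckClass hq.continuous hx₀) := by
  subst hx₀
  constructor
  · intro τ τ' h
    -- The point `τ x₀` is recovered as the endpoint of the lifted loop, which depends only on the
    -- homotopy class; and `τ x₀` determines `τ`.
    have h1 : ∀ (τ : deckGroup q) (γ : Path x₀ (τ.1 x₀)),
        τ.1 x₀ = hq.liftPath ((γ.map hq.continuous).cast rfl (τ.2 x₀).symm)
          x₀ (Path.source _) 1 := by
      intro τ γ
      have h2 : (γ : C(unitInterval, X')) = hq.liftPath ((γ.map hq.continuous).cast rfl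
          (τ.2 x₀).symm) x₀ (Path.source _) := by
        rw [hq.eq_liftPath_iff']
        exact ⟨rfl, γ.source⟩
      rw [← h2]
      exact γ.target.symm
    have h3 : τ.1 x₀ = τ'.1 x₀ := by
      rw [h1 τ (PathConnectedSpace.somePath _ _), h1 τ' (PathConnectedSpace.somePath _ _)]
      exact hq.liftPath_apply_one_eq_of_homotopicRel (Path.Homotopic.Quotient.eq.1 h) _ _ _
    refine Subtype.ext (Homeomorph.ext fun x => ?_)
    refine congrFun (hq.eq_of_comp_eq τ.1.continuous τ'.1.continuous (funext fun y => ?_) x₀ h3) x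
    exact (τ.2 y).trans (τ'.2 y).symm
  · intro c
    induction c using Quotient.inductionOn with | _ γ
    have h0 : γ 0 = q x₀ := γ.source
    have h1 : q (hq.liftPath γ x₀ h0 1) = q x₀ :=
      (congrFun (hq.liftPath_lifts γ x₀ h0) 1).trans γ.target
    obtain ⟨τ, hτ⟩ := exists_deck_apply_eq hq h1
    refine ⟨τ, ?_⟩
    rw [deckClass_eq hq.continuous rfl τ
      ⟨hq.liftPath γ x₀ h0, hq.liftPath_zero γ x₀ h0, hτ.symm⟩]
    refine congrArg (fun c => FundamentalGroup.fromPath (Path.Homotopic.Quotient.mk c)) ?_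
    ext t
    exact congrFun (hq.liftPath_lifts γ x₀ h0) t

end Deck

/-! ### The twisted action on the pulled-back prequantisation. -/

namespace Prequantisation

section Pullback
variable {n : ℕ} {E E' : Type u} [TopologicalSpace E] [ChartedSpace (EuclideanSpace ℝ (Fin n)) E]
  [TopologicalSpace E'] [ChartedSpace (EuclideanSpace ℝ (Fin n)) E']
  [IsManifold (𝓡 n) ∞ E] [IsManifold (𝓡 n) ∞ E']
  {ħ : ℝ} {σ : DForm (𝓡 n) E 2} (P : Prequantisation ħ σ) {q : E' → E}
  (hq : IsLocalDiffeomorph (𝓡 n) (𝓡 n) ∞ q)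

theorem isLocalDiffeomorph_pullback_snd : IsLocalDiffeomorph (totalModel n) (totalModel n) ∞
    (fun y : (P.pullback q hq).Y => y.1.2) :=
  liftCharts_isLocalDiffeomorph
    (isLocalHomeomorph_snd hq.isLocalHomeomorph P.proj_smooth.continuous)

theorem morphAt_pullback_snd (y : (P.pullback q hq).Y) :
    MorphAt (P.pullback q hq) P (fun y => y.1.2) y :=
  ⟨(P.isLocalDiffeomorph_pullback_snd hq).contMDiff y, rfl⟩

variable {P hq}

theorem MorphAt.of_pullback_snd {σ' : DForm (𝓡 n) E' 2} {Q : Prequantisation ħ σ'}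
    {f : Q.Y → (P.pullback q hq).Y} (hf : ContMDiff (totalModel n) (totalModel n) ∞ f)
    {y : Q.Y} (h : MorphAt Q P (fun y => (f y).1.2) y) : MorphAt Q (P.pullback q hq) f y := by
  refine ⟨hf y, ?_⟩
  rw [← h.preserves]
  exact (DForm.pullAt_comp _ ((P.isLocalDiffeomorph_pullback_snd hq).mdifferentiable (by simp) _)
    (hf.mdifferentiable (by simp) y)).symm

variable [SimplyConnectedSpace E'] {e : E} {x₀ : E'} (hx₀ : q x₀ = e)
  (χ : FundamentalGroup E e →* Circle)

/-- `deckClass` reverses products, but its composite with a character is multiplicative because the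
circle is commutative. -/
theorem twistedLift_mul (τ τ' : deckGroup q) (y : (P.pullback q hq).Y) :
    P.twistedLift hq hx₀ χ (τ * τ') y =
      P.twistedLift hq hx₀ χ τ (P.twistedLift hq hx₀ χ τ' y) := by
  refine Subtype.ext (Prod.ext rfl ?_)
  change χ (deckClass hq.contMDiff.continuous hx₀ (τ * τ')) • y.1.2 =
    χ (deckClass hq.contMDiff.continuous hx₀ τ) • χ (deckClass hq.contMDiff.continuous hx₀ τ') •
      y.1.2
  rw [deckClass_mul, map_mul, smul_smul, mul_comm]

/-- The structure of the pullback is lifted along the local diffeomorphism `(x, ξ) ↦ ξ`, and after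
composition with it the map is a constant rotation of `ξ`. -/
theorem isMorphismOver_twistedLift (τ : deckGroup q) :
    IsMorphismOver (P.pullback q hq) (P.pullback q hq) τ.1 (P.twistedLift hq hx₀ χ τ) := by
  have h1 : ContMDiff (totalModel n) (totalModel n) ∞
      (fun y : (P.pullback q hq).Y => (P.twistedLift hq hx₀ χ τ y).1.2) :=
    (P.contMDiff_smul _).comp (P.isLocalDiffeomorph_pullback_snd hq).contMDiff
  have h2 : Continuous (P.twistedLift hq hx₀ χ τ) :=
    Continuous.subtype_mk ((τ.1.continuous.comp (continuous_fst.comp continuous_subtype_val)).prodMk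
      h1.continuous) _
  refine .of_morphAt (fun y => ?_) (fun _ => rfl) fun z y => ?_
  · exact MorphAt.of_pullback_snd
      (contMDiff_of_comp (P.isLocalDiffeomorph_pullback_snd hq) h2 h1)
      ((P.morphAt_pullback_snd hq y).const_smul _)
  · refine Subtype.ext (Prod.ext rfl ?_)
    change χ _ • z • y.1.2 = z • χ _ • y.1.2
    rw [smul_comm]

end Pullback

end Prequantisation

theorem IsLocalDiffeomorphAt.congr_of_eventuallyEq {F H F' H' M M' : Type*}
    [NormedAddCommGroup F] [NormedSpace ℝ F] [TopologicalSpace H]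
    [NormedAddCommGroup F'] [NormedSpace ℝ F'] [TopologicalSpace H']
    [TopologicalSpace M] [ChartedSpace H M] [TopologicalSpace M'] [ChartedSpace H' M']
    {I : ModelWithCorners ℝ F H} {I' : ModelWithCorners ℝ F' H'} {f g : M → M'} {x : M}
    (hf : IsLocalDiffeomorphAt I I' ∞ f x) (h : g =ᶠ[𝓝 x] f) :
    IsLocalDiffeomorphAt I I' ∞ g x := by
  obtain ⟨V, hV, hVo, hx⟩ := mem_nhds_iff.1 h
  let Ψ : PartialDiffeomorph I I M M ∞ :=
    { toPartialEquiv := PartialEquiv.ofSet V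
      open_source := hVo
      open_target := hVo
      contMDiffOn_toFun := contMDiffOn_id
      contMDiffOn_invFun := contMDiffOn_id }
  obtain ⟨Φ, hxΦ, hΦ⟩ := hf
  refine ⟨Ψ.trans Φ, ⟨hx, hxΦ⟩, fun y hy => ?_⟩
  exact (hV hy.1).trans (hΦ hy.2)

/-! ### Twisted quotients: uniqueness, and realisation by twists. -/

namespace Prequantisation

theorem isLocalDiffeomorph_smul {n : ℕ} {E : Type u} [TopologicalSpace E]
    [ChartedSpace (EuclideanSpace ℝ (Fin n)) E] {ħ : ℝ} {σ : DForm (𝓡 n) E 2}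
    (P : Prequantisation ħ σ) (z : Circle) :
    IsLocalDiffeomorph (totalModel n) (totalModel n) ∞ (fun y : P.Y => z • y) :=
  Diffeomorph.isLocalDiffeomorph
    ⟨MulAction.toPerm z, P.contMDiff_smul z, P.contMDiff_smul z⁻¹⟩

section Quotient
variable {n : ℕ} {E E' : Type u} [TopologicalSpace E] [ChartedSpace (EuclideanSpace ℝ (Fin n)) E]
  [TopologicalSpace E'] [ChartedSpace (EuclideanSpace ℝ (Fin n)) E']
  [IsManifold (𝓡 n) ∞ E] [IsManifold (𝓡 n) ∞ E']
  {ħ : ℝ} {σ : DForm (𝓡 n) E 2} {P Q Q' : Prequantisation ħ σ} {q : E' → E}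
  {hq : IsLocalDiffeomorph (𝓡 n) (𝓡 n) ∞ q}

section Descent
variable [PathConnectedSpace E'] {e : E} {x₀ : E'} {hx₀ : q x₀ = e}
  {χ : FundamentalGroup E e →* Circle}

theorem IsTwistedQuotient.of_equivalent (h : P.IsTwistedQuotient hq hx₀ χ Q)
    (hQ : Equivalent Q Q') : P.IsTwistedQuotient hq hx₀ χ Q' := by
  obtain ⟨p, hp, hs, ho, hm⟩ := h
  obtain ⟨f, hf⟩ := hQ
  refine ⟨f ∘ p, fun y => (hp y).comp (hg := f.isLocalDiffeomorph (p y)),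
    f.surjective.comp hs, fun y y' => ?_, hf.comp hm⟩
  rw [← ho]
  exact f.injective.eq_iff

/-- The two quotient maps have the same fibres, namely the orbits, so one factors through the other
set-theoretically; local inverses of the local diffeomorphism `p` show that the factor is a
morphism. -/
theorem IsTwistedQuotient.equivalent (h : P.IsTwistedQuotient hq hx₀ χ Q)
    (h' : P.IsTwistedQuotient hq hx₀ χ Q') : Equivalent Q Q' := by
  obtain ⟨p, hp, hs, ho, hm⟩ := h
  obtain ⟨p', -, -, ho', hm'⟩ := h'
  let f : Q.Y → Q'.Y := p' ∘ Function.surjInv hs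
  have hf : ∀ y, f (p y) = p' y := fun y => by
    refine (ho' _ _).2 ((ho _ _).1 ?_)
    exact Function.surjInv_eq hs (p y)
  refine IsMorphismOver.equivalent (f := f) (.of_morphAt (fun w => ?_) (fun w => ?_) fun z w => ?_)
  all_goals obtain ⟨y, rfl⟩ := hs w
  · set g := (hp y).localInverse
    have hgp : (p ∘ g) =ᶠ[𝓝 (p y)] id := (hp y).localInverse_eventuallyEq_right
    have hg : MorphAt Q (P.pullback q hq) g (p y) := by
      refine ⟨(hp y).localInverse_contMDiffAt, ?_⟩
      change ((P.pullback q hq).conn.toCLM (g (p y))).comp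
        (tder (totalModel n) (totalModel n) g (p y)) = _
      rw [← (hm.morphAt (g (p y))).preserves, ← DForm.pullAt_comp _
        (hm.smooth.mdifferentiable (by simp) _)
        ((hp y).localInverse_contMDiffAt.mdifferentiableAt (by simp)),
        DForm.pullAt_congr _ hgp, DForm.pullAt_id]
    refine ((hm'.morphAt _).comp hg).congr ?_
    filter_upwards [hgp] with w hw
    rw [Function.comp_apply, ← hf]
    exact congrArg f hw.symm
  · rw [hf, hm'.covers, id_eq, hm.covers]
  · rw [← hm.equivariant, hf, hf, hm'.equivariant]

end Descent

section Twist
variable [SimplyConnectedSpace E'] {e : E} {x₀ : E'} (hx₀ : q x₀ = e) (P) (D : FlatCocycle E)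

/-- A global parallel section `h` on the covering trivialises the pulled-back flat bundle and so
identifies the pullback of the twist with the pullback of `P`. The law `h (τ x) = D.holonomy e
(deckClass _ hx₀ τ) * h x` is the invariance of `(h x)⁻¹ • ξ` under the twisted action. -/
theorem isTwistedQuotient_twist (hc : IsCoveringMap q) (hqs : Function.Surjective q) :
    P.IsTwistedQuotient hq hx₀ (D.holonomy e) (P.twist D) := by
  have := ChartedSpace.locallyPathConnectedSpace (EuclideanSpace ℝ (Fin n)) E'
  obtain ⟨h, hh⟩ := D.exists_flatAlong hc.continuous
  let p : (P.pullback q hq).Y → Twist P D := fun y => ⟨(h y.1.1)⁻¹ • y.1.2⟩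
  have hpq : ∀ y, P.proj (p y).val = q y.1.1 := fun y => (P.proj_smul _ _).trans y.2.symm
  -- Parallelism of `h` makes its ratio to the cochain constant near `y`. So `p` is locally a
  -- composite of three local diffeomorphisms that respect the connection forms: the projection to
  -- `P`, a constant rotation and an inverse chart.
  have hp : ∀ y : (P.pullback q hq).Y, p =ᶠ[𝓝 y] (Twist.chart P D (q y.1.1)).symm ∘
      (fun ξ : P.Y => (h y.1.1 / D.c (q y.1.1) (q y.1.1))⁻¹ • ξ) ∘
      (fun y : (P.pullback q hq).Y => y.1.2) := fun y => by
    have h1 : ∀ᶠ y' : (P.pullback q hq).Y in 𝓝 y,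
        h y'.1.1 / D.c (q y.1.1) (q y'.1.1) = h y.1.1 / D.c (q y.1.1) (q y.1.1) :=
      (continuous_fst.comp continuous_subtype_val).continuousAt.eventually (hh y.1.1)
    refine h1.mono fun y' hy' => Twist.ext ?_
    have h2 : q y'.1.1 = P.proj y'.1.2 := y'.2
    simp only [Function.comp_apply]
    rw [Twist.chart_symm_apply, P.proj_smul, ← hy', h2, smul_smul, inv_div, ← mul_div_assoc,
      inv_mul_cancel, one_div]
  have htgt : ∀ y : (P.pullback q hq).Y,
      P.proj ((h y.1.1 / D.c (q y.1.1) (q y.1.1))⁻¹ • y.1.2) ∈ D.U (q y.1.1) := fun y => by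
    rw [P.proj_smul, ← show q y.1.1 = P.proj y.1.2 from y.2]
    exact D.mem_U _
  refine ⟨p, fun y => ?_, fun w => ?_, fun y y' => ?_, .of_morphAt (fun y => ?_) hpq fun z y => ?_⟩
  · refine IsLocalDiffeomorphAt.congr_of_eventuallyEq ?_ (hp y)
    exact ((P.isLocalDiffeomorph_pullback_snd hq y).comp
      (hg := P.isLocalDiffeomorph_smul (h y.1.1 / D.c (q y.1.1) (q y.1.1))⁻¹ y.1.2)).comp
      (hg := Twist.isLocalDiffeomorphAt_chart_symm (htgt y))
  · obtain ⟨x, hx⟩ := hqs (P.proj w.val)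
    refine ⟨⟨(x, h x • w.val), by rw [P.proj_smul]; exact hx⟩, Twist.ext ?_⟩
    change (h x)⁻¹ • h x • w.val = w.val
    rw [inv_smul_smul]
  · constructor
    · intro hy
      have h1 : q y'.1.1 = q y.1.1 := by rw [← hpq, ← hpq, hy]
      obtain ⟨τ, hτ⟩ := exists_deck_apply_eq hc h1
      refine ⟨τ, Subtype.ext (Prod.ext hτ ?_)⟩
      have h2 : (h y.1.1)⁻¹ • y.1.2 = (h y'.1.1)⁻¹ • y'.1.2 := congrArg Twist.val hy
      rw [← hτ, hh.deck_apply hc.continuous hx₀, eq_inv_smul_iff, smul_smul,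
        mul_inv_cancel_right] at h2
      exact h2
    · rintro ⟨τ, rfl⟩
      refine Twist.ext ?_
      change (h y.1.1)⁻¹ • y.1.2 = (h (τ.1 y.1.1))⁻¹ • D.holonomy e (deckClass _ hx₀ τ) • y.1.2
      rw [hh.deck_apply hc.continuous hx₀, eq_inv_smul_iff, smul_smul, mul_inv_cancel_right]
  · refine MorphAt.congr ?_ (hp y)
    exact MorphAt.comp (P' := P) (Twist.morphAt_chart_symm (htgt y))
      ((P.morphAt_pullback_snd hq y).const_smul _)
  · refine Twist.ext ?_
    change (h y.1.1)⁻¹ • z • y.1.2 = z • (h y.1.1)⁻¹ • y.1.2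
    rw [smul_comm]

end Twist

end Quotient

end Prequantisation

end

end Prequant

/-! ### The classification theorem. -/

open Prequant Prequantisation in
theorem mainTheorem4 {n : ℕ} {E : Type u} [TopologicalSpace E] [T2Space E]
    [SecondCountableTopology E] [ConnectedSpace E] [ChartedSpace (EuclideanSpace ℝ (Fin n)) E]
    [IsManifold (𝓡 n) ∞ E] (ħ : ℝ) (hħ : 0 < ħ) (σ : DForm (𝓡 n) E 2) (hσ : σ.Smooth)
    (hσ' : σ.d = 0) (e : E) (P₀ : Prequantisation ħ σ) :
    ∃ Φ : (FundamentalGroup E e →* Circle) ≃ Quotient (equivalenceSetoid ħ σ),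
      ∀ (E' : Type u) [TopologicalSpace E'] [ChartedSpace (EuclideanSpace ℝ (Fin n)) E']
        [IsManifold (𝓡 n) ∞ E'] [SimplyConnectedSpace E'] (q : E' → E) (_ : IsCoveringMap q)
        (hq : IsLocalDiffeomorph (𝓡 n) (𝓡 n) ∞ q) (x₀ : E') (hx₀ : q x₀ = e)
        (χ : FundamentalGroup E e →* Circle),
        Function.Bijective (deckClass hq.contMDiff.continuous hx₀) ∧
        (∀ τ τ' y, P₀.twistedLift hq hx₀ χ (τ * τ') y =
          P₀.twistedLift hq hx₀ χ τ (P₀.twistedLift hq hx₀ χ τ' y)) ∧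
        (∀ τ, IsMorphismOver (P₀.pullback q hq) (P₀.pullback q hq) τ.1
          (P₀.twistedLift hq hx₀ χ τ)) ∧
        ∀ P : Prequantisation ħ σ, Φ χ = Quotient.mk _ P ↔ P₀.IsTwistedQuotient hq hx₀ χ P := by
  have := ChartedSpace.locallyPathConnectedSpace (EuclideanSpace ℝ (Fin n)) E
  have : PathConnectedSpace E := pathConnectedSpace_iff_connectedSpace.2 inferInstance
  choose U hU hx hs using exists_isSimplyConnected_nhds (n := n) (E := E)
  let D : (FundamentalGroup E e →* Circle) → FlatCocycle E := fun χ =>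
    FlatCocycle.ofCharacter χ (fun x => PathConnectedSpace.somePath e x) hU hx hs
  have hD : ∀ χ, (D χ).holonomy e = χ := fun χ => FlatCocycle.holonomy_ofCharacter χ _ hU hx hs
  let φ : (FundamentalGroup E e →* Circle) → Quotient (equivalenceSetoid ħ σ) :=
    fun χ => Quotient.mk _ (P₀.twist (D χ))
  have hφ : Function.Bijective φ := by
    constructor
    · intro χ χ' h
      obtain ⟨u, hu⟩ := exists_isGauge_of_equivalent hħ (Quotient.exact h)
      rw [← hD χ, ← hD χ', hu.holonomy_eq]
    · intro c
      induction c using Quotient.inductionOn with | _ P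
      obtain ⟨D', hD'⟩ := exists_twist_equivalent P₀ P hħ
      refine ⟨D'.holonomy e, Quotient.sound ?_⟩
      -- The cocycle `D'` produced from `P` and the chosen cocycle with the same holonomy are gauge
      -- equivalent, so their twists are equivalent.
      obtain ⟨u, hu⟩ := FlatCocycle.exists_isGauge (hD (D'.holonomy e))
      exact (equivalenceSetoid ħ σ).trans (twist_equivalent_of_isGauge hu) hD'
  refine ⟨Equiv.ofBijective φ hφ, ?_⟩
  intro E' _ _ _ _ q hc hq x₀ hx₀ χ
  have := ChartedSpace.locallyPathConnectedSpace (EuclideanSpace ℝ (Fin n)) E'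
  have hqs : Function.Surjective q := Prequant.IsCoveringMap.surjective hc
  -- The representative of `Φ χ`, built on `E` alone, is a twisted quotient for every simply
  -- connected covering. Both directions of (ii) then follow: being such a quotient is invariant
  -- under equivalence and determines the class.
  have hT : P₀.IsTwistedQuotient hq hx₀ χ (P₀.twist (D χ)) := by
    have := isTwistedQuotient_twist (hq := hq) P₀ hx₀ (D χ) hc hqs
    rwa [hD] at this
  refine ⟨deckClass_bijective hc hx₀, twistedLift_mul hx₀ χ, isMorphismOver_twistedLift hx₀ χ,
    fun P => ⟨fun h => hT.of_equivalent (Quotient.exact h), fun h => Quotient.sound ?_⟩⟩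
  exact hT.equivalent h
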